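/- Let $k$ be a global field, let $L=\prod_{i=1}^r K_i$ be an étale $k$-algebra (each $K_i/k$ a finite separable field extension), and let $S$ be a nonempty finite set of places of $k$ containing all archimedean places. For a place $v$ of $k$ put $L_v=k_v\otimes_k L$, and for finite $v$ let $O_{L_v}$ be the integral closure in $L_v$ of the valuation ring $O_v$ of $k_v$. Let $\mathbb A_L^\times$ be the idele group of $L$, i.e. the restricted product of the groups $L_v^\times$ with respect to the $O_{L_v}^\times$, and put $$U_{L,S}=\prod_{v\in S}L_v^\times\times\prod_{v\notin S}O_{L_v}^\times,\qquad U_{k,S}=\prod_{v\in S}k_v^\times\times\prod_{v\notin S}O_v^\times .$$ Let $O_{L,S}=\{x\in L: x\in O_{L_v}\ \forall v\notin S\}$ and $O_{k,S}=\{x\in k: x\in O_v\ \forall v\notin S\}$. Let $N$ denote the norm from $L$ to $k$ on elements, ideles and ideals, and let the superscript $(1)$ denote the elements of norm one (the kernel of $N$). Let $I_{L,S}=\prod_i I_{K_i,S}$ be the product of the groups of nonzero fractional ideals of the rings $O_{K_i,S}$, $P_{L,S}$ its subgroup of (tuples of) principal ideals, $P_{L,S}^{+}$ the subgroup of (tuples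 of) principal ideals generated by totally positive elements, and $P_{L,S}^{(1)}=P_{L,S}\cap I_{L,S}^{(1)}$, $P_{L,S}^{(1)+}=P_{L,S}^{+}\cap I_{L,S}^{(1)}$. Let $T=T_{L/k}$ be the multinorm-one torus, the kernel of the norm $R_{L/k}\mathbb G_{m,L}\to\mathbb G_{m,k}$, so that $T(k)=L^{(1)}$ is the group of elements of $L^\times$ of norm one, $T(\mathbb A_k)=\mathbb A_L^{(1)}$, and $U_{T,S}=U_{L,S}^{(1)}$. Its $S$-class number is $$h_S(T)=\left|\,T(\mathbb A_k)/T(k)\,U_{T,S}\right| .$$ If $k$ is a number field, the narrow $S$-class number is $h_S^+(T)=\left|\,T(\mathbb A_k)/T(k)\,U_{T,S}^+\right|$, where $U_{T,S}^+$ consists of the $(x_v)\in U_{T,S}$ such that $x_v$ lies in the neutral component of $T(k_v)$ for every real place $v$ of $k$. Then $h_S(T)$ and the three indices below are finite and $$h_S(T_{L/k})=\frac{[I_{L,S}^{(1)}:P_{L,S}^{(1)}]\;[O_{k,S}^\times\cap N(L^\times):N(O_{L,S}^\times)]}{[U_{k,S}\cap N(\mathbb A_L^\times):N(U_{L,S})]}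 .$$ If $k$ is a number field, then $h_S^+(T)$ and the indices below are finite as well and $$h_S^+(T_{L/k})=\frac{[I_{L,S}^{(1)}:P_{L,S}^{(1)+}]\;[O_{k,S}^{\times+}\cap N(L^{\times+}):N(O_{L,S}^{\times+})]}{[U_{k,S}\cap N(\mathbb A_L^\times):N(U_{L,S})]},$$ where $^{+}$ on $k^\times$, $L^\times$ and their subgroups denotes the totally positive elements (positive under every real embedding, i.e. every ring homomorphism to $\mathbb R$). -/

import Mathlib

open scoped TensorProduct nonZeroDivisors

/-- Global fields: number fields, and function fields in one variable over a finite field.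
(A function field in one variable over a finite field of characteristic `p` is the same thing as a
finite extension of `𝔽_p(t)`.) -/
def IsGlobalField (k : Type*) [Field k] : Prop :=
  NumberField k ∨ ∃ (p : ℕ) (_ : Fact p.Prime) (_ : Algebra (RatFunc (ZMod p)) k),
    FunctionField (ZMod p) k

/-- The places of a global field `k`: the finite (nonarchimedean) places, given by the nontrivial
valuation rings of `k`, and the infinite (archimedean) places, given by the complex embeddings of
`k` up to conjugation (there are none in positive characteristic). -/
inductive Place (k : Type*) [Field k]
  | finite (A : ValuationSubring k) (hA : A ≠ ⊤) : Place k
  | infinite (w : NumberField.InfinitePlace k) : Place k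

namespace Place

noncomputable section

variable {k : Type*} [Field k]

/-- The completion `k_v` of `k` at the place `v`. -/
def Completion : Place k → Type _
  | .finite A _ => A.valuation.Completion
  | .infinite w => w.Completion

instance (v : Place k) : Field v.Completion :=
  match v with
  | .finite A _ => inferInstanceAs (Field A.valuation.Completion)
  | .infinite w => inferInstanceAs (Field w.Completion)

instance (v : Place k) : TopologicalSpace v.Completion :=
  match v with
  | .finite A _ => inferInstanceAs (TopologicalSpace A.valuation.Completion)
  | .infinite w => inferInstanceAs (TopologicalSpace w.Completion)

instance (v : Place k) : IsTopologicalRing v.Completion :=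
  match v with
  | .finite A _ => inferInstanceAs (IsTopologicalRing A.valuation.Completion)
  | .infinite w => inferInstanceAs (IsTopologicalRing w.Completion)

/-- The canonical embedding `k → k_v`. -/
def embed : (v : Place k) → k →+* v.Completion
  | .finite A _ => (UniformSpace.Completion.coeRingHom (α := WithVal A.valuation)).comp
      (WithVal.equiv A.valuation).symm.toRingHom
  | .infinite w => algebraMap k w.Completion

instance (v : Place k) : Algebra k v.Completion := v.embed.toAlgebra

/-- The valuation ring `O_v` of `k_v` if `v` is finite; by convention `O_v = k_v` if `v` is
infinite. -/
def integers : (v : Place k) → Subring v.Completion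
  | .finite A _ => (Valued.v : Valuation A.valuation.Completion A.ValueGroup).integer
  | .infinite _ => ⊤

/-- `v` is a real place. -/
def IsReal : Place k → Prop
  | .finite _ _ => False
  | .infinite w => w.IsReal

end

end Place

namespace MultinormTorus

noncomputable section

/-! ### Two facts on norms -/

theorem isIntegral_norm_of_finite {O F E : Type*} [CommRing O] [Field F] [CommRing E] [Algebra O F]
    [Algebra F E] [Algebra O E] [IsScalarTower O F E] [Module.Finite F E] {y : E}
    (hy : IsIntegral O y) : IsIntegral O (Algebra.norm F y) := by
  classical
  obtain ⟨p, hp, hpy⟩ := hy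
  let b := Module.finBasis F E
  let C := AlgebraicClosure F
  let M := Algebra.leftMulMatrix b y
  rw [← isIntegral_algebraMap_iff (algebraMap F C).injective, Algebra.norm_eq_matrix_det b,
    RingHom.map_det, Matrix.det_eq_prod_roots_charpoly]
  refine IsIntegral.multiset_prod fun μ hμ => ⟨p, hp, ?_⟩
  have hroot := (Polynomial.mem_roots'.1 hμ).2
  rw [← Matrix.mem_spectrum_iff_isRoot_charpoly] at hroot
  let q : Polynomial C := (p.map (algebraMap O F)).map (algebraMap F C)
  have hM : Polynomial.aeval M (p.map (algebraMap O F)) = 0 := by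
    rw [Polynomial.aeval_algHom_apply, Polynomial.aeval_map_algebraMap]
    have : Polynomial.aeval y p = 0 := hpy
    rw [this, map_zero]
  have hq : Polynomial.aeval ((algebraMap F C).mapMatrix M) q = 0 := by
    have : (algebraMap F C).mapMatrix M = (Algebra.ofId F C).mapMatrix M := rfl
    rw [this, Polynomial.aeval_map_algebraMap, Polynomial.aeval_algHom_apply, hM, map_zero]
  have hsub := spectrum.subset_polynomial_aeval ((algebraMap F C).mapMatrix M) q ⟨μ, hroot, rfl⟩
  rw [hq] at hsub
  have : Nontrivial (Matrix (Fin (Module.finrank F E)) (Fin (Module.finrank F E)) C) := by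
    by_contra h
    rw [not_nontrivial_iff_subsingleton] at h
    rw [spectrum.of_subsingleton] at hroot
    exact hroot
  rw [spectrum.zero_eq, Set.mem_singleton_iff] at hsub
  have h2 : Polynomial.eval μ q = 0 := hsub
  rw [IsScalarTower.algebraMap_eq O F C]
  simpa [q, Polynomial.eval_map, Polynomial.eval₂_map, Polynomial.map_map] using h2
theorem norm_one_tmul {k F E : Type*} [Field k] [Field F] [Algebra k F] [CommRing E] [Algebra k E] [Module.Finite k E] (x : E) :
    Algebra.norm F ((1 : F) ⊗ₜ[k] x) = algebraMap k F (Algebra.norm k x) := by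
  rw [Algebra.norm_apply, Algebra.norm_apply, ← LinearMap.det_baseChange]
  congr 1
  ext y
  simp

variable {k : Type*} [Field k]

/-! ### Local objects -/

section Local

variable (L : Type*) [CommRing L] [Algebra k L] (v : Place k)

/-- `L_v = k_v ⊗_k L`. -/
abbrev LocalAlg : Type _ := v.Completion ⊗[k] L

/-- `O_{L_v}`: the maximal `O_v`-order of `L_v`, that is, the integral closure of `O_v` in `L_v`. -/
def localOrder : Subring (LocalAlg L v) :=
  (integralClosure v.integers (LocalAlg L v)).toSubring

/-- `O_{L_v}^×` as a subgroup of `L_v^×`. -/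
def localUnits : Subgroup (LocalAlg L v)ˣ :=
  (localOrder L v).toSubmonoid.units

/-- The local norm `L_v^× → k_v^×`. -/
def localNorm : (LocalAlg L v)ˣ →* (v.Completion)ˣ :=
  Units.map (Algebra.norm v.Completion)

/-- `T_{L/k}(k_v)`: the elements of `L_v^×` of norm one. -/
def localTorus : Subgroup (LocalAlg L v)ˣ := (localNorm L v).ker

/-- The neutral component `T_{L/k}(k_v)^0` of the topological group `T_{L/k}(k_v)`. Here `L_v`
carries its topology as a finite-dimensional `k_v`-vector space, `L_v^×` the topology of the units
of a topological ring, and `T_{L/k}(k_v)` the subspace topology. -/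
def localTorusNeutral [Module.Finite k L] : Subgroup (LocalAlg L v)ˣ :=
  letI : TopologicalSpace (LocalAlg L v) := moduleTopology v.Completion (LocalAlg L v)
  haveI : IsModuleTopology v.Completion (LocalAlg L v) := ⟨rfl⟩
  haveI : IsTopologicalRing (LocalAlg L v) :=
    IsModuleTopology.isTopologicalRing v.Completion (LocalAlg L v)
  (Subgroup.connectedComponentOfOne (localTorus L v)).map (localTorus L v).subtype

end Local

/-! ### Ideles -/

section Ideles

variable (L : Type*) [CommRing L] [Algebra k L] (S : Finset (Place k))

/-- `A_L^×`, the idele group of `L`: families `(x_v)_v` with `x_v ∈ L_v^×` for every place `v` of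
`k`, and `x_v ∈ O_{L_v}^×` for almost all `v`. -/
def ideles : Subgroup (∀ v : Place k, (LocalAlg L v)ˣ) where
  carrier := {x | ∀ᶠ v in Filter.cofinite, x v ∈ localUnits L v}
  one_mem' := show ∀ᶠ v in Filter.cofinite, _ from
    Filter.Eventually.of_forall fun v => (localUnits L v).one_mem
  mul_mem' {x y} hx hy := by
    have hx : ∀ᶠ v in Filter.cofinite, x v ∈ localUnits L v := hx
    have hy : ∀ᶠ v in Filter.cofinite, y v ∈ localUnits L v := hy
    exact (hx.and hy).mono fun v h => (localUnits L v).mul_mem h.1 h.2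
  inv_mem' {x} hx := by
    have hx : ∀ᶠ v in Filter.cofinite, x v ∈ localUnits L v := hx
    exact hx.mono fun v h => (localUnits L v).inv_mem h

/-- `U_{L,S} = ∏_{v ∈ S} L_v^× × ∏_{v ∉ S} O_{L_v}^×`, the unit group of the `S`-adele ring. -/
def sUnitIdeles : Subgroup (∀ v : Place k, (LocalAlg L v)ˣ) :=
  Subgroup.pi {v | v ∉ S} (localUnits L)

/-- `U_{k,S} = ∏_{v ∈ S} k_v^× × ∏_{v ∉ S} O_v^×`. -/
def baseSUnitIdeles : Subgroup (∀ v : Place k, (v.Completion)ˣ) :=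
  Subgroup.pi {v | v ∉ S} (fun v => v.integers.toSubmonoid.units)

/-- The norm map on ideles, `(x_v)_v ↦ (N_{L_v/k_v}(x_v))_v`. -/
def ideleNorm : (∀ v : Place k, (LocalAlg L v)ˣ) →* (∀ v : Place k, (v.Completion)ˣ) :=
  MonoidHom.pi fun v => (localNorm L v).comp (Pi.evalMonoidHom _ v)

/-- The diagonal embedding of `L^×`. -/
def diagonal : Lˣ →* (∀ v : Place k, (LocalAlg L v)ˣ) :=
  MonoidHom.pi fun v => Units.map
    ((Algebra.TensorProduct.includeRight : L →ₐ[k] LocalAlg L v) : L →* LocalAlg L v)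

end Ideles

/-! ### The multinorm-one torus and its class groups -/

section Torus

variable (L : Type*) [CommRing L] [Algebra k L] (S : Finset (Place k))

/-- The norm `L^× → k^×`. -/
def globalNorm : Lˣ →* kˣ := Units.map (Algebra.norm k)

/-- `T_{L/k}(A_k)`, the ideles of `L` of norm one. -/
def adelicPoints : Subgroup (∀ v : Place k, (LocalAlg L v)ˣ) :=
  ideles L ⊓ (ideleNorm L).ker

/-- `T_{L/k}(k)`, the elements of `L^×` of norm one, embedded diagonally in the ideles. -/
def rationalPoints : Subgroup (∀ v : Place k, (LocalAlg L v)ˣ) :=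
  (globalNorm (k := k) L).ker.map (diagonal L)

/-- `U_{T,S} = ∏_{v ∈ S} T(k_v) × ∏_{v ∉ S} T(O_v)` for `T = T_{L/k}`. -/
def torusSUnits : Subgroup (∀ v : Place k, (LocalAlg L v)ˣ) :=
  sUnitIdeles L S ⊓ (ideleNorm L).ker

/-- `T(A_k)^+` for `T = T_{L/k}`: those `(x_v)_v ∈ T(A_k)` for which `x_v` lies in the neutral
component of `T(k_v)` for every real place `v`. -/
def adelicPointsPos [Module.Finite k L] : Subgroup (∀ v : Place k, (LocalAlg L v)ˣ) :=
  adelicPoints L ⊓ Subgroup.pi {v | v.IsReal} fun v => localTorusNeutral L v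

/-- The `S`-class group `Cl_S(T) = T(A_k) / T(k) U_{T,S}` of `T = T_{L/k}`. -/
abbrev TorusClassGroup : Type _ :=
  adelicPoints L ⧸ (rationalPoints L ⊔ torusSUnits L S).subgroupOf (adelicPoints L)

/-- The narrow `S`-class group `Cl_S^+(T) = T(A_k) / T(k) U_{T,S}^+` of `T = T_{L/k}`, where
`U_{T,S}^+ = U_{T,S} ∩ T(A_k)^+`. -/
abbrev NarrowTorusClassGroup [Module.Finite k L] : Type _ :=
  adelicPoints L ⧸
    (rationalPoints L ⊔ (torusSUnits L S ⊓ adelicPointsPos L)).subgroupOf (adelicPoints L)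

/-- The `S`-class number `h_S(T_{L/k})`. -/
def classNumber : ℕ := Nat.card (TorusClassGroup L S)

/-- The narrow `S`-class number `h_S^+(T_{L/k})`. -/
def narrowClassNumber [Module.Finite k L] : ℕ := Nat.card (NarrowTorusClassGroup L S)

end Torus

/-! ### `S`-integers and `S`-units -/

section SIntegers

variable (L : Type*) [CommRing L] [Algebra k L] (S : Finset (Place k))

/-- `O_{L,S} = L ∩ A_{L,S}`: the elements of `L` lying in `O_{L_v}` for all `v ∉ S`. -/
def sIntegers : Subring L :=
  ⨅ v : {v : Place k // v ∉ S}, (localOrder L v.1).comap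
    ((Algebra.TensorProduct.includeRight : L →ₐ[k] LocalAlg L v.1) : L →+* LocalAlg L v.1)

/-- `O_{k,S} = k ∩ A_{k,S}`: the elements of `k` lying in `O_v` for all `v ∉ S`. -/
def baseSIntegers : Subring k :=
  ⨅ v : {v : Place k // v ∉ S}, v.1.integers.comap (algebraMap k v.1.Completion)

/-- `O_{L,S}^×` as a subgroup of `L^×`. -/
def sUnits : Subgroup Lˣ := (sIntegers L S).toSubmonoid.units

/-- `O_{k,S}^×` as a subgroup of `k^×`. -/
def baseSUnits : Subgroup kˣ := (baseSIntegers S).toSubmonoid.units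

/-- The group of totally positive units of a ring `R`: those that are positive in every real
embedding. For an étale algebra `R` over a number field it is `R^{×+}`. -/
def totallyPositive (R : Type*) [CommRing R] : Subgroup Rˣ where
  carrier := {x | ∀ φ : R →+* ℝ, 0 < φ x}
  one_mem' φ := by simp
  mul_mem' {x y} hx hy φ := by
    rw [Units.val_mul, map_mul]
    exact mul_pos (hx φ) (hy φ)
  inv_mem' {x} hx φ := by
    have h : φ ((x⁻¹ : Rˣ) : R) * φ x = 1 := by rw [← map_mul, Units.inv_mul, map_one]
    exact pos_of_mul_pos_left (h ▸ one_pos) (hx φ).le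

variable {L S}

theorem norm_mem_integers (v : Place k) [Module.Finite k L] {y : LocalAlg L v}
    (hy : y ∈ localOrder L v) : Algebra.norm v.Completion y ∈ v.integers := by
  have h : IsIntegral v.integers (Algebra.norm v.Completion y) :=
    isIntegral_norm_of_finite (hy : IsIntegral v.integers y)
  cases v with
  | finite A hA =>
    exact (Valuation.integer.integers
      (Valued.v : Valuation A.valuation.Completion A.ValueGroup)).mem_of_integral h
  | infinite w => exact Subring.mem_top _

theorem norm_mem_baseSIntegers [Module.Finite k L] {x : L} (hx : x ∈ sIntegers L S) :
    Algebra.norm k x ∈ baseSIntegers (k := k) S := by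
  simp only [sIntegers, baseSIntegers, Subring.mem_iInf, Subring.mem_comap] at hx ⊢
  intro v
  rw [← norm_one_tmul]
  exact norm_mem_integers v.1 (hx v)

end SIntegers

/-! ### Ideals -/

section Ideals

variable {ι : Type*} [Fintype ι] (K : ι → Type*) [∀ i, Field (K i)] [∀ i, Algebra k (K i)]
  (S : Finset (Place k))

/-- `I_{L,S} = ∏ᵢ I_{Kᵢ,S}` for `L = ∏ᵢ Kᵢ`, where `I_{Kᵢ,S}` is the group of (invertible)
fractional ideals of `O_{Kᵢ,S}`. -/
abbrev SIdeals : Type _ := ∀ i, (FractionalIdeal (sIntegers (K i) S)⁰ (K i))ˣ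

variable {K S} in
/-- The relative norm `N_{L/k}(I) = ∏ᵢ N_{Kᵢ/k}(Iᵢ)` of `I = (Iᵢ)ᵢ ∈ I_{L,S}`, where `N_{Kᵢ/k}(J)`
is the `O_{k,S}`-submodule of `k` generated by the norms of the elements of `J`. -/
def idealNorm (I : SIdeals K S) : Submodule (baseSIntegers S) k :=
  ∏ i, Submodule.span (baseSIntegers S)
    ((fun x : K i => Algebra.norm k x) ''
      {x : K i | x ∈ (I i : FractionalIdeal (sIntegers (K i) S)⁰ (K i))})

theorem idealNorm_one [∀ i, Module.Finite k (K i)] : idealNorm (1 : SIdeals K S) = 1 := by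
  refine Finset.prod_eq_one fun i _ => le_antisymm ?_ ?_
  · rw [Submodule.span_le]
    rintro _ ⟨x, hx, rfl⟩
    obtain ⟨z, rfl⟩ := (FractionalIdeal.mem_one_iff _).1 hx
    exact Submodule.mem_one.2 ⟨⟨_, norm_mem_baseSIntegers z.2⟩, rfl⟩
  · rw [Submodule.one_eq_span, Submodule.span_le, Set.singleton_subset_iff]
    exact Submodule.subset_span ⟨1, FractionalIdeal.one_mem_one _, map_one _⟩

theorem idealNorm_mul_le (I J : SIdeals K S) :
    idealNorm I * idealNorm J ≤ idealNorm (I * J) := by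
  rw [idealNorm, idealNorm, idealNorm, ← Finset.prod_mul_distrib]
  gcongr with i
  rw [Submodule.span_mul_span, Submodule.span_le]
  rintro _ ⟨_, ⟨x, hx, rfl⟩, _, ⟨y, hy, rfl⟩, rfl⟩
  exact Submodule.subset_span ⟨x * y, FractionalIdeal.mul_mem_mul hx hy, map_mul _ _ _⟩

/-- `I_{L,S}^{(1)}`, the kernel of the norm `N_{L/k} : I_{L,S} → I_{k,S}`. (The norm being
multiplicative, the second condition follows from the first; it is written out so that the subgroup
axioms are immediate.) -/
def normOneIdeals [∀ i, Module.Finite k (K i)] : Subgroup (SIdeals K S) where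
  carrier := {I | idealNorm I = 1 ∧ idealNorm I⁻¹ = 1}
  one_mem' := by simp [idealNorm_one]
  mul_mem' {I J} hI hJ := by
    have key : ∀ I J : SIdeals K S, idealNorm I = 1 ∧ idealNorm I⁻¹ = 1 →
        idealNorm J = 1 ∧ idealNorm J⁻¹ = 1 → idealNorm (I * J) = 1 := by
      intro I J hI hJ
      apply le_antisymm
      · have h := idealNorm_mul_le K S (I * J) J⁻¹
        rwa [hJ.2, mul_one, mul_inv_cancel_right, hI.1] at h
      · have h := idealNorm_mul_le K S I J
        rwa [hI.1, hJ.1, one_mul] at h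
    refine ⟨key I J hI hJ, ?_⟩
    rw [show (I * J)⁻¹ = I⁻¹ * J⁻¹ from mul_inv I J]
    exact key _ _ ⟨hI.2, by rw [inv_inv]; exact hI.1⟩ ⟨hJ.2, by rw [inv_inv]; exact hJ.1⟩
  inv_mem' {I} hI := ⟨hI.2, by rw [inv_inv]; exact hI.1⟩

/-- Principal ideals of `L = ∏ᵢ Kᵢ` with generators in prescribed subgroups `Hᵢ ≤ Kᵢ^×`: those
`(Iᵢ)ᵢ ∈ I_{L,S}` with `Iᵢ = aᵢ O_{Kᵢ,S}`, `aᵢ ∈ Hᵢ`, for every `i`. -/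
def principalIdealsOf (H : ∀ i, Subgroup (K i)ˣ) : Subgroup (SIdeals K S) where
  carrier := {I | ∀ i, ∃ a ∈ H i, ((I i : FractionalIdeal (sIntegers (K i) S)⁰ (K i)) :
    Submodule (sIntegers (K i) S) (K i)) = Submodule.span _ {(a : K i)}}
  one_mem' i := ⟨1, (H i).one_mem, by
    simp [Submodule.one_eq_span]⟩
  mul_mem' {I J} hI hJ i := by
    obtain ⟨a, ha, hIa⟩ := hI i
    obtain ⟨b, hb, hJb⟩ := hJ i
    refine ⟨a * b, (H i).mul_mem ha hb, ?_⟩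
    simp [hIa, hJb, Submodule.span_mul_span]
  inv_mem' {I} hI i := by
    obtain ⟨a, ha, hIa⟩ := hI i
    refine ⟨a⁻¹, (H i).inv_mem ha, ?_⟩
    have h1 : (((I⁻¹) i : FractionalIdeal (sIntegers (K i) S)⁰ (K i)) :
        Submodule (sIntegers (K i) S) (K i)) * Submodule.span _ {(a : K i)} = 1 := by
      rw [← hIa, ← FractionalIdeal.coe_mul, Pi.inv_apply, Units.inv_mul, FractionalIdeal.coe_one]
    have h2 : Submodule.span (sIntegers (K i) S) {(a : K i)} *
        Submodule.span _ {((a⁻¹ : (K i)ˣ) : K i)} = 1 := by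
      rw [Submodule.span_mul_span, Set.singleton_mul_singleton, Units.mul_inv,
        Submodule.one_eq_span]
    rw [← mul_one (((I⁻¹) i : FractionalIdeal (sIntegers (K i) S)⁰ (K i)) :
      Submodule (sIntegers (K i) S) (K i)), ← h2, ← mul_assoc, h1, one_mul]

/-- `P_{L,S} = ∏ᵢ P_{Kᵢ,S}`, the principal ideals. -/
def principalIdeals : Subgroup (SIdeals K S) := principalIdealsOf K S fun _ => ⊤

/-- `P_{L,S}^+ = ∏ᵢ P_{Kᵢ,S}^+`, the principal ideals generated by totally positive elements. -/
def principalIdealsPos : Subgroup (SIdeals K S) :=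
  principalIdealsOf K S fun i => totallyPositive (K i)

end Ideals

end

end MultinormTorus

open MultinormTorus

/-!
Let `L = ∏ᵢ Kᵢ`. Two homomorphisms on the idele group of `L` carry the argument: the norm `N`, and
the map `φ` sending an idele to the ideal of `L` with the same valuations, whose kernel among the
ideles is `U_{L,S}`. For any homomorphisms `φ` and `N` on a commutative group `G`, and any subgroup
`V` of the target of `N` with `N (ker φ) ⊆ V`, the quotient of `N⁻¹(V)` by `ker φ · ker N` has two
descriptions:

* applying `φ`, it is `φ(N⁻¹(V)) / φ(ker N)`;
* applying `N`, it is `(V ∩ N(G)) / N(ker φ)`.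

Comparing these equalities of indices for `G` the group of ideles and for a subgroup `Γ` of it gives
`relIndex_mul_relIndex_eq`. With `V = U_{k,S}`, the group `φ(N⁻¹(V))` is the group of ideals of norm
one: an ideal is locally generated by an element of `L^×`, and the norm of the ideal is locally
generated by the norm of that element (`mem_normOneIdeals_iff`). With `Γ` the image of `L^×`,
the groups `φ(Γ)` and `Γ ∩ ker φ` are those of the principal ideals and of the `S`-units, and
`φ(ker N) / φ(Γ ∩ ker N)` is the class group of the torus (`relIndex_formula`,
`relIndex_rationalPoints_mul`).

The narrow formula is the same identity with `Γ` the image of the totally positive elements. What it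
needs in addition is `T(A_k) = T(k) · T(A_k)⁺` (`exists_normOne_mul_pos`). The neutral component of
`T(k_v)`, `v` real, consists of the elements that are positive at all homomorphisms `L_v → ℝ`
(`mem_adelicPointsPos_iff`): such an element is a square, and its square root is joined to `1` by a
segment of units, which can be rescaled to norm one. So an element of `T(k)` with prescribed signs
is needed, the product of the signs above each real embedding of `k` being `1`. It is obtained as
`N₁(y) / N₂(y)`, where `N₁` and `N₂` are the norms of `L ⊗ L` to its two factors and `y` is a unit
of `L ⊗ L` with suitable signs (`exists_norm_eq_one_sign_eq`); the norm of this element to `k` is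
`1` by transitivity.

All indices on one side of the formula are finite because class groups are finite and `S`-unit
groups are finitely generated, so that those on the other side are finite as well. The arithmetic of
global fields behind this rests on a single construction, `exists_polesEq`: the set `S` is,
archimedean places aside, the set of poles of an element `t`. The rings of `S`-integers are then the
intersections of the valuation rings containing `t`. For number fields they are localizations of the
rings of integers; for function fields they are integral closures of `𝔽_p[t]` in separable
extensions. A function with a single pole is found by the pigeonhole principle
(`exists_pole_only_at`), and separability is reached by minimizing the inseparable degree
(`exists_isSeparable`).
-/

/-! ### Index computations in commutative groups -/

namespace MultinormTorus
section IndexFormula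

variable {G I J : Type*} [CommGroup G] [CommGroup I] [CommGroup J]

/-- Both sides are the index of `ker φ · ker N` in `N⁻¹(V)`, computed after applying `φ` and `N`,
respectively. -/
theorem relIndex_map_ker_eq (φ : G →* I) (N : G →* J) (V : Subgroup J)
    (hU : φ.ker ≤ V.comap N) :
    (N.ker.map φ).relIndex ((V.comap N).map φ) = (φ.ker.map N).relIndex (V ⊓ N.range) := by
  rw [inf_comm, ← Subgroup.map_comap_eq, Subgroup.relIndex_map_map, Subgroup.relIndex_map_map,
    sup_comm, sup_eq_left.2 hU, sup_eq_left.2 (N.ker_le_comap V)]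

theorem map_subtype_ker_comp_subtype (f : G →* I) (Γ : Subgroup G) :
    (f.comp Γ.subtype).ker.map Γ.subtype = Γ ⊓ f.ker := by
  ext x
  simp [Subgroup.mem_map, MonoidHom.mem_ker, and_comm]

/-- The equality `relIndex_map_ker_eq` for the restrictions of `φ` and `N` to a subgroup `Γ`. -/
theorem relIndex_map_inf_ker_eq (φ : G →* I) (N : G →* J) (V : Subgroup J)
    (hU : φ.ker ≤ V.comap N) (Γ : Subgroup G) :
    ((Γ ⊓ N.ker).map φ).relIndex (Γ.map φ ⊓ (V.comap N).map φ) =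
      ((Γ ⊓ φ.ker).map N).relIndex (V ⊓ Γ.map N) := by
  have h := relIndex_map_ker_eq (φ.comp Γ.subtype) (N.comp Γ.subtype) V
    (by intro x hx; exact hU hx)
  have e2 : ((V.comap (N.comp Γ.subtype)).map (φ.comp Γ.subtype)) =
      Γ.map φ ⊓ (V.comap N).map φ := by
    ext y
    constructor
    · rintro ⟨x, hx, rfl⟩
      exact ⟨⟨x, x.2, rfl⟩, ⟨x, hx, rfl⟩⟩
    · rintro ⟨⟨x, hx, rfl⟩, ⟨z, hz, hzx⟩⟩
      refine ⟨⟨x, hx⟩, ?_, rfl⟩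
      have h1 : z⁻¹ * x ∈ φ.ker := by simp [MonoidHom.mem_ker, hzx]
      have := mul_mem (show z ∈ V.comap N from hz) (hU h1)
      simpa using this
  rw [e2, ← Subgroup.map_map, ← Subgroup.map_map, map_subtype_ker_comp_subtype,
    map_subtype_ker_comp_subtype, MonoidHom.range_comp, Subgroup.range_subtype] at h
  exact h

/-- The index between the images of `X ≤ T`, as an index in `T`. -/
theorem relIndex_map_of_le (φ : G →* I) {X T : Subgroup G} (hX : X ≤ T) :
    (X.map φ).relIndex (T.map φ) = (X ⊔ (φ.ker ⊓ T)).relIndex T := by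
  rw [Subgroup.relIndex_map_map]
  have h1 : T ⊔ φ.ker = T ⊔ (X ⊔ φ.ker) := by rw [← sup_assoc, sup_eq_left.2 hX]
  rw [h1, Subgroup.relIndex_sup_right, ← Subgroup.inf_relIndex_right, sup_inf_assoc_of_le _ hX]

/-- The quotient of `relIndex_map_ker_eq` for the whole group by the same equality for a subgroup
`Γ`, written without division. -/
theorem relIndex_mul_relIndex_eq (φ : G →* I) (N : G →* J) (V : Subgroup J)
    (hU : φ.ker ≤ V.comap N) (Γ : Subgroup G) :
    (Γ.map φ ⊓ (V.comap N).map φ).relIndex ((V.comap N).map φ) *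
        ((Γ ⊓ φ.ker).map N).relIndex (V ⊓ Γ.map N) =
      ((Γ ⊓ N.ker).map φ).relIndex (N.ker.map φ) * (φ.ker.map N).relIndex (V ⊓ N.range) := by
  -- Both products are the index of `φ(Γ ∩ ker N)` in `φ(N⁻¹(V))`, along the chains through
  -- `φ(Γ) ∩ φ(N⁻¹(V))` and through `φ(ker N)`.
  rw [← relIndex_map_inf_ker_eq φ N V hU Γ, ← relIndex_map_ker_eq φ N V hU,
    Subgroup.relIndex_mul_relIndex _ _ _ (Subgroup.map_mono inf_le_right)
      (Subgroup.map_mono (N.ker_le_comap V)), mul_comm,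
    Subgroup.relIndex_mul_relIndex _ _ _ _ inf_le_right]
  refine le_inf (Subgroup.map_mono inf_le_left) (Subgroup.map_mono ?_)
  exact inf_le_right.trans (N.ker_le_comap V)

/-- If `T = (Γ ∩ T) T⁺` and `T⁺` has the same image under `φ` as `T`, then the index of
`(Γ ∩ T)(ker φ ∩ T⁺)` in `T` can be computed in the image. -/
theorem relIndex_sup_inf_eq (φ : G →* I) {Γ T Tp : Subgroup G} (hTp : Tp ≤ T)
    (hT : T ≤ (Γ ⊓ T) ⊔ Tp) (hφ : T.map φ ≤ Tp.map φ) :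
    ((Γ ⊓ T) ⊔ (φ.ker ⊓ Tp)).relIndex T = ((Γ ⊓ Tp).map φ).relIndex (T.map φ) := by
  have h0 : T.map φ = Tp.map φ := le_antisymm hφ (Subgroup.map_mono hTp)
  rw [h0, relIndex_map_of_le φ inf_le_right]
  have h1 : T = Tp ⊔ ((Γ ⊓ T) ⊔ (φ.ker ⊓ Tp)) := by
    apply le_antisymm
    · exact hT.trans (sup_le (le_sup_left.trans le_sup_right) le_sup_left)
    · exact sup_le hTp (sup_le inf_le_right (inf_le_right.trans hTp))
  conv_lhs => rw [h1, ← h1]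
  have h2 : ((Γ ⊓ T) ⊔ (φ.ker ⊓ Tp)).relIndex T =
      ((Γ ⊓ T) ⊔ (φ.ker ⊓ Tp)).relIndex (Tp ⊔ ((Γ ⊓ T) ⊔ (φ.ker ⊓ Tp))) := by rw [← h1]
  rw [h2, Subgroup.relIndex_sup_right, ← Subgroup.inf_relIndex_right, sup_comm (Γ ⊓ T),
    sup_inf_assoc_of_le _ inf_le_right, sup_comm, inf_assoc, inf_eq_right.2 hTp]

/-- A subgroup of a finitely generated commutative group containing all `n`-th powers has
finite index. -/
theorem relIndex_ne_zero_of_pow_mem {A B : Subgroup G} (hfg : A.FG) {n : ℕ} (hn : n ≠ 0)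
    (h : ∀ x ∈ A, x ^ n ∈ B) : B.relIndex A ≠ 0 := by
  have : Group.FG A := (Group.fg_iff_subgroup_fg A).2 hfg
  have hfin : Finite (A ⧸ B.subgroupOf A) := by
    apply CommGroup.finite_of_fg_isMulTorsion
    intro x
    obtain ⟨a, rfl⟩ := QuotientGroup.mk_surjective x
    rw [isOfFinOrder_iff_pow_eq_one]
    refine ⟨n, Nat.pos_of_ne_zero hn, ?_⟩
    rw [← QuotientGroup.mk_pow, QuotientGroup.eq_one_iff]
    exact h a a.2
  exact (Subgroup.finiteIndex_of_finite_quotient (H := B.subgroupOf A)).index_ne_zero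

/-- An extension of a subgroup of `ℤ^m` by a finitely generated group is finitely generated. -/
theorem fg_of_fg_ker {α : Type*} [Finite α] (f : G →* (α → Multiplicative ℤ)) (hf : f.ker.FG) :
    Group.FG G := by
  let F : Additive G →ₗ[ℤ] (α → ℤ) :=
    { toFun := fun x i => (f x.toMul i).toAdd
      map_add' := fun x y => by ext i; simp
      map_smul' := fun n x => by ext i; simp }
  have hK : (LinearMap.ker F).FG := by
    rw [Submodule.fg_iff_addSubgroup_fg]
    have h1 : (LinearMap.ker F).toAddSubgroup = Subgroup.toAddSubgroup f.ker := by
      ext x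
      simp only [Submodule.mem_toAddSubgroup, LinearMap.mem_ker]
      change F x = 0 ↔ f x.toMul = 1
      rw [funext_iff, funext_iff]
      exact Iff.rfl
    rw [h1]
    exact (Subgroup.fg_iff_add_fg _).1 hf
  have h2 : (⊤ : Submodule ℤ (Additive G)).FG := by
    refine Submodule.fg_of_fg_map_of_fg_inf_ker F (IsNoetherian.noetherian _) ?_
    rwa [top_inf_eq]
  have h3 : Module.Finite ℤ (Additive G) := ⟨h2⟩
  rw [Group.fg_iff_monoid_fg, Monoid.fg_iff_add_fg, ← AddGroup.fg_iff_addMonoid_fg]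
  exact Module.Finite.iff_addGroup_fg.1 h3

end IndexFormula

/-! ### Valuation rings above Dedekind domains -/

section Dedekind
open IsDedekindDomain WithZero

variable {D K : Type*} [CommRing D] [IsDedekindDomain D] [Field K] [Algebra D K]
  [IsFractionRing D K]

/-- Every nontrivial valuation ring of the fraction field of a Dedekind domain `D` containing `D`
is the localization of `D` at a prime. -/
theorem exists_valuationSubring_eq {B : ValuationSubring K} (hD : ∀ d : D, algebraMap D K d ∈ B)
    (hB : B ≠ ⊤) : ∃ P : HeightOneSpectrum D, (P.valuation K).valuationSubring = B := by
  -- The prime is the trace on `D` of the maximal ideal of `B`. The localization of `D` there is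
  -- contained in `B`, and equal to it because it is a discrete valuation ring.
  let f : D →+* B := (algebraMap D K).codRestrict B hD
  let p : Ideal D := (IsLocalRing.maximalIdeal B).comap f
  have hp : p.IsPrime := Ideal.IsPrime.comap f
  have hmem : ∀ d : D, d ∈ p ↔ B.valuation (algebraMap D K d) < 1 := fun d =>
    B.valuation_lt_one_iff (f d)
  have hp0 : p ≠ ⊥ := by
    intro h0
    apply hB
    rw [eq_top_iff]
    rintro x -
    obtain ⟨n, d, hd, rfl⟩ := IsFractionRing.div_surjective (A := D) x
    rw [div_eq_mul_inv]
    refine mul_mem (hD n) ?_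
    have hd0 : d ∉ p := by rw [h0, Ideal.mem_bot]; exact nonZeroDivisors.ne_zero hd
    rw [hmem, not_lt] at hd0
    rw [← B.valuation_le_one_iff, map_inv₀]
    exact inv_le_one_of_one_le₀ hd0
  let P : HeightOneSpectrum D := ⟨p, hp, hp0⟩
  refine ⟨P, ?_⟩
  have hunit : ∀ d : D, d ∉ p → algebraMap D K d ≠ 0 ∧ B.valuation (algebraMap D K d) = 1 := by
    intro d hd
    have h1 : B.valuation (algebraMap D K d) = 1 :=
      le_antisymm ((B.valuation_le_one_iff _).2 (hD d)) (not_lt.1 ((hmem d).not.1 hd))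
    refine ⟨fun h => ?_, h1⟩
    rw [h, map_zero] at h1
    exact zero_ne_one h1
  rw [← HeightOneSpectrum.valuationSubringAtPrime_eq_valuationSubring]
  refine ValuationSubring.eq_of_le_of_ne_top _ ?_ hB
  rw [HeightOneSpectrum.valuationSubringAtPrime_eq_valuationSubring]
  intro x hx
  obtain ⟨n, ⟨d, hd⟩, h⟩ := P.exists_primeCompl_mul_eq_of_integer x hx
  have h2 := congrArg B.valuation h
  rw [map_mul, (hunit d hd).2, mul_one] at h2
  rw [← B.valuation_le_one_iff, h2]
  exact (B.valuation_le_one_iff _).2 (hD _)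

theorem valuationSubring_ne_top (P : HeightOneSpectrum D) :
    (P.valuation K).valuationSubring ≠ ⊤ := by
  simp only [ne_eq, Valuation.valuationSubring_eq_top_iff, not_not]; infer_instance

/-- There are no inclusions between the localizations of a Dedekind domain at distinct primes. -/
theorem eq_of_valuationSubring_le {P Q : HeightOneSpectrum D}
    (h : (P.valuation K).valuationSubring ≤ (Q.valuation K).valuationSubring) : P = Q := by
  have hle : Q.asIdeal ≤ P.asIdeal := by
    intro d hd
    by_contra hdP
    have h1 : P.valuation K (algebraMap D K d) = 1 := (P.valuation_eq_one_iff_notMem).2 hdP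
    have h2 : (algebraMap D K d)⁻¹ ∈ (P.valuation K).valuationSubring := by
      rw [Valuation.mem_valuationSubring_iff, map_inv₀, h1, inv_one]
    have h3 := h h2
    rw [Valuation.mem_valuationSubring_iff, map_inv₀] at h3
    have h4 := (Q.valuation_lt_one_iff_mem (K := K) d).2 hd
    have h5 : Q.valuation K (algebraMap D K d) ≠ 0 := by
      intro h0
      rw [Valuation.zero_iff] at h0
      rw [h0, map_zero] at h1
      exact zero_ne_one h1
    exact absurd h3 (not_le.2 ((one_lt_inv₀ (zero_lt_iff.2 h5)).2 h4))
  have := Q.isMaximal.eq_of_le P.isPrime.ne_top hle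
  exact HeightOneSpectrum.ext this.symm

/-! ### Fractional ideals and exponents -/

/-- The valuation of an element is given by the exponents of the fractional ideal that it generates.
-/
theorem count_spanSingleton (P : HeightOneSpectrum D) {x : K} (hx : x ≠ 0) :
    P.valuation K x = exp (-(FractionalIdeal.count K P (FractionalIdeal.spanSingleton D⁰ x))) := by
  classical
  have key : ∀ r : D, r ≠ 0 → P.valuation K (algebraMap D K r) =
      exp (-(FractionalIdeal.count K P (FractionalIdeal.spanSingleton D⁰ (algebraMap D K r)))) := by
    intro r hr
    rw [HeightOneSpectrum.valuation_of_algebraMap, HeightOneSpectrum.intValuation_if_neg _ hr,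
      ← FractionalIdeal.coeIdeal_span_singleton, FractionalIdeal.count_coe]
    rwa [ne_eq, Submodule.zero_eq_bot, Ideal.span_singleton_eq_bot]
  obtain ⟨n, d, hd, rfl⟩ := IsFractionRing.div_surjective (A := D) x
  have hd0 := nonZeroDivisors.ne_zero hd
  have hn0 : n ≠ 0 := by rintro rfl; simp at hx
  have inj := IsFractionRing.injective D K
  have hd1 : algebraMap D K d ≠ 0 := by rwa [ne_eq, map_eq_zero_iff _ inj]
  have hn1 : algebraMap D K n ≠ 0 := by rwa [ne_eq, map_eq_zero_iff _ inj]
  have h2 : FractionalIdeal.count K P (FractionalIdeal.spanSingleton D⁰ (algebraMap D K n)) =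
      FractionalIdeal.count K P (FractionalIdeal.spanSingleton D⁰
        (algebraMap D K n / algebraMap D K d)) +
      FractionalIdeal.count K P (FractionalIdeal.spanSingleton D⁰ (algebraMap D K d)) := by
    rw [← FractionalIdeal.count_mul, FractionalIdeal.spanSingleton_mul_spanSingleton,
      div_mul_cancel₀ _ hd1]
    · rw [FractionalIdeal.spanSingleton_ne_zero_iff]; exact hx
    · rwa [FractionalIdeal.spanSingleton_ne_zero_iff]
  rw [map_div₀, key n hn0, key d hd0, h2, ← exp_sub]
  congr 1
  ring

theorem valuation_le_of_mem (P : HeightOneSpectrum D) {I : FractionalIdeal D⁰ K} {y : K}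
    (hy : y ∈ I) : P.valuation K y ≤ exp (-(FractionalIdeal.count K P I)) := by
  obtain rfl | hy0 := eq_or_ne y 0
  · simp
  rw [count_spanSingleton P hy0, exp_le_exp, neg_le_neg_iff]
  apply FractionalIdeal.count_mono
  · rwa [FractionalIdeal.spanSingleton_ne_zero_iff]
  · rwa [FractionalIdeal.spanSingleton_le_iff_mem]

/-- A fractional ideal contains an element whose order at finitely many given primes is the least
possible one. -/
theorem exists_mem_valuation_eq {I : FractionalIdeal D⁰ K} (hI : I ≠ 0)
    (F : Finset (HeightOneSpectrum D)) :
    ∃ y ∈ I, y ≠ 0 ∧ ∀ P ∈ F, P.valuation K y = exp (-(FractionalIdeal.count K P I)) := by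
  obtain rfl | ⟨P₀, hP₀⟩ := F.eq_empty_or_nonempty
  · obtain ⟨y, hy, h0⟩ := Submodule.exists_mem_ne_zero_of_ne_bot
      (p := (I : Submodule D K)) (by rwa [ne_eq, FractionalIdeal.coeToSubmodule_eq_bot])
    exact ⟨y, hy, h0, by simp⟩
  have hP0 : ∀ P : HeightOneSpectrum D, (P.asIdeal : FractionalIdeal D⁰ K) ≠ 0 := fun P =>
    FractionalIdeal.coeIdeal_ne_zero.2 P.ne_bot
  have hP1 : ∀ P : HeightOneSpectrum D, (P.asIdeal : FractionalIdeal D⁰ K) ≤ 1 := fun P =>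
    FractionalIdeal.coeIdeal_le_one
  have hle : ∀ P ∈ F, ∏ Q ∈ F, (Q.asIdeal : FractionalIdeal D⁰ K) ≤ P.asIdeal := by
    classical
    intro P hP
    rw [← Finset.mul_prod_erase _ _ hP]
    calc _ ≤ (P.asIdeal : FractionalIdeal D⁰ K) * 1 := by
            gcongr
            exact Finset.prod_le_one' fun Q _ => hP1 Q
      _ = _ := mul_one _
  have h1 : I * ∏ Q ∈ F, (Q.asIdeal : FractionalIdeal D⁰ K) ≤ I := by
    calc _ ≤ I * 1 := by
            gcongr
            exact Finset.prod_le_one' fun Q _ => hP1 Q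
      _ = _ := mul_one _
  -- Modulo `I ∏ P` the ideal `I` is generated by one element `y`, which thus lies in no `I P`.
  obtain ⟨y, hy⟩ := IsDedekindDomain.exists_add_spanSingleton_mul_eq h1
    (mul_ne_zero hI (Finset.prod_ne_zero_iff.2 fun P _ => hP0 P)) one_ne_zero
  rw [mul_one] at hy
  have hyI : y ∈ I := by
    rw [← FractionalIdeal.spanSingleton_le_iff_mem, ← hy]
    exact le_add_self
  have hyP : ∀ P ∈ F, ¬ FractionalIdeal.spanSingleton D⁰ y ≤ I * P.asIdeal := by
    intro P hP h
    have h2 : I ≤ I * P.asIdeal := by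
      conv_lhs => rw [← hy]
      rw [← FractionalIdeal.sup_eq_add]
      refine sup_le ?_ h
      gcongr
      exact hle P hP
    have h3 : I⁻¹ * I ≤ I⁻¹ * (I * P.asIdeal) := by gcongr
    rw [← mul_assoc, inv_mul_cancel₀ hI, one_mul, ← FractionalIdeal.coeIdeal_top,
      FractionalIdeal.coeIdeal_le_coeIdeal] at h3
    exact P.isPrime.ne_top (top_le_iff.1 h3)
  have hy0 : y ≠ 0 := by
    rintro rfl
    exact hyP P₀ hP₀ (by simp)
  refine ⟨y, hyI, hy0, fun P hP => ?_⟩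
  have hs0 : FractionalIdeal.spanSingleton D⁰ y ≠ 0 := by
    rwa [FractionalIdeal.spanSingleton_ne_zero_iff]
  have h4 : I⁻¹ * FractionalIdeal.spanSingleton D⁰ y ≤ 1 := by
    rw [← inv_mul_cancel₀ hI]
    gcongr
    rwa [FractionalIdeal.spanSingleton_le_iff_mem]
  obtain ⟨J, hJ⟩ := FractionalIdeal.le_one_iff_exists_coeIdeal.1 h4
  have h5 : FractionalIdeal.spanSingleton D⁰ y = I * J := by
    rw [hJ, ← mul_assoc, mul_inv_cancel₀ hI, one_mul]
  have hJ0 : J ≠ 0 := by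
    rintro rfl
    rw [Submodule.zero_eq_bot, FractionalIdeal.coeIdeal_bot, mul_zero] at h5
    exact hs0 h5
  have h6 : FractionalIdeal.count K P (J : FractionalIdeal D⁰ K) = 0 := by
    classical
    rw [FractionalIdeal.count_coe K P hJ0, Nat.cast_eq_zero]
    by_contra hc
    rw [← ne_eq, Associates.count_ne_zero_iff_dvd hJ0 P.irreducible, Ideal.dvd_iff_le] at hc
    refine hyP P hP ?_
    rw [h5]
    gcongr
  rw [count_spanSingleton P hy0, h5, FractionalIdeal.count_mul K P hI
    (FractionalIdeal.coeIdeal_ne_zero.2 hJ0), h6, add_zero]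

end Dedekind

/-! ### Integral closures as intersections of valuation rings -/

section ValuationIntegral

variable {R K : Type*} [CommRing R] [Field K] [Algebra R K]

/-- The integral closure of a ring in a field is the intersection of the valuation rings
above it. -/
theorem isIntegral_iff_forall_valuationSubring {y : K} :
    IsIntegral R y ↔ ∀ B : ValuationSubring K, (∀ r : R, algebraMap R K r ∈ B) → y ∈ B := by
  constructor
  · rintro ⟨q, hq, hqy⟩ B hB
    let f : R →+* B := (algebraMap R K).codRestrict B hB
    have h1 : IsIntegral B y := by
      refine ⟨q.map f, hq.map f, ?_⟩
      rw [Polynomial.eval₂_map]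
      exact hqy
    obtain ⟨b, rfl⟩ := IsIntegrallyClosed.isIntegral_iff.1 h1
    exact b.2
  · intro h
    have h1 : y ∈
        (integralClosure (Subring.closure ((algebraMap R K).range : Set K)) K).toSubring := by
      rw [← iInf_valuationSubring_superset, Subring.mem_iInf]
      rintro ⟨B, hB⟩
      exact h B fun a => hB ⟨a, rfl⟩
    have h2 : IsIntegral (Subring.closure ((algebraMap R K).range : Set K)) y := h1
    rw [Subring.closure_eq] at h2
    let : Algebra R (algebraMap R K).range := (algebraMap R K).rangeRestrict.toAlgebra
    have : IsScalarTower R (algebraMap R K).range K := .of_algebraMap_eq fun _ => rfl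
    have : Algebra.IsIntegral R (algebraMap R K).range :=
      Algebra.isIntegral_of_surjective (algebraMap R K).rangeRestrict_surjective
    exact isIntegral_trans y h2

/-- In a Dedekind domain `D`, an element that is integral away from `u` becomes integral after
multiplication with a power of `u`. -/
theorem exists_pow_mul_eq {D : Type*} [CommRing D] [IsDedekindDomain D] [Algebra D K]
    [IsFractionRing D K] (u : D) {y : K}
    (h : ∀ B : ValuationSubring K, (∀ d : D, algebraMap D K d ∈ B) →
      (algebraMap D K u)⁻¹ ∈ B → y ∈ B) :
    ∃ (c : ℕ) (d : D), algebraMap D K u ^ c * y = algebraMap D K d := by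
  -- The ideal of denominators of `y`: its prime divisors contain `u`, so that its radical does.
  let J : Ideal D :=
    { carrier := {d | ∃ e : D, algebraMap D K d * y = algebraMap D K e}
      zero_mem' := ⟨0, by simp⟩
      add_mem' := by
        rintro a b ⟨e, he⟩ ⟨f, hf⟩
        exact ⟨e + f, by rw [map_add, add_mul, he, hf, map_add]⟩
      smul_mem' := by
        rintro a b ⟨e, he⟩
        exact ⟨a * e, by rw [smul_eq_mul, map_mul, mul_assoc, he, map_mul]⟩ }
  have hJ0 : J ≠ ⊥ := by
    obtain ⟨n, d, hd, rfl⟩ := IsFractionRing.div_surjective (A := D) y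
    have hd0 := nonZeroDivisors.ne_zero hd
    intro h0
    have h1 : d ∈ J := ⟨n, by
      rw [mul_div_cancel₀]
      rwa [ne_eq, map_eq_zero_iff _ (IsFractionRing.injective D K)]⟩
    rw [h0] at h1
    exact hd0 h1
  have hu : u ∈ J.radical := by
    rw [Ideal.radical_eq_sInf, Submodule.mem_sInf]
    rintro p ⟨hJp, hp⟩
    by_contra hup
    let P : IsDedekindDomain.HeightOneSpectrum D :=
      ⟨p, hp, fun h0 => hJ0 (eq_bot_iff.2 (h0 ▸ hJp))⟩
    have hy : y ∈ (P.valuation K).valuationSubring := by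
      refine h _ (fun d => P.valuation_le_one d) ?_
      rw [Valuation.mem_valuationSubring_iff, map_inv₀, P.valuation_eq_one_iff_notMem.2 hup,
        inv_one]
    obtain ⟨n, ⟨d, hd⟩, hnd⟩ := P.exists_primeCompl_mul_eq_of_integer y hy
    exact hd (hJp ⟨n, by rw [mul_comm]; exact hnd⟩)
  obtain ⟨c, e, he⟩ := hu
  exact ⟨c, e, by rw [← map_pow]; exact he⟩

/-- The intersection of the valuation rings containing `t`, that is, the integral closure of
`ℤ[t]`. -/
def poleRing (t : K) : Subring K := ⨅ A : {A : ValuationSubring K // t ∈ A}, A.1.toSubring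

theorem mem_poleRing {t x : K} : x ∈ poleRing t ↔ ∀ A : ValuationSubring K, t ∈ A → x ∈ A := by
  simp [poleRing, Subring.mem_iInf]

theorem self_mem_poleRing (t : K) : t ∈ poleRing t := mem_poleRing.2 fun _ h => h

end ValuationIntegral

/-! ### Function fields: separating elements -/

section FunctionFields
open IntermediateField Polynomial IsDedekindDomain

variable {p : ℕ} [Fact p.Prime] {k : Type*} [Field k] [Algebra (ZMod p) k]

theorem algebraMap_zmod_mem (A : ValuationSubring k) (c : ZMod p) :
    algebraMap (ZMod p) k c ∈ A := by
  rw [← ZMod.natCast_zmod_val c, map_natCast]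
  exact natCast_mem A _

theorem aeval_mem {A : ValuationSubring k} {t : k} (ht : t ∈ A) (f : (ZMod p)[X]) :
    aeval t f ∈ A := by
  rw [aeval_eq_sum_range]
  refine sum_mem fun i _ => ?_
  rw [Algebra.smul_def]
  exact mul_mem (algebraMap_zmod_mem A _) (pow_mem ht _)

/-- The constants of `k` are the functions without poles. -/
theorem isAlgebraic_iff_forall_mem {x : k} :
    IsAlgebraic (ZMod p) x ↔ ∀ A : ValuationSubring k, x ∈ A := by
  rw [isAlgebraic_iff_isIntegral, isIntegral_iff_forall_valuationSubring]
  exact forall_congr' fun A => ⟨fun h => h fun r => algebraMap_zmod_mem A r, fun h _ => h⟩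

variable (p) in
/-- The ring structure of `poleRing t` as the integral closure of `𝔽_p[t]`. -/
theorem isIntegralClosure_poleRing (t : k) :
    letI := (aeval (R := ZMod p) t).toAlgebra
    IsIntegralClosure (poleRing t) (ZMod p)[X] k := by
  let := (aeval (R := ZMod p) t).toAlgebra
  refine ⟨Subtype.val_injective, fun {x} => ?_⟩
  rw [isIntegral_iff_forall_valuationSubring]
  constructor
  · intro h
    refine ⟨⟨x, mem_poleRing.2 fun A hA => h A fun r => aeval_mem hA r⟩, rfl⟩
  · rintro ⟨y, rfl⟩ A hA
    refine mem_poleRing.1 y.2 A ?_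
    have := hA X
    rwa [show algebraMap (ZMod p)[X] k X = t from aeval_X t] at this

/-- For transcendental `t`, the field `𝔽_p(t)` is the fraction field of the polynomial ring. -/
theorem isFractionRing_adjoin {t : k} (ht : Transcendental (ZMod p) t) :
    letI := (aeval (R := ZMod p) (AdjoinSimple.gen (ZMod p) t)).toAlgebra
    IsFractionRing (ZMod p)[X] (ZMod p)⟮t⟯ := by
  let := (aeval (R := ZMod p) (AdjoinSimple.gen (ZMod p) t)).toAlgebra
  let e : RatFunc (ZMod p) ≃ₐ[(ZMod p)[X]] (ZMod p)⟮t⟯ :=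
    AlgEquiv.ofRingEquiv (f := (RatFunc.algEquivOfTranscendental t ht).toRingEquiv) fun r => by
      exact RatFunc.algEquivOfTranscendental_algebraMap t ht r
  exact IsLocalization.isLocalization_of_algEquiv _ e

/-- If `k` is finite separable over `𝔽_p(t)` then the integral closure of `𝔽_p[t]` in `k` is a
Dedekind domain with fraction field `k` and finite class group. -/
theorem poleRing_dedekind {t : k} (ht : Transcendental (ZMod p) t)
    [FiniteDimensional (ZMod p)⟮t⟯ k] [Algebra.IsSeparable (ZMod p)⟮t⟯ k] :
    IsDedekindDomain (poleRing t) ∧ IsFractionRing (poleRing t) k ∧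
      ∀ [IsDomain (poleRing t)], Finite (ClassGroup (poleRing t)) := by
  let a1 := (aeval (R := ZMod p) (AdjoinSimple.gen (ZMod p) t)).toAlgebra
  let a2 := (aeval (R := ZMod p) t).toAlgebra
  have := isFractionRing_adjoin ht
  have : IsScalarTower (ZMod p)[X] (ZMod p)⟮t⟯ k := .of_algebraMap_eq fun r =>
     (aeval_algebraMap_apply k (AdjoinSimple.gen (ZMod p) t) r)
  have := isIntegralClosure_poleRing p t
  let a3 : Algebra (ZMod p)[X] (poleRing t) :=
    ((algebraMap (ZMod p)[X] k).codRestrict (poleRing t) fun r =>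
     mem_poleRing.2 fun A hA => aeval_mem hA r).toAlgebra
  have : IsScalarTower (ZMod p)[X] (poleRing t) k := .of_algebraMap_eq fun r => rfl
  have : IsDedekindDomain (poleRing t) :=
    IsIntegralClosure.isDedekindDomain (ZMod p)[X] (ZMod p)⟮t⟯ k (poleRing t)
  have : IsFractionRing (poleRing t) k :=
    IsIntegralClosure.isFractionRing_of_finite_extension (ZMod p)[X] (ZMod p)⟮t⟯ k (poleRing t)
  refine ⟨inferInstance, inferInstance, fun {_} => ?_⟩
  have := ClassGroup.fintypeOfAdmissibleOfFinite (S := poleRing t) (ZMod p)⟮t⟯ k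
    (Polynomial.cardPowDegreeIsAdmissible :
      AbsoluteValue.IsAdmissible (Polynomial.cardPowDegree : AbsoluteValue (ZMod p)[X] ℤ))
  exact Finite.of_fintype _

/-- The separable closure of `𝔽_p(t)` in `k`, as a subfield over `𝔽_p`. -/
noncomputable abbrev sepClosureOf (p : ℕ) [Fact p.Prime] {k : Type*} [Field k]
    [Algebra (ZMod p) k] (t : k) :
    IntermediateField (ZMod p) k :=
  (separableClosure (ZMod p)⟮t⟯ k).restrictScalars (ZMod p)

theorem mem_sepClosureOf_self (t : k) : t ∈ sepClosureOf p t :=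
  le_restrictScalars_separableClosure _ (mem_adjoin_simple_self _ t)

/-- Linear independence over `𝔽_p` is preserved by the Frobenius, `𝔽_p` being perfect. This is the
condition under which separating transcendence bases exist. -/
theorem linearIndepOn_pow (s : Finset k) (h : LinearIndepOn (ZMod p) _root_.id (s : Set k)) :
    LinearIndepOn (ZMod p) (· ^ p) (s : Set k) := by
  have hp : p.Prime := Fact.out
  have : CharP k p := charP_of_injective_algebraMap (algebraMap (ZMod p) k).injective p
  have : ExpChar k p := .prime hp
  have : ExpChar (ZMod p) p := .prime hp
  apply h.map_of_injective_injective (frobeniusEquiv (ZMod p) p).symm (frobenius k p).toAddMonoidHom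
  · simp
  · intro x hx
    exact pow_eq_zero_iff hp.ne_zero |>.1 hx
  · intro r m
    change (_ • m) ^ p = r • m ^ p
    rw [_root_.smul_pow, frobeniusEquiv_symm_pow_p]

/-- A family consisting of one transcendental element is a transcendence basis of `k`. -/
theorem isTranscendenceBasis_singleton
    (hfin : ∀ y : k, Transcendental (ZMod p) y → FiniteDimensional (ZMod p)⟮y⟯ k)
    {ι : Type*} {x : ι → k} {x₀ : ι} (hx₀ : ∀ i, i = x₀)
    (ht : Transcendental (ZMod p) (x x₀)) : IsTranscendenceBasis (ZMod p) x := by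
  let : Unique ι := ⟨⟨x₀⟩, hx₀⟩
  rw [isTranscendenceBasis_iff_algebraicIndependent_isAlgebraic]
  refine ⟨algebraicIndependent_unique_type_iff.2 ht, ?_⟩
  have hr : Set.range x = {x x₀} := by
    ext y
    simp only [Set.mem_range, Set.mem_singleton_iff]
    exact ⟨fun ⟨i, hi⟩ => by rw [← hi, hx₀ i], fun h => ⟨x₀, h.symm⟩⟩
  rw [hr]
  have := hfin _ ht
  exact isAlgebraic_adjoin_iff_top.1 inferInstance

/-- The exchange property in transcendence degree one: of two elements `s` and `y`, one is separable
over the field generated by the other. -/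
theorem exchange (hfin : ∀ y : k, Transcendental (ZMod p) y → FiniteDimensional (ZMod p)⟮y⟯ k)
    {s y : k} (hs : Transcendental (ZMod p) s) (hy : y ∉ sepClosureOf p s) :
    Transcendental (ZMod p) y ∧ s ∈ sepClosureOf p y := by
  have hp : p.Prime := Fact.out
  have : ExpChar (ZMod p) p := .prime hp
  let a : Bool → k := fun b => if b then y else s
  have hb : IsTranscendenceBasis (ZMod p) (fun i : {i : Bool // i ≠ true} => a i) := by
    refine isTranscendenceBasis_singleton hfin (x₀ := ⟨false, by simp⟩) ?_ hs
    rintro ⟨i, hi⟩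
    cases i <;> simp_all
  -- One of `s`, `y` can be dropped so that it is separable over the other; it is not `y`.
  obtain ⟨i, hi, hsep⟩ :=
    exists_isTranscendenceBasis_and_isSeparable_of_linearIndepOn_pow (K := k) p hp
      (fun s hs => linearIndepOn_pow s hs) (a := a) true hb
  have him : ∀ b : Bool, a '' {b}ᶜ = {a !b} := by
    intro b; ext x; cases b <;> simp
  cases i
  · rw [him] at hsep
    have h1 := hi.1.transcendental ⟨true, by simp⟩
    exact ⟨h1, mem_separableClosure_iff.2 hsep⟩
  · rw [him] at hsep
    exact absurd (mem_separableClosure_iff.2 hsep) hy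

/-- Every element of `k` is a quotient of an element integral over `𝔽_p[s]` by a nonzero element
of `𝔽_p[s]`. -/
theorem exists_aeval_mul_mem_poleRing {s : k} (hs : Transcendental (ZMod p) s)
    [FiniteDimensional (ZMod p)⟮s⟯ k] (x : k) :
    ∃ q : (ZMod p)[X], aeval s q ≠ 0 ∧ aeval s q * x ∈ poleRing s := by
  let a1 := (aeval (R := ZMod p) (AdjoinSimple.gen (ZMod p) s)).toAlgebra
  let a2 := (aeval (R := ZMod p) s).toAlgebra
  have := isFractionRing_adjoin hs
  have : IsScalarTower (ZMod p)[X] (ZMod p)⟮s⟯ k := .of_algebraMap_eq fun r =>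
    (aeval_algebraMap_apply k (AdjoinSimple.gen (ZMod p) s) r)
  have hI := isIntegralClosure_poleRing p s
  have h1 : IsAlgebraic (ZMod p)[X] x :=
    (IsFractionRing.isAlgebraic_iff (ZMod p)[X] (ZMod p)⟮s⟯ k).2 (Algebra.IsAlgebraic.isAlgebraic x)
  obtain ⟨q, hq, hqx⟩ := h1.exists_integral_multiple
  obtain ⟨y, hy⟩ := hI.isIntegral_iff.1 hqx
  refine ⟨q, ?_, ?_⟩
  · intro h
    exact hq (transcendental_iff.1 hs q h)
  · rw [Algebra.smul_def] at hy
    exact hy ▸ y.2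

/-- For a suitable exponent, adding a power of `s` to `y` produces poles at given poles of `s`. -/
theorem exists_pow_add_notMem (F : Finset (ValuationSubring k)) {s : k} (y : k)
    (hF : ∀ A ∈ F, s ∉ A) : ∃ N : ℕ, ∀ A ∈ F, y + s ^ (N + 1) ∉ A := by
  -- At a pole of `s` the powers of `s` have distinct valuations, so that at most one of them
  -- cancels the pole of `y`.
  have hbad : ∀ A ∈ F, {N : ℕ | y + s ^ (N + 1) ∈ A}.Subsingleton := by
    intro A hA
    have key : ∀ N M : ℕ, N < M → y + s ^ (N + 1) ∈ A → y + s ^ (M + 1) ∈ A → False := by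
      intro N M hNM hN hM
      have h1 : s ^ (M + 1) - s ^ (N + 1) ∈ A := by
        have := sub_mem hM hN
        rwa [add_sub_add_left_eq_sub] at this
      have hs1 : 1 < A.valuation s := by
        rw [← not_le, A.valuation_le_one_iff]; exact hF A hA
      rw [← A.valuation_le_one_iff, Valuation.map_sub_eq_of_lt_left, map_pow] at h1
      · exact absurd h1 (not_le.2 (one_lt_pow₀ hs1 (Nat.succ_ne_zero M)))
      · rw [map_pow, map_pow]
        exact pow_lt_pow_right₀ hs1 (by omega)
    intro N hN M hM
    by_contra hne
    rcases lt_or_gt_of_ne hne with h | h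
    · exact key N M h hN hM
    · exact key M N h hM hN
  have hfin : (⋃ A ∈ F, {N : ℕ | y + s ^ (N + 1) ∈ A}).Finite :=
    F.finite_toSet.biUnion fun A hA => (hbad A hA).finite
  obtain ⟨N, hN⟩ := hfin.exists_notMem
  refine ⟨N, fun A hA h => hN ?_⟩
  simp only [Set.mem_iUnion]
  exact ⟨A, hA, h⟩

/-- There is an element over which `k` is separable, with poles only where `t` has poles, and among
them any finitely many given ones. It is found by minimizing the inseparable degree. -/
theorem exists_isSeparable
    (hfin : ∀ y : k, Transcendental (ZMod p) y → FiniteDimensional (ZMod p)⟮y⟯ k)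
    {t : k} (ht : Transcendental (ZMod p) t) (F : Finset (ValuationSubring k))
    (hF : ∀ A ∈ F, t ∉ A) :
    ∃ s : k, Transcendental (ZMod p) s ∧ Algebra.IsSeparable (ZMod p)⟮s⟯ k ∧ (∀ A ∈ F, s ∉ A) ∧
      ∀ A : ValuationSubring k, t ∈ A → s ∈ A := by
  let G : Set k := {s | Transcendental (ZMod p) s ∧ (∀ A ∈ F, s ∉ A) ∧
    ∀ A : ValuationSubring k, t ∈ A → s ∈ A}
  -- `f s` is the degree of inseparability of `k` over `𝔽_p(s)`.
  let f : k → ℕ := fun s => Module.finrank (sepClosureOf p s) k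
  obtain ⟨_, ⟨s, ⟨hs, hsF, hsA⟩, rfl⟩, hmin⟩ := wellFounded_lt.has_min (f '' G)
    ⟨_, t, ⟨ht, hF, fun _ h => h⟩, rfl⟩
  refine ⟨s, hs, ?_, hsF, hsA⟩
  have := hfin s hs
  by_contra hsep
  -- If `k` is not separable over `𝔽_p(s)`, some `y` integral over `𝔽_p[s]` is not. For suitable `N`
  -- the element `y + s ^ (N + 1)` has the required poles. Its degree of inseparability is smaller,
  -- because the separable closure in question contains both that of `s` and the element itself.
  obtain ⟨y, hy, hyE⟩ : ∃ y ∈ poleRing s, y ∉ sepClosureOf p s := by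
    by_contra! h
    apply hsep
    rw [← separableClosure.eq_top_iff, eq_top_iff]
    rintro x -
    obtain ⟨q, hq, hqx⟩ := exists_aeval_mul_mem_poleRing hs x
    have h1 : aeval s q ∈ sepClosureOf p s :=
      (Algebra.adjoin_le (S := (sepClosureOf p s).toSubalgebra)
        (Set.singleton_subset_iff.2 (mem_sepClosureOf_self s)))
        (aeval_mem_adjoin_singleton (ZMod p) s)
    have h2 := mul_mem (inv_mem h1) (h _ hqx)
    rwa [inv_mul_cancel_left₀ hq] at h2
  obtain ⟨N, hN⟩ := exists_pow_add_notMem F y hsF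
  have hyE' : y + s ^ (N + 1) ∉ sepClosureOf p s := fun h => hyE <| by
    have := sub_mem h (pow_mem (mem_sepClosureOf_self s) (N + 1))
    rwa [add_sub_cancel_right] at this
  obtain ⟨htr, hmem⟩ := exchange hfin hs hyE'
  refine hmin _ ⟨y + s ^ (N + 1), ⟨htr, hN, fun A hA =>
    add_mem (mem_poleRing.1 hy A (hsA A hA)) (pow_mem (hsA A hA) _)⟩, rfl⟩ ?_
  have hle : sepClosureOf p s ≤ sepClosureOf p (y + s ^ (N + 1)) := by
    rw [separableClosure_le_separableClosure_iff, adjoin_simple_le_iff]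
    exact hmem
  have h1 := relfinrank_mul_finrank_top hle
  have h2 : relfinrank (sepClosureOf p s) (sepClosureOf p (y + s ^ (N + 1))) ≠ 1 := by
    rw [ne_eq, relfinrank_eq_one_iff]
    exact fun h => hyE' (h (mem_sepClosureOf_self _))
  have h3 : 0 < Module.finrank (sepClosureOf p s) k := by
    have : FiniteDimensional (sepClosureOf p s) k :=
      inferInstanceAs (FiniteDimensional (separableClosure (ZMod p)⟮s⟯ k) k)
    exact Module.finrank_pos
  change Module.finrank (sepClosureOf p (y + s ^ (N + 1))) k < Module.finrank (sepClosureOf p s) k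
  rw [← h1] at h3 ⊢
  have h4 := pos_of_mul_pos_left h3 (Nat.zero_le _)
  have h5 := pos_of_mul_pos_right h3 (Nat.zero_le _)
  nlinarith [show 2 ≤ relfinrank (sepClosureOf p s) (sepClosureOf p (y + s ^ (N + 1))) by omega]

end FunctionFields

/-! ### Functions with a single pole -/

section Pigeonhole
open IntermediateField Polynomial IsDedekindDomain

variable {p : ℕ} [Fact p.Prime] {k : Type*} [Field k] [Algebra (ZMod p) k]

/-- A basis of `k` over `𝔽_p(s)` that is integral over `𝔽_p[s]`, the linear independence being
stated over `𝔽_p[s]`. -/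
theorem exists_integral_family {s : k} (hs : Transcendental (ZMod p) s)
    [FiniteDimensional (ZMod p)⟮s⟯ k] {n : ℕ} (hn : Module.finrank (ZMod p)⟮s⟯ k = n) :
    ∃ b : Fin n → k, (∀ i, b i ∈ poleRing s) ∧
      ∀ f : Fin n → (ZMod p)[X], ∑ i, aeval s (f i) * b i = 0 → f = 0 := by
  let b := Module.finBasisOfFinrankEq (ZMod p)⟮s⟯ k hn
  choose q hq0 hq using fun i => exists_aeval_mul_mem_poleRing hs (b i)
  refine ⟨fun i => aeval s (q i) * b i, hq, fun f hf => ?_⟩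
  have h1 := Fintype.linearIndependent_iff.1 b.linearIndependent
    (fun i => aeval (AdjoinSimple.gen (ZMod p) s) (f i * q i)) (by
      rw [← hf]
      refine Finset.sum_congr rfl fun i _ => ?_
      rw [Algebra.smul_def, ← aeval_algebraMap_apply, map_mul, mul_assoc]
      rfl)
  ext1 i
  have h2 := congrArg (algebraMap (ZMod p)⟮s⟯ k) (h1 i)
  rw [← aeval_algebraMap_apply, map_zero] at h2
  change aeval s _ = 0 at h2
  rw [map_mul] at h2
  exact transcendental_iff.1 hs _ ((mul_eq_zero.1 h2).resolve_right (hq0 i))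

/-- In the separable case, the integral closure of `𝔽_p[u]` is generated over `𝔽_p[u]` by as many
elements as the degree of `k` over `𝔽_p(u)`. -/
theorem exists_generating_family {u : k} (hu : Transcendental (ZMod p) u)
    [FiniteDimensional (ZMod p)⟮u⟯ k] [Algebra.IsSeparable (ZMod p)⟮u⟯ k] :
    ∃ e : Fin (Module.finrank (ZMod p)⟮u⟯ k) → poleRing u, ∀ d : poleRing u,
      ∃ c : Fin (Module.finrank (ZMod p)⟮u⟯ k) → (ZMod p)[X],
        (d : k) = ∑ i, aeval u (c i) * (e i : k) := by
  let a1 := (aeval (R := ZMod p) (AdjoinSimple.gen (ZMod p) u)).toAlgebra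
  let a2 := (aeval (R := ZMod p) u).toAlgebra
  have := isFractionRing_adjoin hu
  have : IsScalarTower (ZMod p)[X] (ZMod p)⟮u⟯ k := .of_algebraMap_eq fun r =>
     (aeval_algebraMap_apply k (AdjoinSimple.gen (ZMod p) u) r)
  have := isIntegralClosure_poleRing p u
  let a3 : Algebra (ZMod p)[X] (poleRing u) :=
    ((algebraMap (ZMod p)[X] k).codRestrict (poleRing u) fun r =>
     mem_poleRing.2 fun A hA => aeval_mem hA r).toAlgebra
  have : IsScalarTower (ZMod p)[X] (poleRing u) k := .of_algebraMap_eq fun r => rfl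
  have : Module.IsTorsionFree (ZMod p)[X] k := by
    have := (faithfulSMul_iff_algebraMap_injective (ZMod p)[X] k).2
      (transcendental_iff_injective.1 hu)
    infer_instance
  have : Module.Free (ZMod p)[X] (poleRing u) :=
    IsIntegralClosure.module_free (ZMod p)[X] (ZMod p)⟮u⟯ k (poleRing u)
  have : IsNoetherian (ZMod p)[X] (poleRing u) :=
    IsIntegralClosure.isNoetherian (ZMod p)[X] (ZMod p)⟮u⟯ k (poleRing u)
  let e := Module.finBasisOfFinrankEq (ZMod p)[X] (poleRing u)
    (IsIntegralClosure.rank (ZMod p)[X] (ZMod p)⟮u⟯ k (poleRing u))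
  refine ⟨e, fun d => ⟨fun i => e.repr d i, ?_⟩⟩
  conv_lhs => rw [← e.sum_repr d]
  rw [AddSubmonoidClass.coe_finsetSum]
  refine Finset.sum_congr rfl fun i _ => ?_
  rw [Algebra.smul_def]
  rfl

theorem card_degreeLT (n N : ℕ) :
    Nat.card (Fin n → degreeLT (ZMod p) N) = p ^ (n * N) := by
  rw [Nat.card_fun, Nat.card_congr (degreeLTEquiv (ZMod p) N).toEquiv, Nat.card_fun, Nat.card_zmod,
    Nat.card_fin, Nat.card_fin, ← pow_mul, mul_comm]

instance finite_degreeLT (N : ℕ) : Finite (degreeLT (ZMod p) N) :=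
  Finite.of_equiv _ (degreeLTEquiv (ZMod p) N).toEquiv.symm

/-- The residue ring modulo `u ^ M` consists of the combinations of a generating family whose
coefficients are polynomials in `u` of degree less than `M`. -/
theorem card_quotient_span_pow_le {u : k} (hu : Transcendental (ZMod p) u)
    [FiniteDimensional (ZMod p)⟮u⟯ k] [Algebra.IsSeparable (ZMod p)⟮u⟯ k] (M : ℕ) :
    Finite (poleRing u ⧸ Ideal.span {(⟨u, self_mem_poleRing u⟩ : poleRing u)} ^ M) ∧
    Nat.card (poleRing u ⧸ Ideal.span {(⟨u, self_mem_poleRing u⟩ : poleRing u)} ^ M) ≤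
      p ^ (Module.finrank (ZMod p)⟮u⟯ k * M) := by
  obtain ⟨e, he⟩ := exists_generating_family hu
  have hmem : ∀ f : (ZMod p)[X], aeval u f ∈ poleRing u := fun f =>
    mem_poleRing.2 fun A hA => aeval_mem hA f
  let g : (Fin (Module.finrank (ZMod p)⟮u⟯ k) → degreeLT (ZMod p) M) →
      poleRing u ⧸ Ideal.span {(⟨u, self_mem_poleRing u⟩ : poleRing u)} ^ M := fun f =>
    Ideal.Quotient.mk _ (∑ i, ⟨aeval u (f i : (ZMod p)[X]), hmem _⟩ * e i)
  have hg : Function.Surjective g := by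
    intro x
    obtain ⟨d, rfl⟩ := Ideal.Quotient.mk_surjective x
    obtain ⟨c, hc⟩ := he d
    have hM : (X ^ M : (ZMod p)[X]).Monic := monic_X_pow M
    refine ⟨fun i => ⟨c i %ₘ X ^ M, ?_⟩, ?_⟩
    · rw [mem_degreeLT]
      calc _ < (X ^ M : (ZMod p)[X]).degree := degree_modByMonic_lt _ hM
        _ = M := degree_X_pow M
    · rw [eq_comm]
      refine Ideal.Quotient.eq.2 ?_
      rw [Ideal.span_singleton_pow, Ideal.mem_span_singleton]
      refine ⟨∑ i, ⟨aeval u (c i /ₘ X ^ M), hmem _⟩ * e i, Subtype.ext ?_⟩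
      simp only [AddSubgroupClass.coe_sub, Subring.coe_mul, AddSubmonoidClass.coe_finsetSum,
        Subring.coe_pow, hc]
      rw [← Finset.sum_sub_distrib, Finset.mul_sum]
      refine Finset.sum_congr rfl fun i _ => ?_
      conv_lhs => enter [1, 1]; rw [← modByMonic_add_div (c i) (X ^ M)]
      rw [map_add, map_mul, map_pow, aeval_X]
      ring
  exact ⟨Finite.of_surjective g hg, (Nat.card_le_card_of_surjective g hg).trans_eq
    (card_degreeLT _ _)⟩

/-- A polynomial in `s` of degree less than `N` becomes a polynomial in `s⁻¹` after multiplication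
with `s⁻¹ ^ N`. -/
theorem pow_mul_aeval_mem {s : k} (hs : s ≠ 0) {N : ℕ} {f : (ZMod p)[X]}
    (hf : f ∈ degreeLT (ZMod p) N) :
    s⁻¹ ^ N * aeval s f ∈ poleRing s⁻¹ := by
  rw [mem_poleRing]
  intro A hA
  rw [mem_degreeLT] at hf
  rw [aeval_eq_sum_range, Finset.mul_sum]
  refine sum_mem fun i hi => ?_
  by_cases h0 : f = 0
  · simp [h0]
  rw [degree_eq_natDegree h0, Nat.cast_lt] at hf
  have hi : i ≤ N := by rw [Finset.mem_range] at hi; omega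
  obtain ⟨j, rfl⟩ := Nat.exists_eq_add_of_le hi
  rw [pow_add, Algebra.smul_def, mul_comm (s⁻¹ ^ i), mul_assoc, mul_comm _ (s ^ i),
    ← mul_assoc (s⁻¹ ^ i), ← mul_pow, inv_mul_cancel₀ hs, one_pow, one_mul]
  exact mul_mem (pow_mem hA _) (algebraMap_zmod_mem A _)

/-- There is a function with a pole at a given place and no other poles.

Starting from a function `s` with a pole there, among others, one looks at the functions
`z = ∑ fᵢ(s) bᵢ` with polynomials `fᵢ` of degree less than `N`, where the `bᵢ` are a basis integral
over `𝔽_p[s]`. The poles of `s z` are among those of `s ^ M`, with multiplicities, where `M - N` is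
independent of `N`. For large `N` the number of these functions exceeds the number of possible
principal parts of `s z` away from the given place, so that by the pigeonhole principle there is
some `z ≠ 0` for which `s z` has no pole away from it. -/
theorem exists_pole_only_at
    (hfin : ∀ y : k, Transcendental (ZMod p) y → FiniteDimensional (ZMod p)⟮y⟯ k)
    {A₀ : ValuationSubring k} (hA₀ : A₀ ≠ ⊤) :
    ∃ t : k, t ∉ A₀ ∧ ∀ A : ValuationSubring k, A ≠ A₀ → t ∈ A := by
  have hp : p.Prime := Fact.out
  obtain ⟨s₀, hs₀⟩ : ∃ s, s ∉ A₀ := by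
    by_contra! h
    exact hA₀ (eq_top_iff.2 fun x _ => h x)
  obtain ⟨s, hs, hsep, hsA₀, -⟩ := exists_isSeparable hfin (t := s₀)
    (fun h => hs₀ (isAlgebraic_iff_forall_mem.1 h A₀)) {A₀} (by simpa using hs₀)
  replace hsA₀ := hsA₀ A₀ (by simp)
  have hsfin := hfin s hs
  have hs0 : s ≠ 0 := by rintro rfl; exact hsA₀ (zero_mem _)
  obtain ⟨n, hn⟩ : ∃ n, Module.finrank (ZMod p)⟮s⟯ k = n := ⟨_, rfl⟩
  obtain ⟨b, hb, hbi⟩ := exists_integral_family hs hn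
  -- the place `A₀` lies over `u = 0`
  set u : k := s⁻¹ with hu_def
  have hE : (ZMod p)⟮s⟯ = (ZMod p)⟮u⟯ := by
    apply le_antisymm
    · rw [adjoin_simple_le_iff, ← inv_inv s]
      exact inv_mem (mem_adjoin_simple_self _ _)
    · rw [adjoin_simple_le_iff]
      exact inv_mem (mem_adjoin_simple_self _ _)
  have hu : Transcendental (ZMod p) u := fun h => hs (by simpa [hu_def] using h.inv)
  have hufin := hfin u hu
  have husep : Algebra.IsSeparable (ZMod p)⟮u⟯ k := hE ▸ hsep
  have hun : Module.finrank (ZMod p)⟮u⟯ k = n := by rw [← hn, hE]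
  obtain ⟨hD, hfrac, -⟩ := poleRing_dedekind hu
  let u' : poleRing u := ⟨u, self_mem_poleRing u⟩
  have hu0 : u ≠ 0 := inv_ne_zero hs0
  have hDA : ∀ A : ValuationSubring k, s ∉ A →
      ∀ d : poleRing u, algebraMap (poleRing u) k d ∈ A := by
    intro A hA d
    exact mem_poleRing.1 d.2 A ((A.mem_or_inv_mem s).resolve_left hA)
  obtain ⟨P₀, hP₀⟩ := exists_valuationSubring_eq (hDA A₀ hsA₀) hA₀
  have hmemP : ∀ P : HeightOneSpectrum (poleRing u),
      s ∉ (P.valuation k).valuationSubring → u' ∈ P.asIdeal := by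
    intro P hP
    rw [← P.valuation_lt_one_iff_mem (K := k)]
    rw [Valuation.mem_valuationSubring_iff, not_le] at hP
    change P.valuation k s⁻¹ < 1
    rw [map_inv₀]
    exact inv_lt_one_of_one_lt₀ hP
  have hI0 : Ideal.span {u'} ≠ 0 := by
    rw [ne_eq, Submodule.zero_eq_bot, Ideal.span_singleton_eq_bot]
    exact fun h => hu0 (congrArg Subtype.val h)
  -- the part of the divisor of `u` away from `A₀`
  obtain ⟨Q, hIQ, hPQ⟩ :=
    (FiniteMultiplicity.of_prime_left P₀.prime hI0).exists_eq_pow_mul_and_not_dvd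
  set m := multiplicity P₀.asIdeal (Ideal.span {u'}) with hm
  have hm0 : m ≠ 0 := by
    intro h0
    rw [h0, pow_zero, one_mul] at hIQ
    apply hPQ
    rw [← hIQ, Ideal.dvd_iff_le, Ideal.span_singleton_le_iff_mem]
    exact hmemP P₀ (by rwa [hP₀])
  have hcop : IsCoprime P₀.asIdeal Q := by
    rw [Ideal.isCoprime_iff_sup_eq]
    refine P₀.isMaximal.out.2 _ (left_lt_sup.2 fun h => hPQ (Ideal.dvd_iff_le.2 h))
  -- a common denominator for the `b i`, of the form `u ^ c`
  choose c hc using fun i => exists_pow_mul_eq (K := k) u' (y := b i) fun B _ hB => by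
    refine mem_poleRing.1 (hb i) B ?_
    change (u : k)⁻¹ ∈ B at hB
    rwa [hu_def, inv_inv] at hB
  let C := ∑ i, c i
  have hC : ∀ i, u ^ C * b i ∈ poleRing u := by
    intro i
    obtain ⟨d, hd⟩ := hc i
    have h1 : C = (C - c i) + c i :=
      (Nat.sub_add_cancel
        (Finset.single_le_sum (fun _ _ => Nat.zero_le _) (Finset.mem_univ i))).symm
    rw [h1, pow_add, mul_assoc]
    exact mul_mem (pow_mem (self_mem_poleRing u) _)
      (by rw [show u ^ c i * b i = d from hd]; exact d.2)
  -- The residue ring modulo `u ^ M` has at most `p ^ (n * M)` elements, and the factor at `A₀` has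
  -- at least `2 ^ M`. As `M = N + C + 1`, the quotient of the two bounds is less than `p ^ (n * N)`
  -- as soon as `p ^ (n * (C + 1)) < 2 ^ N`.
  obtain ⟨N, hN⟩ : ∃ N : ℕ, p ^ (n * (C + 1)) < 2 ^ N := pow_unbounded_of_one_lt _ one_lt_two
  let M := N + C + 1
  -- the quotient by `Q ^ M` is smaller than the space of functions considered
  have hcard : Finite (poleRing u ⧸ Q ^ M) ∧ Nat.card (poleRing u ⧸ Q ^ M) < p ^ (n * N) := by
    obtain ⟨hfinM, hle⟩ := card_quotient_span_pow_le hu M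
    have h1 : Submodule.cardQuot (Ideal.span {u'} ^ M) =
        Submodule.cardQuot P₀.asIdeal ^ (m * M) * Submodule.cardQuot (Q ^ M) := by
      rw [hIQ, mul_pow, ← pow_mul, cardQuot_mul_of_coprime hcop.pow,
        cardQuot_pow_of_prime P₀.ne_bot]
    have h2 : Submodule.cardQuot (Ideal.span {u'} ^ M) ≠ 0 := by
      rw [Submodule.cardQuot_apply]
      exact Nat.card_ne_zero.2 ⟨inferInstance, hfinM⟩
    have h3 : Submodule.cardQuot P₀.asIdeal ≠ 0 ∧ Submodule.cardQuot (Q ^ M) ≠ 0 := by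
      rw [h1, mul_ne_zero_iff] at h2
      exact ⟨fun h => h2.1 (by rw [h, zero_pow (mul_ne_zero hm0 (Nat.succ_ne_zero _))]), h2.2⟩
    have h4 : 2 ≤ Submodule.cardQuot P₀.asIdeal := by
      have : Submodule.cardQuot P₀.asIdeal ≠ 1 := by
        rw [ne_eq, Submodule.cardQuot_eq_one_iff]
        exact P₀.isPrime.ne_top
      omega
    have h5 : 2 ^ M ≤ Submodule.cardQuot P₀.asIdeal ^ (m * M) :=
      (Nat.pow_le_pow_left h4 M).trans (Nat.pow_le_pow_right (by omega)
        (Nat.le_mul_of_pos_left M (Nat.pos_of_ne_zero hm0)))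
    refine ⟨Nat.finite_of_card_ne_zero h3.2, ?_⟩
    rw [← Submodule.cardQuot_apply] at hle ⊢
    rw [h1, hun] at hle
    have h6 : 2 ^ N ≤ 2 ^ M := Nat.pow_le_pow_right (by norm_num) (by omega)
    have h7 : p ^ (n * M) = p ^ (n * N) * p ^ (n * (C + 1)) := by
      rw [← pow_add, ← mul_add]; rfl
    have h8 : 0 < p ^ (n * N) := pow_pos hp.pos _
    rw [h7] at hle
    by_contra hlt
    rw [not_lt] at hlt
    have h9 : 2 ^ N * p ^ (n * N) ≤ p ^ (n * N) * p ^ (n * (C + 1)) :=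
      (Nat.mul_le_mul (h6.trans h5) hlt).trans hle
    rw [mul_comm] at h9
    exact absurd (Nat.le_of_mul_le_mul_left h9 h8) (not_le.2 hN)
  obtain ⟨hQfin, hQcard⟩ := hcard
  let z : (Fin n → degreeLT (ZMod p) N) → k := fun f => ∑ i, aeval s (f i : (ZMod p)[X]) * b i
  have hz : ∀ f, u ^ M * (s * z f) ∈ poleRing u := by
    intro f
    have : u ^ M * (s * z f) = ∑ i, (u ^ N * aeval s (f i : (ZMod p)[X])) * (u ^ C * b i) := by
      rw [show M = N + C + 1 from rfl, pow_succ, mul_assoc, ← mul_assoc u, hu_def,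
        inv_mul_cancel₀ hs0, one_mul, Finset.mul_sum]
      refine Finset.sum_congr rfl fun i _ => ?_
      rw [pow_add]
      ring
    rw [this]
    exact sum_mem fun i _ => mul_mem (pow_mul_aeval_mem hs0 (f i).2) (hC i)
  obtain ⟨f, f', hne, hff⟩ := Function.not_injective_iff.1 (fun hinj => absurd
    (Nat.card_le_card_of_injective
      (fun f => Ideal.Quotient.mk (Q ^ M) ⟨u ^ M * (s * z f), hz f⟩) hinj)
    (by rw [card_degreeLT]; exact not_le.2 hQcard)) |>.imp fun f h => h.imp fun f' h => And.symm h
  have hsub : ⟨u ^ M * (s * z (f - f')), hz (f - f')⟩ ∈ Q ^ M := by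
    rw [Ideal.Quotient.eq] at hff
    convert hff using 1
    apply Subtype.ext
    simp only [AddSubgroupClass.coe_sub]
    rw [← mul_sub, ← mul_sub, ← Finset.sum_sub_distrib]
    congr 2
    refine Finset.sum_congr rfl fun i _ => ?_
    simp [sub_mul]
  set g := f - f' with hg
  have hz0 : z g ≠ 0 := by
    intro h0
    have h1 := hbi (fun i => (g i : (ZMod p)[X])) h0
    apply hne
    rw [← sub_eq_zero]
    ext1 i
    exact Subtype.ext (congrFun h1 i)
  have hzA : ∀ A : ValuationSubring k, s ∈ A → z g ∈ A := fun A hA =>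
    sum_mem fun i _ => mul_mem (aeval_mem hA _) (mem_poleRing.1 (hb i) A hA)
  have hmain : ∀ A : ValuationSubring k, A ≠ A₀ → s * z g ∈ A := by
    intro A hA
    by_cases hsA : s ∈ A
    · exact mul_mem hsA (hzA A hsA)
    obtain ⟨P, rfl⟩ := exists_valuationSubring_eq (hDA A hsA) (by rintro rfl; exact hsA trivial)
    have hPP : P ≠ P₀ := by rintro rfl; exact hA hP₀
    -- Away from `A₀`, membership in `Q ^ M` amounts to divisibility by `u ^ M`.
    obtain ⟨r, hr, hrP⟩ : ∃ r ∈ P₀.asIdeal ^ (m * M), r ∉ P.asIdeal := by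
      by_contra! h
      have h1 := P.isPrime.le_of_pow_le (show P₀.asIdeal ^ (m * M) ≤ P.asIdeal from h)
      exact hPP (HeightOneSpectrum.ext (P₀.isMaximal.eq_of_le P.isPrime.ne_top h1).symm)
    have h1 : r * ⟨u ^ M * (s * z g), hz g⟩ ∈ Ideal.span {u'} ^ M := by
      rw [hIQ, mul_pow, ← pow_mul]
      exact Ideal.mul_mem_mul hr hsub
    rw [Ideal.span_singleton_pow, Ideal.mem_span_singleton] at h1
    obtain ⟨d, hd⟩ := h1
    have h2 : (r : k) * (u ^ M * (s * z g)) = u ^ M * d := congrArg Subtype.val hd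
    have h3 : (r : k) * (s * z g) = d := by
      have hu' := pow_ne_zero M hu0
      apply mul_left_cancel₀ hu'
      rw [← h2]; ring
    have h4 := congrArg (P.valuation k) h3
    rw [map_mul] at h4
    have h5 : P.valuation k (r : k) = 1 := P.valuation_eq_one_iff_notMem.2 hrP
    rw [h5, one_mul] at h4
    rw [Valuation.mem_valuationSubring_iff, h4]
    exact P.valuation_le_one d
  refine ⟨s * z g, fun hA => ?_, hmain⟩
  -- otherwise `s * z g` would be a nonzero constant, but it vanishes where `s` does
  have halg : IsAlgebraic (ZMod p) (s * z g) := isAlgebraic_iff_forall_mem.2 fun A => by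
    by_cases h : A = A₀
    · exact h ▸ hA
    · exact hmain A h
  apply hu
  rw [isAlgebraic_iff_forall_mem]
  intro A
  by_contra huA
  have hsA : s ∈ A := by
    have := (A.mem_or_inv_mem u).resolve_left huA
    rwa [hu_def, inv_inv] at this
  apply huA
  have h1 := mul_mem (hzA A hsA) (isAlgebraic_iff_forall_mem.1 halg.inv A)
  rwa [mul_inv, mul_comm s⁻¹, mul_inv_cancel_left₀ hz0] at h1

end Pigeonhole

/-! ### Elements with prescribed poles -/

section Poles
open IntermediateField Polynomial IsDedekindDomain

section CharP
variable {p : ℕ} [Fact p.Prime] {k : Type*} [Field k] [Algebra (ZMod p) k]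

/-- A finite nonempty set of places is the exact set of poles of some function over which `k` is
separable. -/
theorem exists_poles_eq
    (hfin : ∀ y : k, Transcendental (ZMod p) y → FiniteDimensional (ZMod p)⟮y⟯ k)
    (S : Finset (ValuationSubring k)) (hS : S.Nonempty) (hStop : ∀ A ∈ S, A ≠ ⊤) :
    ∃ t : k, Transcendental (ZMod p) t ∧ Algebra.IsSeparable (ZMod p)⟮t⟯ k ∧
      ∀ A : ValuationSubring k, t ∉ A ↔ A ∈ S := by
  classical
  choose! g hg hg' using fun A hA => exists_pole_only_at hfin (hStop A hA)
  have h1 : ∀ A ∈ S, ∑ B ∈ S, g B ∉ A := by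
    intro A hA h
    rw [← Finset.add_sum_erase _ _ hA] at h
    refine hg A hA ?_
    have h2 : ∑ B ∈ S.erase A, g B ∈ A := sum_mem fun B hB =>
      hg' B (Finset.mem_of_mem_erase hB) A (Finset.ne_of_mem_erase hB).symm
    have := sub_mem h h2
    rwa [add_sub_cancel_right] at this
  have h2 : ∀ A ∉ S, ∑ B ∈ S, g B ∈ A := fun A hA => sum_mem fun B hB =>
    hg' B hB A (by rintro rfl; exact hA hB)
  obtain ⟨A₀, hA₀⟩ := hS
  obtain ⟨t, ht, hsep, htS, htA⟩ := exists_isSeparable hfin (t := ∑ B ∈ S, g B)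
    (fun h => h1 A₀ hA₀ (isAlgebraic_iff_forall_mem.1 h A₀)) S h1
  exact ⟨t, ht, hsep, fun A => ⟨fun h => by_contra fun hA => h (htA A (h2 A hA)), htS A⟩⟩

/-- At every place some `u` over which `k` is separable has no pole. -/
theorem exists_transcendental_mem
    (hfin : ∀ y : k, Transcendental (ZMod p) y → FiniteDimensional (ZMod p)⟮y⟯ k)
    {A : ValuationSubring k} (hA : A ≠ ⊤) :
    ∃ u ∈ A, Transcendental (ZMod p) u ∧ Algebra.IsSeparable (ZMod p)⟮u⟯ k := by
  obtain ⟨s, hs⟩ : ∃ s, s ∉ A := by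
    by_contra! h
    exact hA (eq_top_iff.2 fun x _ => h x)
  have htr : Transcendental (ZMod p) s⁻¹ := fun h =>
    hs (isAlgebraic_iff_forall_mem.1 (by simpa using h.inv) A)
  obtain ⟨u, hu, husep, -, huA⟩ := exists_isSeparable hfin htr ∅ (by simp)
  exact ⟨u, huA A ((A.mem_or_inv_mem s).resolve_left hs), hu, husep⟩

/-- The constants of a function field over a finite field are finite in number. -/
theorem finite_setOf_isAlgebraic
    (hfin : ∀ y : k, Transcendental (ZMod p) y → FiniteDimensional (ZMod p)⟮y⟯ k)
    {A : ValuationSubring k} (hA : A ≠ ⊤) : {x : k | IsAlgebraic (ZMod p) x}.Finite := by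
  obtain ⟨u, -, hu, husep⟩ := exists_transcendental_mem hfin hA
  have := hfin u hu
  obtain ⟨hQ, -⟩ := card_quotient_span_pow_le hu 1
  have hmem : ∀ x : {x : k | IsAlgebraic (ZMod p) x}, (x : k) ∈ poleRing u := fun x =>
    mem_poleRing.2 fun A _ => isAlgebraic_iff_forall_mem.1 x.2 A
  refine Set.finite_coe_iff.1 ?_
  -- Two distinct constants cannot be congruent modulo `u`: their difference is a nonzero constant,
  -- which is not divisible by `u`.
  refine Finite.of_injective (fun x => Ideal.Quotient.mk
    (Ideal.span {(⟨u, self_mem_poleRing u⟩ : poleRing u)} ^ 1) ⟨x, hmem x⟩) fun x y hxy => ?_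
  rw [Ideal.Quotient.eq, pow_one, Ideal.mem_span_singleton] at hxy
  obtain ⟨d, hd⟩ := hxy
  have hd : (x : k) - y = u * d := congrArg Subtype.val hd
  by_contra hne
  have hne' : (x : k) - y ≠ 0 := fun h => hne (Subtype.ext (sub_eq_zero.1 h))
  have halg : IsAlgebraic (ZMod p) ((x : k) - y) := x.2.sub y.2
  have hu0 : u ≠ 0 := by rintro rfl; simp at hd; exact hne' hd
  refine hu ?_
  rw [← inv_inv u]
  refine IsAlgebraic.inv (isAlgebraic_iff_forall_mem.2 fun B => ?_)
  by_contra hB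
  have huB := (B.mem_or_inv_mem u).resolve_right hB
  apply hB
  have h1 := mul_mem (mem_poleRing.1 d.2 B huB) (isAlgebraic_iff_forall_mem.1 halg.inv B)
  rwa [hd, mul_inv, mul_comm u⁻¹, mul_inv_cancel_left₀] at h1
  intro h0
  rw [h0, mul_zero] at hd
  exact hne' hd

end CharP

/-- Class groups of localizations of Dedekind domains with finite class group are finite. -/
theorem finite_classGroup_of_isLocalization {D R : Type*} [CommRing D] [IsDedekindDomain D]
    [CommRing R] [IsDedekindDomain R] [Algebra D R] (M : Submonoid D) (hM : M ≤ D⁰)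
    [IsLocalization M R] [Finite (ClassGroup D)] : Finite (ClassGroup R) := by
  have hinj : Function.Injective (algebraMap D R) := IsLocalization.injective R hM
  choose I hI using ClassGroup.mk0_surjective (R := D)
  have hmap : ∀ J : (Ideal D)⁰, (J : Ideal D).map (algebraMap D R) ∈ (Ideal R)⁰ := fun J => by
    rw [mem_nonZeroDivisors_iff_ne_zero]
    exact (Ideal.map_eq_bot_iff_of_injective hinj).not.2 (nonZeroDivisors.ne_zero J.2)
  refine Finite.of_surjective (fun c => ClassGroup.mk0 ⟨_, hmap (I c)⟩) fun c => ?_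
  obtain ⟨J, rfl⟩ := ClassGroup.mk0_surjective c
  have hJ : ((J : Ideal R).comap (algebraMap D R)).map (algebraMap D R) = J :=
    IsLocalization.map_under M R J
  have hJ0 : (J : Ideal R).comap (algebraMap D R) ∈ (Ideal D)⁰ := by
    rw [mem_nonZeroDivisors_iff_ne_zero]
    intro h
    rw [h, Ideal.zero_eq_bot, Ideal.map_bot] at hJ
    exact nonZeroDivisors.ne_zero J.2 hJ.symm
  refine ⟨ClassGroup.mk0 ⟨_, hJ0⟩, ?_⟩
  obtain ⟨x, y, hx, hy, h⟩ := ClassGroup.mk0_eq_mk0_iff.1 (hI (ClassGroup.mk0 ⟨_, hJ0⟩))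
  refine ClassGroup.mk0_eq_mk0_iff.2 ⟨algebraMap D R x, algebraMap D R y, ?_, ?_, ?_⟩
  · rwa [ne_eq, map_eq_zero_iff _ hinj]
  · rwa [ne_eq, map_eq_zero_iff _ hinj]
  · have h' := congrArg (Ideal.map (algebraMap D R)) h
    simp only [Ideal.map_mul, Ideal.map_span, Set.image_singleton, hJ] at h'
    exact h'

section NumberFields
open NumberField
variable {k : Type*} [Field k]

theorem ringOfIntegers_mem (A : ValuationSubring k) (x : 𝓞 k) : algebraMap (𝓞 k) k x ∈ A := by
  have h1 : IsIntegral ℤ (algebraMap (𝓞 k) k x) := x.2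
  exact isIntegral_iff_forall_valuationSubring.1 h1 A fun r => by simp

variable [NumberField k]

/-- A finite set of finite places of a number field is the exact set of poles of some element. -/
theorem exists_inv_poles_eq (S : Finset (ValuationSubring k)) (hStop : ∀ A ∈ S, A ≠ ⊤) :
    ∃ x : 𝓞 k, x ≠ 0 ∧ ∀ A : ValuationSubring k, (algebraMap (𝓞 k) k x)⁻¹ ∉ A ↔ A ∈ S := by
  classical
  rcases S.eq_empty_or_nonempty with rfl | ⟨A₀, hA₀⟩
  · exact ⟨1, one_ne_zero, by simp⟩
  have : Nonempty (HeightOneSpectrum (𝓞 k)) :=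
    ⟨(exists_valuationSubring_eq (ringOfIntegers_mem A₀) (hStop A₀ hA₀)).choose⟩
  choose! P hP using fun A hA => exists_valuationSubring_eq (ringOfIntegers_mem A) (hStop A hA)
  let J : Ideal (𝓞 k) := ∏ A ∈ S, (P A).asIdeal
  have hJ : J ∈ (Ideal (𝓞 k))⁰ := mem_nonZeroDivisors_iff_ne_zero.2
    (Finset.prod_ne_zero_iff.2 fun A _ => (P A).ne_bot)
  -- By finiteness of the class group some power of the product of the primes in `S` is principal,
  -- and a generator of it vanishes exactly on `S`.
  have h1 : ClassGroup.mk0 (⟨J, hJ⟩ ^ Fintype.card (ClassGroup (𝓞 k))) = 1 := by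
    rw [map_pow, pow_card_eq_one]
  rw [ClassGroup.mk0_eq_one_iff] at h1
  obtain ⟨x, hx⟩ := h1.principal
  have hx : J ^ Fintype.card (ClassGroup (𝓞 k)) = Ideal.span {x} := hx
  have hx0 : x ≠ 0 := by
    rintro rfl
    rw [Ideal.span_singleton_zero] at hx
    exact pow_ne_zero _ (nonZeroDivisors.ne_zero hJ) hx
  have hxk : algebraMap (𝓞 k) k x ≠ 0 := by
    rwa [ne_eq, map_eq_zero_iff _ (IsFractionRing.injective (𝓞 k) k)]
  refine ⟨x, hx0, fun A => ?_⟩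
  have hval : ∀ Q : HeightOneSpectrum (𝓞 k),
      (algebraMap (𝓞 k) k x)⁻¹ ∉ (Q.valuation k).valuationSubring ↔ ∃ B ∈ S, (P B) = Q := by
    intro Q
    rw [Valuation.mem_valuationSubring_iff, map_inv₀, not_le, one_lt_inv₀,
      Q.valuation_lt_one_iff_mem, ← Ideal.span_singleton_le_iff_mem, ← hx]
    · constructor
      · intro h
        have h2 := Q.isPrime.le_of_pow_le h
        obtain ⟨B, hB, hBQ⟩ := (Q.isPrime.prod_le).1 h2
        exact ⟨B, hB, HeightOneSpectrum.ext ((P B).isMaximal.eq_of_le Q.isPrime.ne_top hBQ)⟩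
      · rintro ⟨B, hB, rfl⟩
        refine (Ideal.pow_le_self Fintype.card_ne_zero).trans ?_
        exact Ideal.prod_le_inf.trans (Finset.inf_le hB)
    · exact zero_lt_iff.2 ((Valuation.ne_zero_iff _).2 hxk)
  constructor
  · intro h
    obtain ⟨Q, rfl⟩ := exists_valuationSubring_eq (ringOfIntegers_mem A)
      (by rintro rfl; exact h trivial)
    obtain ⟨B, hB, rfl⟩ := (hval Q).1 h
    rwa [hP B hB]
  · intro h
    rw [← hP A h]
    exact (hval _).2 ⟨A, h, rfl⟩

/-- The elements without poles except at the zeros of `x` form the localization of `𝓞 k` at `x`. -/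
theorem poleRing_inv_dedekind {x : 𝓞 k} (hx : x ≠ 0) :
    IsDedekindDomain (poleRing (algebraMap (𝓞 k) k x)⁻¹) ∧
      IsFractionRing (poleRing (algebraMap (𝓞 k) k x)⁻¹) k ∧
      ∀ [IsDomain (poleRing (algebraMap (𝓞 k) k x)⁻¹)],
        Finite (ClassGroup (poleRing (algebraMap (𝓞 k) k x)⁻¹)) := by
  have hxk : algebraMap (𝓞 k) k x ≠ 0 := by
    rwa [ne_eq, map_eq_zero_iff _ (IsFractionRing.injective (𝓞 k) k)]
  let R := poleRing (algebraMap (𝓞 k) k x)⁻¹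
  let _ : Algebra (𝓞 k) R := ((algebraMap (𝓞 k) k).codRestrict R fun r =>
    mem_poleRing.2 fun A _ => ringOfIntegers_mem A r).toAlgebra
  have : IsScalarTower (𝓞 k) R k := .of_algebraMap_eq fun _ => rfl
  have hle : Submonoid.powers x ≤ (𝓞 k)⁰ := powers_le_nonZeroDivisors_of_noZeroDivisors hx
  have hloc : IsLocalization (Submonoid.powers x) R := by
    refine ⟨?_, ?_, ?_⟩
    · rintro ⟨_, n, rfl⟩
      refine (map_pow (algebraMap (𝓞 k) R) x n) ▸ IsUnit.pow n ?_
      exact IsUnit.of_mul_eq_one ⟨_, self_mem_poleRing _⟩ (Subtype.ext (mul_inv_cancel₀ hxk))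
    · intro y
      obtain ⟨c, d, h⟩ := exists_pow_mul_eq (K := k) x (y := y) fun B _ hB =>
        mem_poleRing.1 y.2 B hB
      refine ⟨⟨d, ⟨_, c, rfl⟩⟩, Subtype.ext ?_⟩
      change (y : k) * algebraMap (𝓞 k) k (x ^ c) = algebraMap (𝓞 k) k d
      rw [map_pow, mul_comm, h]
    · intro a b h
      refine ⟨1, ?_⟩
      have hk : ((algebraMap (𝓞 k) R a : R) : k) = (algebraMap (𝓞 k) R b : R) := congrArg _ h
      have hab : a = b := IsFractionRing.injective (𝓞 k) k hk
      rw [hab]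
  have : IsDedekindDomain R := IsLocalization.isDedekindDomain (𝓞 k) hle R
  exact ⟨inferInstance,
    IsFractionRing.isFractionRing_of_isDomain_of_isLocalization (Submonoid.powers x) R k,
    fun {_} => finite_classGroup_of_isLocalization (Submonoid.powers x) hle⟩

end NumberFields
end Poles

/-! ### Global fields -/

section GlobalFields
open IntermediateField Polynomial IsDedekindDomain

section CharP
variable {p : ℕ} [Fact p.Prime] {k : Type*} [Field k] [Algebra (ZMod p) k]

/-- The integral closure of `𝔽_p[t]` in a finite separable extension of `k`. -/
theorem poleRing_algebraMap_dedekind {t : k} (ht : Transcendental (ZMod p) t)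
    [FiniteDimensional (ZMod p)⟮t⟯ k] [Algebra.IsSeparable (ZMod p)⟮t⟯ k]
    (K : Type*) [Field K] [Algebra k K] [FiniteDimensional k K] [Algebra.IsSeparable k K] :
    IsDedekindDomain (poleRing (algebraMap k K t)) ∧
      IsFractionRing (poleRing (algebraMap k K t)) K ∧
      ∀ [IsDomain (poleRing (algebraMap k K t))],
        Finite (ClassGroup (poleRing (algebraMap k K t))) := by
  let _ : Algebra (ZMod p) K := ((algebraMap k K).comp (algebraMap (ZMod p) k)).toAlgebra
  have : IsScalarTower (ZMod p) k K := .of_algebraMap_eq fun _ => rfl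
  have ht' : Transcendental (ZMod p) (algebraMap k K t) :=
    (transcendental_algebraMap_iff (algebraMap k K).injective).2 ht
  let t' := algebraMap k K t
  let E := (ZMod p)⟮t⟯
  let E' := (ZMod p)⟮t'⟯
  have hle : E ≤ E'.comap (IsScalarTower.toAlgHom (ZMod p) k K) := by
    rw [adjoin_simple_le_iff]
    exact mem_adjoin_simple_self (ZMod p) t'
  let f : E →+* E' := ((algebraMap k K).comp (algebraMap E k)).codRestrict E' fun e => hle e.2
  let _ : Algebra E E' := f.toAlgebra
  have : IsScalarTower E E' K := .of_algebraMap_eq fun _ => rfl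
  have : FiniteDimensional E K := FiniteDimensional.trans E k K
  have : Algebra.IsSeparable E K := Algebra.IsSeparable.trans E k K
  have : FiniteDimensional (ZMod p)⟮algebraMap k K t⟯ K :=
    Module.Finite.of_restrictScalars_finite E E' K
  have : Algebra.IsSeparable (ZMod p)⟮algebraMap k K t⟯ K :=
    Algebra.isSeparable_tower_top_of_isSeparable E E' K
  exact poleRing_dedekind ht'

end CharP

section NumberFields
open NumberField

/-- The localization of `𝓞 K` at a nonzero element of `𝓞 k`, for a finite extension `K` of `k`. -/
theorem poleRing_algebraMap_inv_dedekind {k : Type*} [Field k] [NumberField k] {x : 𝓞 k}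
    (hx : x ≠ 0) (K : Type*) [Field K] [Algebra k K] [FiniteDimensional k K] :
    IsDedekindDomain (poleRing (algebraMap k K (algebraMap (𝓞 k) k x)⁻¹)) ∧
      IsFractionRing (poleRing (algebraMap k K (algebraMap (𝓞 k) k x)⁻¹)) K ∧
      ∀ [IsDomain (poleRing (algebraMap k K (algebraMap (𝓞 k) k x)⁻¹))],
        Finite (ClassGroup (poleRing (algebraMap k K (algebraMap (𝓞 k) k x)⁻¹))) := by
  have : CharZero K := charZero_of_injective_algebraMap (algebraMap k K).injective
  have : FiniteDimensional ℚ K := FiniteDimensional.trans ℚ k K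
  have : NumberField K := {}
  have hx' : algebraMap (𝓞 k) (𝓞 K) x ≠ 0 := by
    rwa [ne_eq, map_eq_zero_iff _ (FaithfulSMul.algebraMap_injective (𝓞 k) (𝓞 K))]
  have h : algebraMap k K (algebraMap (𝓞 k) k x)⁻¹ =
      (algebraMap (𝓞 K) K (algebraMap (𝓞 k) (𝓞 K) x))⁻¹ := by
    rw [map_inv₀]; rfl
  rw [h]
  exact poleRing_inv_dedekind hx'

end NumberFields

variable {k : Type*} [Field k]

/-- The set of poles of `t` among the places of `k` is `S`, archimedean places aside. -/
def PolesEq (t : k) (S : Finset (Place k)) : Prop :=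
  ∀ (A : ValuationSubring k) (hA : A ≠ ⊤), t ∉ A ↔ Place.finite A hA ∈ S

/-- The valuation rings of the finite places in `S`. -/
theorem exists_finset_finite_mem (S : Finset (Place k)) : ∃ F : Finset (ValuationSubring k),
    (∀ A ∈ F, A ≠ ⊤) ∧ ∀ (A : ValuationSubring k) (hA : A ≠ ⊤), A ∈ F ↔ Place.finite A hA ∈ S := by
  classical
  let f : Place k → Option (ValuationSubring k) := fun v => match v with
    | .finite A _ => some A
    | .infinite _ => none
  have h : ∀ A, A ∈ S.filterMap f (by
      rintro (⟨A, hA⟩ | w) (⟨B, hB⟩ | w') C h1 h2 <;> simp_all [f]) ↔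
      ∃ hA : A ≠ ⊤, Place.finite A hA ∈ S := by
    intro A
    rw [Finset.mem_filterMap]
    constructor
    · rintro ⟨⟨B, hB⟩ | w, h1, h2⟩
      · obtain rfl : B = A := by simpa [f] using h2
        exact ⟨hB, h1⟩
      · simp [f] at h2
    · rintro ⟨hA, h⟩
      exact ⟨_, h, rfl⟩
  refine ⟨_, fun A hA => ((h A).1 hA).1, fun A hA => ?_⟩
  rw [h]
  exact ⟨fun h => h.2, fun h => ⟨hA, h⟩⟩

/-- In a global field every nonempty finite set `S` of places is, archimedean places aside, the set
of poles of an element `t`. It can be chosen such that the ring of elements with poles only at the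
poles of `t` is a Dedekind domain, in `k` and in its finite separable extensions, where its class
group is finite. -/
theorem exists_polesEq.{u} (hk : IsGlobalField k) {S : Finset (Place k)} (hS : S.Nonempty) :
    ∃ t : k, PolesEq t S ∧ (IsDedekindDomain (poleRing t) ∧ IsFractionRing (poleRing t) k) ∧
      ∀ (K : Type u) [Field K] [Algebra k K] [FiniteDimensional k K] [Algebra.IsSeparable k K],
        IsDedekindDomain (poleRing (algebraMap k K t)) ∧
          IsFractionRing (poleRing (algebraMap k K t)) K ∧
          ∀ [IsDomain (poleRing (algebraMap k K t))],
            Finite (ClassGroup (poleRing (algebraMap k K t))) := by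
  obtain ⟨F, hFtop, hF⟩ := exists_finset_finite_mem S
  rcases hk with hk | ⟨p, hp, halg, hff⟩
  · obtain ⟨x, hx, hxF⟩ := exists_inv_poles_eq F hFtop
    exact ⟨_, fun A hA => (hxF A).trans (hF A hA), ⟨(poleRing_inv_dedekind hx).1,
      (poleRing_inv_dedekind hx).2.1⟩, fun K => poleRing_algebraMap_inv_dedekind hx K⟩
  · let _ : Algebra (ZMod p) k :=
      ((algebraMap (RatFunc (ZMod p)) k).comp (algebraMap (ZMod p) (RatFunc (ZMod p)))).toAlgebra
    have : IsScalarTower (ZMod p) (RatFunc (ZMod p)) k := .of_algebraMap_eq fun _ => rfl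
    have hfin : ∀ y : k, Transcendental (ZMod p) y → FiniteDimensional (ZMod p)⟮y⟯ k :=
      fun y hy => FunctionField.finiteDimensional_of_adjoin_transcendental hy
    have hFne : F.Nonempty := by
      obtain ⟨⟨A, hA⟩ | w, hv⟩ := hS
      · exact ⟨A, (hF A hA).2 hv⟩
      -- In positive characteristic there are no archimedean places, so that `S` contains a finite
      -- one.
      · have : CharP k p := charP_of_injective_algebraMap (algebraMap (ZMod p) k).injective p
        have h0 : ((p : ℕ) : k) = 0 := CharP.cast_eq_zero k p
        have h1 := congrArg w.embedding h0
        rw [map_natCast, map_zero, Nat.cast_eq_zero] at h1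
        exact absurd h1 hp.out.ne_zero
    obtain ⟨t, ht, hsep, htF⟩ := exists_poles_eq hfin F hFne hFtop
    have := hfin t ht
    exact ⟨t, fun A hA => (htF A).trans (hF A hA), ⟨(poleRing_dedekind ht).1,
      (poleRing_dedekind ht).2.1⟩, fun K => poleRing_algebraMap_dedekind ht K⟩

/-- Every nontrivial valuation ring of a global field contains a Dedekind domain of the form
`poleRing u`. -/
theorem exists_mem_dedekind (hk : IsGlobalField k) {A : ValuationSubring k} (hA : A ≠ ⊤) :
    ∃ u ∈ A, IsDedekindDomain (poleRing u) ∧ IsFractionRing (poleRing u) k := by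
  rcases hk with hk | ⟨p, hp, halg, hff⟩
  · have h := poleRing_inv_dedekind (k := k) (x := 1) one_ne_zero
    exact ⟨_, by simp, h.1, h.2.1⟩
  · let _ : Algebra (ZMod p) k :=
      ((algebraMap (RatFunc (ZMod p)) k).comp (algebraMap (ZMod p) (RatFunc (ZMod p)))).toAlgebra
    have : IsScalarTower (ZMod p) (RatFunc (ZMod p)) k := .of_algebraMap_eq fun _ => rfl
    have hfin : ∀ y : k, Transcendental (ZMod p) y → FiniteDimensional (ZMod p)⟮y⟯ k :=
      fun y hy => FunctionField.finiteDimensional_of_adjoin_transcendental hy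
    obtain ⟨u, huA, hu, husep⟩ := exists_transcendental_mem hfin hA
    have := hfin u hu
    exact ⟨u, huA, (poleRing_dedekind hu).1, (poleRing_dedekind hu).2.1⟩

/-- The normalized valuation of a nontrivial valuation ring of a global field. -/
theorem exists_valuation (hk : IsGlobalField k) {A : ValuationSubring k} (hA : A ≠ ⊤) :
    ∃ ν : kˣ →* Multiplicative ℤ, ∀ x, ν x = 1 ↔ (x : k) ∈ A ∧ ((x⁻¹ : kˣ) : k) ∈ A := by
  obtain ⟨u, huA, _, _⟩ := exists_mem_dedekind hk hA
  obtain ⟨P, rfl⟩ := exists_valuationSubring_eq (D := poleRing u)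
    (fun d => mem_poleRing.1 d.2 A huA) hA
  refine ⟨P.valuationOfNeZero, fun x => ?_⟩
  rw [← WithZero.coe_inj, HeightOneSpectrum.valuationOfNeZero_eq,
    Valuation.mem_valuationSubring_iff, Valuation.mem_valuationSubring_iff,
    Units.val_inv_eq_inv_val, map_inv₀, inv_le_one₀, WithZero.coe_one, le_antisymm_iff]
  exact zero_lt_iff.2 ((Valuation.ne_zero_iff _).2 x.ne_zero)

/-- The elements of `kˣ` that are units at every finite place. -/
def everywhereUnits (k : Type*) [Field k] : Subgroup kˣ :=
  ⨅ A : ValuationSubring k, A.toSubring.toSubmonoid.units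

theorem mem_everywhereUnits {x : kˣ} :
    x ∈ everywhereUnits k ↔ ∀ A : ValuationSubring k, (x : k) ∈ A ∧ ((x⁻¹ : kˣ) : k) ∈ A := by
  simp only [everywhereUnits, Subgroup.mem_iInf, Submonoid.mem_units_iff]
  rfl

/-- For a number field this group is the unit group of the ring of integers, and for a function
field it is the finite group of nonzero constants. -/
theorem everywhereUnits_fg (hk : IsGlobalField k) : (everywhereUnits k).FG := by
  rcases hk with hk | ⟨p, hp, halg, hff⟩
  · have h : everywhereUnits k = (Units.map (algebraMap (NumberField.RingOfIntegers k) k :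
        NumberField.RingOfIntegers k →* k)).range := by
      ext x
      rw [mem_everywhereUnits]
      constructor
      · intro h
        have h1 : IsIntegral ℤ (x : k) :=
          isIntegral_iff_forall_valuationSubring.2 fun B _ => (h B).1
        have h2 : IsIntegral ℤ ((x⁻¹ : kˣ) : k) :=
          isIntegral_iff_forall_valuationSubring.2 fun B _ => (h B).2
        exact ⟨⟨⟨_, h1⟩, ⟨_, h2⟩, Subtype.ext x.mul_inv, Subtype.ext x.inv_mul⟩, Units.ext rfl⟩
      · rintro ⟨y, rfl⟩ A
        exact ⟨ringOfIntegers_mem A y, ringOfIntegers_mem A (y⁻¹ : _ˣ)⟩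
    rw [h]
    have : Group.FG (NumberField.RingOfIntegers k)ˣ := Group.fg_iff_monoid_fg.2 inferInstance
    rw [← Group.fg_iff_subgroup_fg]
    infer_instance
  · let _ : Algebra (ZMod p) k :=
      ((algebraMap (RatFunc (ZMod p)) k).comp (algebraMap (ZMod p) (RatFunc (ZMod p)))).toAlgebra
    have : IsScalarTower (ZMod p) (RatFunc (ZMod p)) k := .of_algebraMap_eq fun _ => rfl
    have hfin : ∀ y : k, Transcendental (ZMod p) y → FiniteDimensional (ZMod p)⟮y⟯ k :=
      fun y hy => FunctionField.finiteDimensional_of_adjoin_transcendental hy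
    have hX : Transcendental (ZMod p) (algebraMap (RatFunc (ZMod p)) k RatFunc.X) :=
      (transcendental_algebraMap_iff (algebraMap (RatFunc (ZMod p)) k).injective).2
        RatFunc.transcendental_X
    obtain ⟨A, hA⟩ : ∃ A : ValuationSubring k, algebraMap (RatFunc (ZMod p)) k RatFunc.X ∉ A := by
      by_contra! h
      exact hX (isAlgebraic_iff_forall_mem.2 h)
    have h1 := finite_setOf_isAlgebraic hfin (A := A) (by rintro rfl; exact hA trivial)
    have h2 : (everywhereUnits k : Set kˣ).Finite :=
      Set.Finite.of_finite_image (f := Units.val) (h1.subset (by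
        rintro _ ⟨x, hx, rfl⟩
        exact isAlgebraic_iff_forall_mem.2 fun A => (mem_everywhereUnits.1 hx A).1))
        Units.val_injective.injOn
    have : Finite (everywhereUnits k) := h2
    rw [← Group.fg_iff_subgroup_fg]
    infer_instance

end GlobalFields

/-! ### Maximal orders at a finite place -/

section LocalAlgebra
open Polynomial IsDedekindDomain

variable {k : Type*} [Field k]

/-- The valuation of `k_v`, `v` a finite place. -/
noncomputable def finiteVal (A : ValuationSubring k) (hA : A ≠ ⊤) :
    Valuation (Place.finite A hA).Completion A.ValueGroup :=
  (Valued.v : Valuation A.valuation.Completion A.ValueGroup)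

section
variable {A : ValuationSubring k} {hA : A ≠ ⊤}

theorem mem_integers_finite {x : (Place.finite A hA).Completion} :
    x ∈ (Place.finite A hA).integers ↔ finiteVal A hA x ≤ 1 := Iff.rfl

theorem finiteVal_algebraMap (x : k) :
    finiteVal A hA (algebraMap k (Place.finite A hA).Completion x) = A.valuation x :=
  (Valued.valuedCompletion_apply (WithVal.toVal A.valuation x)).trans (WithVal.valued_toVal _ _)

theorem algebraMap_mem_integers_iff {x : k} :
    algebraMap k (Place.finite A hA).Completion x ∈ (Place.finite A hA).integers ↔ x ∈ A := by
  rw [mem_integers_finite, finiteVal_algebraMap, ValuationSubring.valuation_le_one_iff]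

theorem isOpen_integers_finite :
    IsOpen ((Place.finite A hA).integers : Set (Place.finite A hA).Completion) :=
  Valued.isOpen_integer A.valuation.Completion

theorem denseRange_algebraMap_finite :
    DenseRange (algebraMap k (Place.finite A hA).Completion) := by
  have h := (UniformSpace.Completion.denseRange_coe (α := WithVal A.valuation))
  exact h.comp (WithVal.toVal_surjective A.valuation).denseRange
    (UniformSpace.Completion.continuous_coe _)

theorem integers_finite_valuationRing : ValuationRing (Place.finite A hA).integers :=
  ValuationRing.of_integers (finiteVal A hA) (Valuation.integer.integers (finiteVal A hA))

theorem integers_finite_isFractionRing :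
    IsFractionRing (Place.finite A hA).integers (Place.finite A hA).Completion :=
  (Valuation.integer.integers (finiteVal A hA)).isFractionRing

end

section Minpoly
variable {F L : Type*} [Field F] [Algebra k F] [CommRing L] [Algebra k L]

/-- Minimal polynomials are stable under extension of scalars to a field. -/
theorem minpoly_one_tmul {y : L} (hy : IsIntegral k y) :
    minpoly F ((1 : F) ⊗ₜ[k] y) = (minpoly k y).map (algebraMap k F) := by
  symm
  refine minpoly.unique' _ _ ((minpoly.monic hy).map _) ?_ fun q hq => ?_
  · rw [aeval_map_algebraMap]
    have := aeval_algHom_apply (Algebra.TensorProduct.includeRight : L →ₐ[k] F ⊗[k] L) y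
      (minpoly k y)
    rw [minpoly.aeval, map_zero] at this
    exact this
  · rw [or_iff_not_imp_right, not_not]
    intro h0
    by_contra hq0
    have hdeg : q.natDegree < (minpoly k y).natDegree := by
      rw [degree_eq_natDegree hq0, degree_map, degree_eq_natDegree (minpoly.ne_zero hy)] at hq
      exact_mod_cast hq
    have hli := Module.Flat.linearIndependent_one_tmul (S := F) (linearIndependent_pow (K := k) y)
    rw [aeval_eq_sum_range' hdeg, ← Fin.sum_univ_eq_sum_range
      (fun i => q.coeff i • ((1 : F) ⊗ₜ[k] y) ^ i)] at h0
    have hz := Fintype.linearIndependent_iff.1 hli (fun i => q.coeff i) (by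
      rw [← h0]
      exact Finset.sum_congr rfl fun i _ => by simp [Algebra.TensorProduct.tmul_pow])
    refine hq0 (leadingCoeff_eq_zero.1 (hz ⟨q.natDegree, hdeg⟩))

end Minpoly

section LocalOrder
variable {L : Type*} [CommRing L] [Algebra k L] [Module.Finite k L]

/-- An element of `L` is integral over `O_v` in `L_v` iff it is integral over the valuation ring
of `k` at `v`. -/
theorem one_tmul_mem_localOrder_iff {A : ValuationSubring k} {hA : A ≠ ⊤} {y : L} :
    (1 : (Place.finite A hA).Completion) ⊗ₜ[k] y ∈ localOrder L (.finite A hA) ↔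
      IsIntegral A y := by
  let v := Place.finite A hA
  have := integers_finite_valuationRing (A := A) (hA := hA)
  have := integers_finite_isFractionRing (A := A) (hA := hA)
  have hyk : IsIntegral k y := Algebra.IsIntegral.isIntegral y
  constructor
  -- The minimal polynomial of `y` over `k` divides over `k_v` a monic polynomial with coefficients
  -- in `O_v`. As `O_v` is integrally closed, its coefficients lie in `O_v ∩ k = A`.
  · rintro ⟨g, hg, hgy⟩
    have hdvd : (minpoly k y).map (algebraMap k v.Completion) ∣
        g.map (algebraMap v.integers v.Completion) := by
      rw [← minpoly_one_tmul hyk]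
      refine minpoly.dvd _ _ ?_
      rw [aeval_map_algebraMap]
      exact hgy
    obtain ⟨g', hg'⟩ := IsIntegrallyClosed.eq_map_mul_C_of_dvd v.Completion hg hdvd
    rw [((minpoly.monic hyk).map _).leadingCoeff, C_1, mul_one] at hg'
    have hlift : minpoly k y ∈ lifts (algebraMap A k) := by
      rw [lifts_iff_coeff_lifts]
      intro n
      have h1 := congrArg (fun f => coeff f n) hg'
      simp only [coeff_map] at h1
      have h2 : algebraMap k v.Completion ((minpoly k y).coeff n) ∈ v.integers := by
        rw [← h1]
        exact (g'.coeff n).2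
      exact ⟨⟨_, algebraMap_mem_integers_iff.1 h2⟩, rfl⟩
    obtain ⟨f, hf, -, hfm⟩ := lifts_and_natDegree_eq_and_monic hlift (minpoly.monic hyk)
    refine ⟨f, hfm, ?_⟩
    rw [← aeval_def, ← aeval_map_algebraMap k, hf, minpoly.aeval]
  · rintro ⟨g, hg, hgy⟩
    let f : A →+* v.integers := ((algebraMap k v.Completion).comp A.subtype).codRestrict v.integers
      fun a => algebraMap_mem_integers_iff.2 a.2
    refine ⟨g.map f, hg.map f, ?_⟩
    rw [eval₂_map]
    have h := congrArg (Algebra.TensorProduct.includeRight : L →ₐ[k] LocalAlg L v) hgy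
    rw [map_zero, ← AlgHom.coe_toRingHom, hom_eval₂] at h
    have hcomp : (algebraMap v.integers (LocalAlg L v)).comp f =
        ((Algebra.TensorProduct.includeRight : L →ₐ[k] LocalAlg L v) : L →+* LocalAlg L v).comp
          (algebraMap A L) := by
      refine RingHom.ext fun a => ?_
      change algebraMap v.Completion (LocalAlg L v) (algebraMap k v.Completion a) =
        (Algebra.TensorProduct.includeRight : L →ₐ[k] LocalAlg L v) (algebraMap k L a)
      rw [AlgHom.commutes, ← IsScalarTower.algebraMap_apply]
    rw [hcomp]
    exact h

/-- Elements of `k_v` are approximated by elements of `k` up to multiples of a given `e ≠ 0`. -/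
theorem exists_sub_mem_smul_integers {A : ValuationSubring k} {hA : A ≠ ⊤}
    (c : (Place.finite A hA).Completion) {e : (Place.finite A hA).Completion} (he : e ≠ 0) :
    ∃ x : k, ∃ d ∈ (Place.finite A hA).integers, c - algebraMap k _ x = e * d := by
  let v := Place.finite A hA
  have hopen : IsOpen {z : v.Completion | (c - z) * e⁻¹ ∈ v.integers} :=
    (isOpen_integers_finite (A := A) (hA := hA)).preimage (by fun_prop)
  obtain ⟨x, hx⟩ := denseRange_algebraMap_finite.exists_mem_open hopen
    ⟨c, by
      change (c - c) * e⁻¹ ∈ v.integers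
      rw [sub_self, zero_mul]
      exact zero_mem v.integers⟩
  exact ⟨x, _, hx, by field_simp⟩

/-- In an integral extension of a local ring, `1` minus a multiple of a nonunit of the local ring is
a unit. -/
theorem isUnit_one_sub_of_isIntegral {R S : Type*} [CommRing R] [IsLocalRing R] [CommRing S]
    [Algebra R S] [Algebra.IsIntegral R S] {r : R} (hr : ¬ IsUnit r) (s : S) :
    IsUnit (1 - algebraMap R S r * s) := by
  by_contra h
  obtain ⟨M, hM, hmem⟩ := exists_max_ideal_of_mem_nonunits h
  have h1 := Ideal.isMaximal_comap_of_isIntegral_of_isMaximal (R := R) M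
  have h2 : r ∈ M.comap (algebraMap R S) := by
    rw [IsLocalRing.eq_maximalIdeal h1]
    exact hr
  refine hM.ne_top ((Ideal.eq_top_iff_one M).2 ?_)
  have := M.add_mem hmem (M.mul_mem_right s h2)
  rwa [sub_add_cancel] at this

/-- Local approximation: every element of `L_v^×` is the product of an element of `L^×` and a unit
of the maximal order, `v` a finite place. -/
theorem exists_mul_mem_localUnits {A : ValuationSubring k} {hA : A ≠ ⊤}
    (x : (LocalAlg L (.finite A hA))ˣ) :
    ∃ a : Lˣ, x * (Units.map ((Algebra.TensorProduct.includeRight :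
      L →ₐ[k] LocalAlg L (.finite A hA)) : L →* LocalAlg L (.finite A hA)) a)⁻¹ ∈
        localUnits L (.finite A hA) := by
  let v := Place.finite A hA
  have := integers_finite_valuationRing (A := A) (hA := hA)
  have := integers_finite_isFractionRing (A := A) (hA := hA)
  -- The coordinates of `x` are approximated up to multiples of `π d`, where `d` is a common
  -- denominator of the products of `x⁻¹` with the basis vectors and `π` is a nonunit of `O_v`. Then
  -- `x⁻¹ a` differs from `1` by an element of `π O_{L_v}`.
  let b := Module.finBasis k L
  let B : Module.Basis _ v.Completion (LocalAlg L v) := b.baseChange v.Completion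
  let z := fun j => ((x⁻¹ : (LocalAlg L v)ˣ) : LocalAlg L v) * (1 ⊗ₜ b j)
  obtain ⟨d, hd0, hd⟩ : ∃ d : v.integers, d ≠ 0 ∧ ∀ j, IsIntegral v.integers (d • z j) := by
    choose d hd0 hd using fun j => (show IsAlgebraic v.integers (z j) from
      (IsFractionRing.isAlgebraic_iff v.integers v.Completion _).2
        (Algebra.IsIntegral.isIntegral (z j)).isAlgebraic).exists_integral_multiple
    refine ⟨∏ j, d j, Finset.prod_ne_zero_iff.2 fun j _ => hd0 j, fun j => ?_⟩
    classical
    rw [← Finset.prod_erase_mul _ _ (Finset.mem_univ j), mul_smul]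
    exact (hd j).smul _
  obtain ⟨τ, hτA⟩ : ∃ τ, τ ∉ A := by
    by_contra! h
    exact hA (eq_top_iff.2 fun x _ => h x)
  have hτ0 : τ ≠ 0 := by rintro rfl; exact hτA (zero_mem A)
  let π : v.integers := ⟨algebraMap k v.Completion τ⁻¹,
    algebraMap_mem_integers_iff.2 ((A.mem_or_inv_mem τ).resolve_left hτA)⟩
  have hπ : ¬ IsUnit π := by
    intro h
    obtain ⟨y, hy⟩ := h.exists_right_inv
    have hy' : algebraMap k v.Completion τ⁻¹ * (y : v.Completion) = 1 := congrArg Subtype.val hy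
    refine hτA (algebraMap_mem_integers_iff (hA := hA).1 ?_)
    rw [map_inv₀, inv_mul_eq_one₀ (by simpa using hτ0)] at hy'
    rw [hy']
    exact y.2
  have hπ0 : (π : v.Completion) ≠ 0 := by simpa [π] using hτ0
  have hd0' : (d : v.Completion) ≠ 0 := by simpa using hd0
  choose a e he hae using fun j => exists_sub_mem_smul_integers (B.repr (x : LocalAlg L v) j)
    (mul_ne_zero hπ0 hd0')
  let a' : L := ∑ j, a j • b j
  have hxa : (x : LocalAlg L v) - 1 ⊗ₜ a' = ∑ j, ((π : v.Completion) * d * e j) • (1 ⊗ₜ b j) := by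
    conv_lhs => rw [← B.sum_repr (x : LocalAlg L v)]
    rw [TensorProduct.tmul_sum, ← Finset.sum_sub_distrib]
    refine Finset.sum_congr rfl fun j _ => ?_
    rw [← hae, sub_smul, Module.Basis.baseChange_apply, TensorProduct.tmul_smul, algebraMap_smul]
  let O := integralClosure v.integers (LocalAlg L v)
  have hw : ∃ w : O, ((x⁻¹ : (LocalAlg L v)ˣ) : LocalAlg L v) * 1 ⊗ₜ a' =
      1 - algebraMap v.integers (LocalAlg L v) π * (w : LocalAlg L v) := by
    refine ⟨∑ j, (⟨e j, he j⟩ : v.integers) • ⟨d • z j, hd j⟩, ?_⟩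
    rw [eq_sub_iff_add_eq', ← eq_sub_iff_add_eq, ← x.inv_mul, ← mul_sub, hxa]
    rw [Finset.mul_sum, AddSubmonoidClass.coe_finsetSum, Finset.mul_sum]
    refine Finset.sum_congr rfl fun j _ => Eq.symm ?_
    change ((x⁻¹ : (LocalAlg L v)ˣ) : LocalAlg L v) *
        (((π : v.Completion) * d * e j) • (1 ⊗ₜ b j)) =
      algebraMap v.Completion (LocalAlg L v) π * ((e j) • ((d : v.Completion) • z j))
    rw [mul_smul_comm, show ∀ q, algebraMap v.Completion (LocalAlg L v) π * q =
      (π : v.Completion) • q from fun q => (Algebra.smul_def _ q).symm, smul_smul, smul_smul]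
    congr 1
    ring
  obtain ⟨w, hw⟩ := hw
  have hu : IsUnit (1 - algebraMap v.integers O π * w) := isUnit_one_sub_of_isIntegral hπ w
  obtain ⟨y, hy⟩ := hu
  have hy' : ((x⁻¹ : (LocalAlg L v)ˣ) : LocalAlg L v) * 1 ⊗ₜ a' =
      ((y : O) : LocalAlg L v) := by
    rw [hw, hy]
    rfl
  have ha1 : IsUnit ((1 : v.Completion) ⊗ₜ[k] a') := by
    have : IsUnit (((x⁻¹ : (LocalAlg L v)ˣ) : LocalAlg L v) * 1 ⊗ₜ a') := by
      rw [hy']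
      exact (y.isUnit).map O.val
    exact (isUnit_of_mul_isUnit_right this)
  have ha : IsUnit a' := by
    -- As `L → L_v` is injective, `a'` is not a zero divisor, hence a unit.
    have : IsArtinianRing L := isArtinian_of_tower k inferInstance
    refine IsArtinianRing.isUnit_of_mem_nonZeroDivisors
      (mem_nonZeroDivisors_iff_left.2 fun c hc => ?_)
    have h1 : (1 : v.Completion) ⊗ₜ[k] a' * (1 : v.Completion) ⊗ₜ[k] c = 0 := by
      rw [Algebra.TensorProduct.tmul_mul_tmul, hc, TensorProduct.tmul_zero]
    refine Module.Flat.tensorProduct_mk_injective (R := k) (S := v.Completion) (M := L) ?_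
    rw [map_zero]
    exact ha1.mul_right_eq_zero.1 h1
  obtain ⟨a, ha⟩ := ha
  let Y : (LocalAlg L v)ˣ := Units.map (O.val : O →* LocalAlg L v) y
  have hY : Y ∈ localUnits L v := ⟨(y : O).2, ((y⁻¹ : Oˣ) : O).2⟩
  refine ⟨a, ?_⟩
  convert (localUnits L v).inv_mem hY using 1
  have hYx : Y = x⁻¹ * Units.map ((Algebra.TensorProduct.includeRight :
      L →ₐ[k] LocalAlg L v) : L →* LocalAlg L v) a := Units.ext (by
    change ((y : O) : LocalAlg L v) = ((x⁻¹ : (LocalAlg L v)ˣ) : LocalAlg L v) * 1 ⊗ₜ (a : L)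
    rw [ha]
    exact hy'.symm)
  rw [hYx, mul_inv_rev, inv_inv, mul_comm]

end LocalOrder
end LocalAlgebra

/-! ### Rings of `S`-integers -/

section SIntegerRings
open Polynomial IsDedekindDomain

variable {k : Type*} [Field k] {S : Finset (Place k)}

theorem mem_baseSIntegers (hS_arch : ∀ w : NumberField.InfinitePlace k, Place.infinite w ∈ S)
    {x : k} : x ∈ baseSIntegers S ↔
      ∀ (A : ValuationSubring k) (hA : A ≠ ⊤), Place.finite A hA ∉ S → x ∈ A := by
  simp only [baseSIntegers, Subring.mem_iInf, Subring.mem_comap, Subtype.forall]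
  constructor
  · intro h A hA hAS
    exact algebraMap_mem_integers_iff.1 (h _ hAS)
  · rintro h (⟨A, hA⟩ | w) hv
    · exact algebraMap_mem_integers_iff.2 (h A hA hv)
    · exact absurd (hS_arch w) hv

theorem mem_sIntegers (hS_arch : ∀ w : NumberField.InfinitePlace k, Place.infinite w ∈ S)
    {L : Type*} [CommRing L] [Algebra k L] [Module.Finite k L] {y : L} :
    y ∈ sIntegers L S ↔
      ∀ (A : ValuationSubring k) (hA : A ≠ ⊤), Place.finite A hA ∉ S → IsIntegral A y := by
  simp only [sIntegers, Subring.mem_iInf, Subring.mem_comap, Subtype.forall]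
  constructor
  · intro h A hA hAS
    exact one_tmul_mem_localOrder_iff.1 (h _ hAS)
  · rintro h (⟨A, hA⟩ | w) hv
    · exact one_tmul_mem_localOrder_iff.2 (h A hA hv)
    · exact absurd (hS_arch w) hv

/-- In a finite product, integrality can be checked componentwise. -/
theorem isIntegral_pi_iff {R ι : Type*} [CommRing R] [Finite ι] {B : ι → Type*}
    [∀ i, CommRing (B i)] [∀ i, Algebra R (B i)] {y : ∀ i, B i} :
    IsIntegral R y ↔ ∀ i, IsIntegral R (y i) := by
  classical
  have := Fintype.ofFinite ι
  constructor
  · intro h i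
    exact h.map (Pi.evalAlgHom R B i)
  · intro h
    choose f hf hfy using h
    refine ⟨∏ i, f i, monic_prod_of_monic _ _ fun i _ => hf i, funext fun i => ?_⟩
    have h1 := aeval_algHom_apply (Pi.evalAlgHom R B i) y (∏ i, f i)
    change _ = (aeval y (∏ i, f i)) i at h1
    change (aeval y (∏ i, f i)) i = 0
    rw [← h1, map_prod]
    exact Finset.prod_eq_zero (Finset.mem_univ i) (hfy i)

theorem isIntegral_valuationSubring_pi_iff {ι : Type*} [Finite ι] {B : ι → Type*}
    [∀ i, CommRing (B i)] [∀ i, Algebra k (B i)] {A : ValuationSubring k} {y : ∀ i, B i} :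
    IsIntegral A y ↔ ∀ i, IsIntegral A (y i) :=
  isIntegral_pi_iff

/-- There are no proper inclusions between nontrivial valuation rings of a global field. -/
theorem eq_of_le_of_ne_top (hk : IsGlobalField k) {A A' : ValuationSubring k} (hle : A ≤ A')
    (hA' : A' ≠ ⊤) : A = A' := by
  have hA : A ≠ ⊤ := by
    rintro rfl
    exact hA' (top_le_iff.1 hle)
  obtain ⟨u, huA, _, _⟩ := exists_mem_dedekind hk hA
  obtain ⟨P, rfl⟩ := exists_valuationSubring_eq (D := poleRing u)
    (fun d => mem_poleRing.1 d.2 A huA) hA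
  obtain ⟨Q, rfl⟩ := exists_valuationSubring_eq (D := poleRing u)
    (fun d => mem_poleRing.1 d.2 A' (hle huA)) hA'
  rw [eq_of_valuationSubring_le hle]

section Extension
variable {K : Type*} [Field K] [Algebra k K]

theorem comap_ne_top [Algebra.IsIntegral k K] {B : ValuationSubring K} (hB : B ≠ ⊤) :
    B.comap (algebraMap k K) ≠ ⊤ := by
  intro h
  refine hB (eq_top_iff.2 fun x _ => ?_)
  refine isIntegral_iff_forall_valuationSubring.1 (Algebra.IsIntegral.isIntegral (R := k) x) B
    fun r => ?_
  have : r ∈ B.comap (algebraMap k K) := by rw [h]; trivial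
  exact this

theorem mem_of_isIntegral {B : ValuationSubring K} {A : ValuationSubring k} {y : K}
    (hy : IsIntegral A y) (hA : A ≤ B.comap (algebraMap k K)) : y ∈ B :=
  isIntegral_iff_forall_valuationSubring.1 hy B fun r => hA r.2

variable {t : k} (ht : PolesEq t S)
include ht

/-- The `S`-integers of `k` are the elements with poles only at the poles of `t`. -/
theorem baseSIntegers_eq_poleRing
    (hS_arch : ∀ w : NumberField.InfinitePlace k, Place.infinite w ∈ S) :
    baseSIntegers S = poleRing t := by
  ext x
  rw [mem_baseSIntegers hS_arch, mem_poleRing]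
  constructor
  · intro h A htA
    by_cases hA : A = ⊤
    · rw [hA]; trivial
    · exact h A hA fun hAS => (ht A hA).2 hAS htA
  · intro h A hA hAS
    exact h A (by_contra fun h' => hAS ((ht A hA).1 h'))

/-- The `S`-integers of a finite extension are the elements with poles only at the poles of `t`. -/
theorem sIntegers_eq_poleRing [FiniteDimensional k K]
    (hS_arch : ∀ w : NumberField.InfinitePlace k, Place.infinite w ∈ S) :
    sIntegers K S = poleRing (algebraMap k K t) := by
  ext y
  rw [mem_sIntegers hS_arch, mem_poleRing]
  constructor
  · intro h B htB
    by_cases hB : B = ⊤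
    · rw [hB]; trivial
    · have hA := comap_ne_top (k := k) hB
      exact mem_of_isIntegral (h _ hA fun hAS => (ht _ hA).2 hAS htB) le_rfl
  · intro h A hA hAS
    refine isIntegral_iff_forall_valuationSubring.2 fun B hB => h B ?_
    exact hB ⟨t, by_contra fun h' => hAS ((ht A hA).1 h')⟩

end Extension

section Below
variable {K : Type*} [Field K] [Algebra k K] [IsDedekindDomain (sIntegers K S)]
  [IsFractionRing (sIntegers K S) K]

/-- The valuation ring of `k` below a prime ideal of `O_{K,S}`. -/
noncomputable def below (P : HeightOneSpectrum (sIntegers K S)) : ValuationSubring k :=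
  (P.valuation K).valuationSubring.comap (algebraMap k K)

theorem below_ne_top [Algebra.IsIntegral k K] (P : HeightOneSpectrum (sIntegers K S)) :
    below P ≠ ⊤ :=
  comap_ne_top (valuationSubring_ne_top P)

/-- There are only finitely many primes of `O_{K,S}` above a place of `k`: they are among the poles
of an element of `k` that has a pole at that place. -/
theorem finite_setOf_below_eq {A : ValuationSubring k} (hA : A ≠ ⊤) :
    {P : HeightOneSpectrum (sIntegers K S) | below P = A}.Finite := by
  obtain ⟨τ, hτ⟩ : ∃ τ, τ ∉ A := by
    by_contra! h
    exact hA (eq_top_iff.2 fun x _ => h x)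
  refine (HeightOneSpectrum.Support.finite (sIntegers K S) (algebraMap k K τ)).subset ?_
  rintro P rfl
  exact not_le.1 (show ¬ P.valuation K (algebraMap k K τ) ≤ 1 from hτ)

variable [FiniteDimensional k K] (hk : IsGlobalField k)
  (hS_arch : ∀ w : NumberField.InfinitePlace k, Place.infinite w ∈ S) {t : k} (ht : PolesEq t S)
include hS_arch ht

theorem below_notMem (P : HeightOneSpectrum (sIntegers K S)) :
    Place.finite (below P) (below_ne_top P) ∉ S := by
  intro h
  refine (ht _ _).2 h ?_
  have h1 : algebraMap k K t ∈ sIntegers K S := by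
    rw [sIntegers_eq_poleRing ht hS_arch]
    exact self_mem_poleRing _
  exact P.valuation_le_one (K := K) ⟨_, h1⟩

include hk

/-- Integrality over the valuation ring of `k` at a place outside `S` can be checked at the primes
above it. -/
theorem isIntegral_iff_forall_below {A : ValuationSubring k} {hA : A ≠ ⊤}
    (hAS : Place.finite A hA ∉ S) {y : K} :
    IsIntegral A y ↔
      ∀ P : HeightOneSpectrum (sIntegers K S), below P = A → P.valuation K y ≤ 1 := by
  constructor
  · rintro h P rfl
    exact mem_of_isIntegral h le_rfl
  · intro h
    refine isIntegral_iff_forall_valuationSubring.2 fun B hB => ?_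
    by_cases hBt : B = ⊤
    · rw [hBt]; trivial
    have hAB : A ≤ B.comap (algebraMap k K) := fun a ha => hB ⟨a, ha⟩
    have htB : algebraMap k K t ∈ B := hAB (by_contra fun h' => hAS ((ht A hA).1 h'))
    obtain ⟨P, rfl⟩ := exists_valuationSubring_eq (D := sIntegers K S) (B := B) (fun d => by
      have h1 := (sIntegers_eq_poleRing (K := K) ht hS_arch).le d.2
      exact mem_poleRing.1 h1 B htB) hBt
    exact h P (eq_of_le_of_ne_top hk hAB (below_ne_top P)).symm

/-- An element of `K` is integral at almost all places of `k`. The second condition refers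
to the valuation ring of a place `v` that need not be finite. -/
theorem finite_setOf_not_isIntegral (y : K) :
    {v : Place k | v ∉ S ∧ ∀ A hA, v = .finite A hA → ¬ IsIntegral A y}.Finite := by
  refine ((HeightOneSpectrum.Support.finite (sIntegers K S) y).image
    fun P => Place.finite (below P) (below_ne_top P)).subset ?_
  rintro (⟨A, hA⟩ | w) ⟨hv, h⟩
  · have h1 := h A hA rfl
    rw [isIntegral_iff_forall_below hk hS_arch ht hv] at h1
    push Not at h1
    obtain ⟨P, rfl, hP⟩ := h1
    exact ⟨P, hP, rfl⟩
  · exact absurd (hS_arch w) hv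

end Below
end SIntegerRings

/-! ### Valuations of ideles -/

noncomputable section
section IdealOfIdele
open Polynomial IsDedekindDomain

variable {k : Type*} [Field k] {S : Finset (Place k)}

/-- The embedding `L^× → L_v^×`. -/
def localDiagonal (L : Type*) [CommRing L] [Algebra k L] (v : Place k) :
    Lˣ →* (LocalAlg L v)ˣ :=
  Units.map ((Algebra.TensorProduct.includeRight : L →ₐ[k] LocalAlg L v) : L →* LocalAlg L v)

theorem localDiagonal_mem_localUnits_iff {L : Type*} [CommRing L] [Algebra k L] [Module.Finite k L]
    {A : ValuationSubring k} {hA : A ≠ ⊤} {a : Lˣ} :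
    localDiagonal L (.finite A hA) a ∈ localUnits L (.finite A hA) ↔
      IsIntegral A (a : L) ∧ IsIntegral A ((a⁻¹ : Lˣ) : L) := by
  rw [localUnits, Submonoid.mem_units_iff, ← map_inv]
  exact and_congr one_tmul_mem_localOrder_iff one_tmul_mem_localOrder_iff

theorem localDiagonal_mem_localUnits_pi_iff {ι : Type*} [Finite ι] {K : ι → Type*}
    [∀ i, Field (K i)] [∀ i, Algebra k (K i)] [∀ i, FiniteDimensional k (K i)]
    {A : ValuationSubring k} {hA : A ≠ ⊤} {a : (∀ i, K i)ˣ} :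
    localDiagonal (∀ i, K i) (.finite A hA) a ∈ localUnits (∀ i, K i) (.finite A hA) ↔
      (∀ i, IsIntegral A ((a : ∀ i, K i) i)) ∧
        ∀ i, IsIntegral A (((a⁻¹ : (∀ i, K i)ˣ) : ∀ i, K i) i) :=
  localDiagonal_mem_localUnits_iff.trans
    (and_congr isIntegral_valuationSubring_pi_iff isIntegral_valuationSubring_pi_iff)

variable {ι : Type*} {K : ι → Type*} [∀ i, Field (K i)] [∀ i, Algebra k (K i)]
  [∀ i, IsDedekindDomain (sIntegers (K i) S)]
  [∀ i, IsFractionRing (sIntegers (K i) S) (K i)]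

/-- The valuation of `L^×` at a prime of `O_{Kᵢ,S}`. -/
def globalOrd {i : ι} (P : HeightOneSpectrum (sIntegers (K i) S)) :
    (∀ i, K i)ˣ →* Multiplicative ℤ :=
  (P.valuationOfNeZero (K := K i)).comp (Units.map (Pi.evalMonoidHom K i))

theorem globalOrd_eq_one_iff {i : ι} {P : HeightOneSpectrum (sIntegers (K i) S)}
    {a : (∀ i, K i)ˣ} : globalOrd P a = 1 ↔
      P.valuation (K i) ((a : ∀ i, K i) i) ≤ 1 ∧
        P.valuation (K i) (((a⁻¹ : (∀ i, K i)ˣ) : ∀ i, K i) i) ≤ 1 := by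
  let b : (K i)ˣ := Units.map (Pi.evalMonoidHom K i) a
  have h : P.valuation (K i) (((a⁻¹ : (∀ i, K i)ˣ) : ∀ i, K i) i) = (P.valuation (K i) b)⁻¹ := by
    rw [← map_inv₀, ← Units.val_inv_eq_inv_val, ← map_inv]
    rfl
  rw [h, inv_le_one₀ (zero_lt_iff.2 ((Valuation.ne_zero_iff _).2 b.ne_zero)), ← WithZero.coe_inj,
    WithZero.coe_one]
  have h1 : ((globalOrd P a : Multiplicative ℤ) : WithZero (Multiplicative ℤ)) =
    P.valuation (K i) b := HeightOneSpectrum.valuationOfNeZero_eq P b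
  rw [h1, le_antisymm_iff]
  rfl

variable (K S) in
/-- The family of exponents of an ideal of `L`, with the sign of the multiplicative valuation. -/
def idealOrd : SIdeals K S →*
    (∀ i, HeightOneSpectrum (sIntegers (K i) S) → Multiplicative ℤ) where
  toFun J i P := Multiplicative.ofAdd (-(FractionalIdeal.count (K i) P (J i : FractionalIdeal _ _)))
  map_one' := by
    ext i P
    simp [FractionalIdeal.count_one]
  map_mul' I J := by
    ext i P
    simp [FractionalIdeal.count_mul, add_comm]

/-- Unique factorization of ideals. -/
theorem idealOrd_injective : Function.Injective (idealOrd S K) := by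
  intro I J h
  refine funext fun i => Units.ext ?_
  rw [← FractionalIdeal.finprod_heightOneSpectrum_factorization' (K i) (I i).ne_zero,
    ← FractionalIdeal.finprod_heightOneSpectrum_factorization' (K i) (J i).ne_zero]
  refine finprod_congr fun P => ?_
  have h1 := congrArg Multiplicative.toAdd (congrFun (congrFun h i) P)
  rw [show FractionalIdeal.count (K i) P (I i) = FractionalIdeal.count (K i) P (J i) from
    neg_injective h1]

variable [Fintype ι] [∀ i, FiniteDimensional k (K i)]

theorem globalOrd_eq_one {i : ι} {P : HeightOneSpectrum (sIntegers (K i) S)} {a : (∀ i, K i)ˣ}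
    (ha : localDiagonal (∀ i, K i) (.finite (below P) (below_ne_top P)) a ∈
      localUnits (∀ i, K i) (.finite (below P) (below_ne_top P))) : globalOrd P a = 1 := by
  rw [localDiagonal_mem_localUnits_pi_iff] at ha
  exact globalOrd_eq_one_iff.2
    ⟨mem_of_isIntegral (ha.1 i) le_rfl, mem_of_isIntegral (ha.2 i) le_rfl⟩

/-- Elements of `L^×` that differ from a given element of `L_v^×` by local units have the same
valuation at `P`. -/
theorem globalOrd_eq {i : ι} {P : HeightOneSpectrum (sIntegers (K i) S)}
    {x : (LocalAlg (∀ i, K i) (.finite (below P) (below_ne_top P)))ˣ} {a b : (∀ i, K i)ˣ}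
    (ha : x * (localDiagonal (∀ i, K i) _ a)⁻¹ ∈ localUnits (∀ i, K i) _)
    (hb : x * (localDiagonal (∀ i, K i) _ b)⁻¹ ∈ localUnits (∀ i, K i) _) :
    globalOrd P a = globalOrd P b := by
  rw [← mul_inv_eq_one, ← map_inv, ← map_mul]
  refine globalOrd_eq_one ?_
  have := mul_mem (inv_mem ha) hb
  rw [mul_inv_rev, inv_inv, mul_assoc, inv_mul_cancel_left, ← map_inv, ← map_mul] at this
  exact this

/-- The valuation of `L_v^×` at a prime of `O_{Kᵢ,S}` above `v`. By local approximation an element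
of `L_v^×` is the product of an element of `L^×` and a unit of the maximal order, and its valuation
is defined as that of the element of `L^×`. By `globalOrd_eq` it does not depend on the choice. -/
def localOrd {i : ι} (P : HeightOneSpectrum (sIntegers (K i) S)) :
    (LocalAlg (∀ i, K i) (.finite (below P) (below_ne_top P)))ˣ →* Multiplicative ℤ where
  toFun x := globalOrd P (exists_mul_mem_localUnits x).choose
  map_one' := by
    rw [globalOrd_eq (exists_mul_mem_localUnits _).choose_spec (b := 1), map_one]
    rw [map_one, inv_one, one_mul]
    exact one_mem _
  map_mul' x y := by
    rw [← map_mul]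
    refine globalOrd_eq (exists_mul_mem_localUnits _).choose_spec ?_
    have := mul_mem (exists_mul_mem_localUnits x).choose_spec
      (exists_mul_mem_localUnits y).choose_spec
    rw [map_mul, mul_inv, mul_mul_mul_comm]
    exact this

theorem localOrd_eq {i : ι} {P : HeightOneSpectrum (sIntegers (K i) S)}
    {x : (LocalAlg (∀ i, K i) (.finite (below P) (below_ne_top P)))ˣ} {a : (∀ i, K i)ˣ}
    (ha : x * (localDiagonal (∀ i, K i) _ a)⁻¹ ∈ localUnits (∀ i, K i) _) :
    localOrd P x = globalOrd P a :=
  globalOrd_eq (exists_mul_mem_localUnits x).choose_spec ha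

variable (K S) in
/-- The family of valuations of an idele of `L` at the primes of the rings `O_{Kᵢ,S}`. -/
def ideleOrd : (∀ v : Place k, (LocalAlg (∀ i, K i) v)ˣ) →*
    (∀ i, HeightOneSpectrum (sIntegers (K i) S) → Multiplicative ℤ) :=
  MonoidHom.pi fun _ => MonoidHom.pi fun P =>
    (localOrd P).comp (Pi.evalMonoidHom _ (Place.finite (below P) (below_ne_top P)))

theorem ideleOrd_diagonal (a : (∀ i, K i)ˣ) (i : ι) (P : HeightOneSpectrum (sIntegers (K i) S)) :
    ideleOrd S K (diagonal _ a) i P = globalOrd P a := by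
  refine localOrd_eq ?_
  have h : diagonal (∀ i, K i) a (.finite (below P) (below_ne_top P)) *
      (localDiagonal (∀ i, K i) (.finite (below P) (below_ne_top P)) a)⁻¹ = 1 := mul_inv_cancel _
  exact h.symm.subst (motive := fun z => z ∈ localUnits _ _) (one_mem _)

variable (hk : IsGlobalField k)
  (hS_arch : ∀ w : NumberField.InfinitePlace k, Place.infinite w ∈ S) {t : k} (ht : PolesEq t S)

include hk hS_arch ht

/-- An element of `L^×` whose valuations above a place outside `S` are trivial is a local unit
there. -/
theorem localDiagonal_mem_localUnits_of_globalOrd {A : ValuationSubring k} {hA : A ≠ ⊤}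
    (hAS : Place.finite A hA ∉ S) {a : (∀ i, K i)ˣ}
    (h : ∀ i (P : HeightOneSpectrum (sIntegers (K i) S)), below P = A → globalOrd P a = 1) :
    localDiagonal (∀ i, K i) (.finite A hA) a ∈ localUnits (∀ i, K i) (.finite A hA) := by
  rw [localDiagonal_mem_localUnits_pi_iff]
  constructor <;> intro i <;> rw [isIntegral_iff_forall_below hk hS_arch ht hAS] <;> intro P hP
  · exact (globalOrd_eq_one_iff.1 (h i P hP)).1
  · exact (globalOrd_eq_one_iff.1 (h i P hP)).2

/-- The ideles whose ideal is trivial are those in `U_{L,S}`. -/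
theorem ideleOrd_ker : (ideleOrd S K).ker = sUnitIdeles (∀ i, K i) S := by
  ext x
  rw [MonoidHom.mem_ker, sUnitIdeles, Subgroup.mem_pi]
  constructor
  · rintro hx (⟨A, hA⟩ | w) hv
    · obtain ⟨a, ha⟩ := exists_mul_mem_localUnits (x (.finite A hA))
      have h1 : localDiagonal (∀ i, K i) (.finite A hA) a ∈
          localUnits (∀ i, K i) (.finite A hA) := by
        refine localDiagonal_mem_localUnits_of_globalOrd hk hS_arch ht hv ?_
        rintro i P rfl
        rw [← localOrd_eq ha]
        exact congrFun (congrFun hx i) P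
      have := mul_mem ha h1
      rwa [localDiagonal, inv_mul_cancel_right] at this
    · exact absurd (hS_arch w) hv
  · intro hx
    ext i P
    have h : localOrd P (x (.finite (below P) (below_ne_top P))) = globalOrd P 1 :=
      localOrd_eq (by
        rw [map_one, inv_one, mul_one]
        exact hx _ (below_notMem hS_arch ht P))
    rw [map_one] at h
    exact congrArg Multiplicative.toAdd h

theorem diagonal_mem_ideles (a : (∀ i, K i)ˣ) : diagonal _ a ∈ ideles (k := k) (∀ i, K i) := by
  have h1 := Set.finite_iUnion fun i => finite_setOf_not_isIntegral hk hS_arch ht ((a : ∀ i, K i) i)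
  have h2 := Set.finite_iUnion fun i =>
    finite_setOf_not_isIntegral hk hS_arch ht (((a⁻¹ : (∀ i, K i)ˣ) : ∀ i, K i) i)
  refine ((S.finite_toSet.union h1).union h2).subset fun v hv => ?_
  by_contra hcon
  simp only [Set.mem_union, Set.mem_iUnion, not_or, not_exists, Finset.mem_coe] at hcon
  obtain ⟨⟨hvS, ha⟩, hb⟩ := hcon
  obtain ⟨A, hA⟩ | w := v
  · refine hv (localDiagonal_mem_localUnits_pi_iff.2 ⟨fun i => ?_, fun i => ?_⟩)
    · by_contra hcon
      refine ha i ⟨hvS, ?_⟩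
      rintro A' hA' h
      cases h
      exact hcon
    · by_contra hcon
      refine hb i ⟨hvS, ?_⟩
      rintro A' hA' h
      cases h
      exact hcon
  · exact hvS (hS_arch w)

end IdealOfIdele
end

/-! ### Norms of ideals and ideles -/

section NormPi

/-- The norm of a finite product of algebras is the product of the norms. -/
theorem norm_pi.{u, v} {k : Type*} [Field k] {ι : Type u} [Fintype ι] (K : ι → Type v)
    [∀ i, CommRing (K i)] [∀ i, Algebra k (K i)] [∀ i, Module.Finite k (K i)] (a : ∀ i, K i) :
    Algebra.norm k a = ∏ i, Algebra.norm k (a i) := by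
  refine Fintype.induction_empty_option (P := fun ι _ => ∀ (K : ι → Type v)
    [∀ i, CommRing (K i)] [∀ i, Algebra k (K i)] [∀ i, Module.Finite k (K i)] (a : ∀ i, K i),
    Algebra.norm k a = ∏ i, Algebra.norm k (a i)) ?_ ?_ ?_ ι K a
  · intro α β _ e h K _ _ _ a
    let _ := Fintype.ofEquiv β e.symm
    let E := LinearEquiv.piCongrLeft k K e
    have h1 := h (fun i => K (e i)) (fun i => a (e i))
    have h2 : Algebra.lmul k _ a = E.toLinearMap ∘ₗ Algebra.lmul k _ (fun i => a (e i)) ∘ₗ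
        E.symm.toLinearMap := by
      refine LinearMap.ext fun x => ?_
      obtain ⟨y, rfl⟩ := E.surjective x
      refine funext fun i => ?_
      obtain ⟨j, rfl⟩ := e.surjective i
      have hE : ∀ (z : ∀ i, K (e i)), E z (e j) = z j := fun z =>
        Equiv.piCongrLeft_apply_apply K e z j
      simp [hE]
    rw [Algebra.norm_apply, h2, LinearMap.det_conj, ← Algebra.norm_apply, h1]
    exact e.prod_comp fun i => Algebra.norm k (a i)
  · intro K _ _ _ a
    rw [Algebra.norm_apply, LinearMap.det_eq_one_of_subsingleton]
    simp
  · intro α _ h K _ _ _ a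
    let E : (∀ i, K i) ≃ₗ[k] K none × ∀ i, K (some i) := LinearEquiv.piOptionEquivProd k
    have h1 := h (fun i => K (some i)) (fun i => a (some i))
    have h2 : Algebra.lmul k _ a = E.symm.toLinearMap ∘ₗ
        ((Algebra.lmul k _ (a none)).prodMap (Algebra.lmul k _ (fun i => a (some i)))) ∘ₗ
        E.symm.symm.toLinearMap := by
      refine LinearMap.ext fun x => E.injective ?_
      simp [E]
      rfl
    rw [Algebra.norm_apply, h2, LinearMap.det_conj, LinearMap.det_prodMap, ← Algebra.norm_apply,
      ← Algebra.norm_apply, h1, Fintype.prod_option]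

variable {k : Type*} [Field k] {S : Finset (Place k)} {ι : Type*} [Fintype ι] {K : ι → Type*}
  [∀ i, Field (K i)] [∀ i, Algebra k (K i)] [∀ i, FiniteDimensional k (K i)]

theorem norm_mem_idealNorm {J : SIdeals K S} {a : ∀ i, K i}
    (ha : ∀ i, a i ∈ (J i : FractionalIdeal (sIntegers (K i) S)⁰ (K i))) :
    Algebra.norm k a ∈ idealNorm J := by
  classical
  rw [norm_pi, idealNorm, Submodule.prod_span]
  refine Submodule.subset_span ?_
  rw [Set.mem_fintype_prod]
  exact ⟨fun i => Algebra.norm k (a i), fun i => ⟨a i, ha i, rfl⟩, rfl⟩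

/-- The norm of an ideal `J` of `L` is spanned by the norms of the elements of `L` that lie in `J`.
-/
theorem idealNorm_eq_span (J : SIdeals K S) : idealNorm J = Submodule.span (baseSIntegers S)
    {z | ∃ y : ∀ i, K i, (∀ i, y i ∈ (J i : FractionalIdeal (sIntegers (K i) S)⁰ (K i))) ∧
      Algebra.norm k y = z} := by
  classical
  rw [idealNorm, Submodule.prod_span]
  congr 1
  ext z
  rw [Set.mem_fintype_prod]
  constructor
  · rintro ⟨g, hg, rfl⟩
    choose y hy hyg using fun i => hg i
    exact ⟨y, hy, by rw [norm_pi]; exact Finset.prod_congr rfl fun i _ => hyg i⟩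
  · rintro ⟨y, hy, rfl⟩
    exact ⟨fun i => Algebra.norm k (y i), fun i => ⟨y i, hy i, rfl⟩, (norm_pi _ _).symm⟩

end NormPi

section IdealsOfIdeles
open IsDedekindDomain

variable {k : Type*} [Field k] {S : Finset (Place k)}
  {ι : Type*} {K : ι → Type*} [∀ i, Field (K i)] [∀ i, Algebra k (K i)]
  [∀ i, IsDedekindDomain (sIntegers (K i) S)] [∀ i, IsFractionRing (sIntegers (K i) S) (K i)]

theorem globalOrd_coe {i : ι} (P : HeightOneSpectrum (sIntegers (K i) S)) (a : (∀ i, K i)ˣ) :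
    ((globalOrd P a : Multiplicative ℤ) : WithZero (Multiplicative ℤ)) =
      P.valuation (K i) ((a : ∀ i, K i) i) :=
  HeightOneSpectrum.valuationOfNeZero_eq P (Units.map (Pi.evalMonoidHom K i) a)

theorem idealOrd_coe (J : SIdeals K S) {i : ι} (P : HeightOneSpectrum (sIntegers (K i) S)) :
    ((idealOrd S K J i P : Multiplicative ℤ) : WithZero (Multiplicative ℤ)) =
      WithZero.exp (-(FractionalIdeal.count (K i) P (J i : FractionalIdeal _ _))) := rfl

variable (S) in
/-- The principal ideal of `L` generated by an element of `L^×`. -/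
noncomputable def principalIdeal : (∀ i, K i)ˣ →* SIdeals K S :=
  MonoidHom.pi fun i => (toPrincipalIdeal (sIntegers (K i) S) (K i)).comp
    (Units.map (Pi.evalMonoidHom K i))

theorem idealOrd_principalIdeal (a : (∀ i, K i)ˣ) {i : ι}
    (P : HeightOneSpectrum (sIntegers (K i) S)) :
    idealOrd S K (principalIdeal S a) i P = globalOrd P a := by
  have ha : (a : ∀ i, K i) i ≠ 0 := (Units.map (Pi.evalMonoidHom K i) a).ne_zero
  rw [← WithZero.coe_inj, globalOrd_coe, idealOrd_coe, count_spanSingleton P ha]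
  congr 3
  exact coe_toPrincipalIdeal _

/-- The principal ideals with generators in `∏ᵢ Hᵢ`, as the image of the latter group. -/
theorem mem_principalIdealsOf {H : ∀ i, Subgroup (K i)ˣ} {J : SIdeals K S} :
    J ∈ principalIdealsOf K S H ↔
      ∃ a : (∀ i, K i)ˣ, (∀ i, Units.map (Pi.evalMonoidHom K i) a ∈ H i) ∧
        principalIdeal S a = J := by
  constructor
  · intro h
    choose a ha hJ using h
    refine ⟨MulEquiv.piUnits.symm a, fun i => ?_, funext fun i => Units.ext ?_⟩
    · convert ha i
      ext; rfl
    · refine FractionalIdeal.coeToSubmodule_injective ?_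
      refine Eq.trans ?_ (hJ i).symm
      refine Eq.trans (congrArg _ (coe_toPrincipalIdeal _)) ?_
      rw [FractionalIdeal.coe_spanSingleton]
      rfl
  · rintro ⟨a, ha, rfl⟩ i
    refine ⟨_, ha i, ?_⟩
    refine Eq.trans (congrArg _ (coe_toPrincipalIdeal _)) ?_
    rw [FractionalIdeal.coe_spanSingleton]

/-- An ideal of `L` is locally generated by a single element that it contains. -/
theorem exists_mem_globalOrd_eq (J : SIdeals K S) {A : ValuationSubring k} (hA : A ≠ ⊤) :
    ∃ a : (∀ i, K i)ˣ,
      (∀ i, (a : ∀ i, K i) i ∈ (J i : FractionalIdeal (sIntegers (K i) S)⁰ (K i))) ∧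
      ∀ i (P : HeightOneSpectrum (sIntegers (K i) S)), below P = A →
        globalOrd P a = idealOrd S K J i P := by
  choose a ha ha0 h using fun i => exists_mem_valuation_eq (J i).ne_zero
    (finite_setOf_below_eq (S := S) (K := K i) hA).toFinset
  refine ⟨MulEquiv.piUnits.symm fun i => Units.mk0 (a i) (ha0 i), ha, fun i P hP => ?_⟩
  rw [← WithZero.coe_inj, globalOrd_coe, idealOrd_coe]
  exact h i P ((Set.Finite.mem_toFinset _).2 hP)

variable [Fintype ι] [∀ i, FiniteDimensional k (K i)]

theorem ideleOrd_diagonal_eq (a : (∀ i, K i)ˣ) :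
    ideleOrd S K (diagonal _ a) = idealOrd S K (principalIdeal S a) := by
  ext i P
  rw [ideleOrd_diagonal, idealOrd_principalIdeal]

theorem ideleNorm_apply {L : Type*} [CommRing L] [Algebra k L]
    (x : ∀ v : Place k, (LocalAlg L v)ˣ) (v : Place k) :
    ideleNorm L x v = localNorm L v (x v) := rfl

theorem localNorm_localDiagonal {L : Type*} [CommRing L] [Algebra k L] [Module.Finite k L]
    (v : Place k) (a : Lˣ) : localNorm L v (localDiagonal L v a) =
      Units.map (algebraMap k v.Completion : k →* v.Completion) (globalNorm L a) :=
  Units.ext (norm_one_tmul _)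

theorem localNorm_mem {L : Type*} [CommRing L] [Algebra k L] [Module.Finite k L]
    {v : Place k} {x : (LocalAlg L v)ˣ} (hx : x ∈ localUnits L v) :
    localNorm L v x ∈ v.integers.toSubmonoid.units := by
  rw [localUnits, Submonoid.mem_units_iff] at hx
  rw [Submonoid.mem_units_iff, ← map_inv]
  exact ⟨norm_mem_integers v hx.1, norm_mem_integers v hx.2⟩

variable (hk : IsGlobalField k)
  (hS_arch : ∀ w : NumberField.InfinitePlace k, Place.infinite w ∈ S) {t : k} (ht : PolesEq t S)

include hk hS_arch ht

/-- At a place outside `S`, the norm of an ideal of `L` is generated by the norm of a local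
generator. -/
theorem norm_inv_mul_mem {J : SIdeals K S} {A : ValuationSubring k} {hA : A ≠ ⊤}
    (hAS : Place.finite A hA ∉ S) {a : (∀ i, K i)ˣ}
    (ha : ∀ i (P : HeightOneSpectrum (sIntegers (K i) S)), below P = A →
      globalOrd P a = idealOrd S K J i P) {z : k} (hz : z ∈ idealNorm J) :
    (Algebra.norm k (a : ∀ i, K i))⁻¹ * z ∈ A := by
  rw [idealNorm_eq_span] at hz
  induction hz using Submodule.span_induction with
  | mem z hz =>
    obtain ⟨y, hy, rfl⟩ := hz
    -- If `y` lies in `J` then `a⁻¹ y` is integral at `A`, and so is its norm.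
    have h1 : (Algebra.norm k (a : ∀ i, K i))⁻¹ =
        Algebra.norm k ((a⁻¹ : (∀ i, K i)ˣ) : ∀ i, K i) := by
      rw [inv_eq_iff_eq_inv]
      refine eq_inv_of_mul_eq_one_left ?_
      rw [← map_mul, Units.mul_inv, map_one]
    rw [h1, ← map_mul]
    have h2 : IsIntegral A (((a⁻¹ : (∀ i, K i)ˣ) : ∀ i, K i) * y) := by
      refine isIntegral_valuationSubring_pi_iff.2 fun i => ?_
      rw [isIntegral_iff_forall_below hk hS_arch ht hAS]
      intro P hP
      have h3 := valuation_le_of_mem P (hy i)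
      rw [← idealOrd_coe, ← ha i P hP, globalOrd_coe] at h3
      have h4 : ((a⁻¹ : (∀ i, K i)ˣ) : ∀ i, K i) i * (a : ∀ i, K i) i = 1 :=
        congrFun a.inv_mul i
      have h5 := congrArg (P.valuation (K i)) h4
      rw [map_mul, map_one] at h5
      rw [Pi.mul_apply, map_mul, ← h5]
      gcongr
    exact IsIntegrallyClosed.isIntegral_iff.1 (isIntegral_norm_of_finite (F := k) h2) |>.elim
      fun b hb => hb ▸ b.2
  | zero => simp [zero_mem]
  | add x y _ _ hx hy => rw [mul_add]; exact add_mem hx hy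
  | smul d x _ hx =>
    have hd : (d : k) ∈ A := (mem_baseSIntegers hS_arch).1 d.2 A hA hAS
    have h1 : d • x = (d : k) * x := rfl
    rw [h1, mul_left_comm]
    exact mul_mem hd hx

/-- An element of `L^×` with the same valuations as an idele above `v` generates it at `v`. -/
theorem mul_inv_mem_localUnits {x : ∀ v : Place k, (LocalAlg (∀ i, K i) v)ˣ}
    {A : ValuationSubring k} {hA : A ≠ ⊤} (hAS : Place.finite A hA ∉ S) {a : (∀ i, K i)ˣ}
    (ha : ∀ i (P : HeightOneSpectrum (sIntegers (K i) S)), below P = A →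
      globalOrd P a = ideleOrd S K x i P) :
    x (.finite A hA) * (localDiagonal (∀ i, K i) (.finite A hA) a)⁻¹ ∈
      localUnits (∀ i, K i) (.finite A hA) := by
  obtain ⟨b, hb⟩ := exists_mul_mem_localUnits (x (.finite A hA))
  have h1 : localDiagonal (∀ i, K i) (.finite A hA) (b * a⁻¹) ∈
      localUnits (∀ i, K i) (.finite A hA) := by
    refine localDiagonal_mem_localUnits_of_globalOrd hk hS_arch ht hAS ?_
    rintro i P rfl
    rw [map_mul, map_inv, mul_inv_eq_one, ha i P rfl]
    exact (localOrd_eq hb).symm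
  have := mul_mem hb h1
  rw [map_mul, map_inv, ← mul_assoc] at this
  convert this using 2
  exact (inv_mul_cancel_right _ _).symm

/-- The norm of an idele is a unit at `v` iff the norm of a local generator of the corresponding
ideal is. -/
theorem ideleNorm_mem_iff {x : ∀ v : Place k, (LocalAlg (∀ i, K i) v)ˣ}
    {A : ValuationSubring k} {hA : A ≠ ⊤} (hAS : Place.finite A hA ∉ S) {a : (∀ i, K i)ˣ}
    (ha : ∀ i (P : HeightOneSpectrum (sIntegers (K i) S)), below P = A →
      globalOrd P a = ideleOrd S K x i P) :
    ideleNorm (∀ i, K i) x (.finite A hA) ∈ (Place.finite A hA).integers.toSubmonoid.units ↔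
      Algebra.norm k (a : ∀ i, K i) ∈ A ∧ (Algebra.norm k (a : ∀ i, K i))⁻¹ ∈ A := by
  have h1 := localNorm_mem (mul_inv_mem_localUnits hk hS_arch ht hAS ha)
  rw [map_mul, map_inv] at h1
  rw [ideleNorm_apply]
  have h2 : localNorm (∀ i, K i) (.finite A hA) (x (.finite A hA)) ∈
      (Place.finite A hA).integers.toSubmonoid.units ↔
      localNorm (∀ i, K i) (.finite A hA) (localDiagonal _ _ a) ∈
        (Place.finite A hA).integers.toSubmonoid.units := by
    constructor
    · intro h
      have := mul_mem (inv_mem h1) h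
      rwa [mul_inv_rev, inv_inv, inv_mul_cancel_right] at this
    · intro h
      have := mul_mem h1 h
      rwa [inv_mul_cancel_right] at this
  rw [h2, localNorm_localDiagonal, Submonoid.mem_units_iff, ← map_inv]
  refine and_congr algebraMap_mem_integers_iff ?_
  rw [← show ((globalNorm (k := k) (∀ i, K i) a)⁻¹ : kˣ) = (Algebra.norm k (a : ∀ i, K i))⁻¹ from
    Units.val_inv_eq_inv_val _]
  exact algebraMap_mem_integers_iff

variable [IsDedekindDomain (baseSIntegers S)] [IsFractionRing (baseSIntegers S) k]

/-- If the norm of an idele is a unit outside `S`, then its ideal has norm one. -/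
theorem idealNorm_eq_one_of_ideleNorm_mem {x : ∀ v : Place k, (LocalAlg (∀ i, K i) v)ˣ}
    {J : SIdeals K S} (hxJ : ideleOrd S K x = idealOrd S K J)
    (hx : ideleNorm (∀ i, K i) x ∈ baseSUnitIdeles S) : idealNorm J = 1 := by
  rw [baseSUnitIdeles, Subgroup.mem_pi] at hx
  have hle : ∀ z ∈ idealNorm J, z ∈ baseSIntegers S := by
    intro z hz
    rw [mem_baseSIntegers hS_arch]
    intro A hA hAS
    obtain ⟨a, -, ha⟩ := exists_mem_globalOrd_eq J hA
    have h1 := norm_inv_mul_mem hk hS_arch ht hAS ha hz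
    have h2 := (ideleNorm_mem_iff hk hS_arch ht hAS (by rwa [hxJ])).1 (hx _ hAS)
    have h3 := mul_mem h2.1 h1
    have ha0 : Algebra.norm k (a : ∀ i, K i) ≠ 0 := (globalNorm (k := k) (∀ i, K i) a).ne_zero
    rwa [mul_inv_cancel_left₀ ha0] at h3
  let I : Ideal (baseSIntegers S) := (idealNorm J).comap (Algebra.linearMap (baseSIntegers S) k)
  have hI : I = ⊤ := by
    by_contra hI
    -- The norm of `J` is an integral ideal. If it were proper, it would be contained in some prime
    -- `P` of `O_{k,S}`. But it contains the norm of a local generator of `J` at `P`, which is a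
    -- unit at `P`.
    obtain ⟨M, hM, hIM⟩ := Ideal.exists_le_maximal I hI
    have hM0 : M ≠ ⊥ := by
      rintro rfl
      choose y hy hy0 using fun i => Submodule.exists_mem_ne_zero_of_ne_bot
        (show ((J i : FractionalIdeal (sIntegers (K i) S)⁰ (K i)) :
          Submodule (sIntegers (K i) S) (K i)) ≠ ⊥ from
          FractionalIdeal.coeToSubmodule_ne_bot.2 (J i).ne_zero)
      have h1 := norm_mem_idealNorm (J := J) hy
      have h2 : (⟨_, hle _ h1⟩ : baseSIntegers S) ∈ I := h1
      have h3 : Algebra.norm k y = 0 := congrArg Subtype.val ((Ideal.mem_bot).1 (hIM h2))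
      rw [norm_pi, Finset.prod_eq_zero_iff] at h3
      obtain ⟨i, -, hi⟩ := h3
      exact hy0 i (Algebra.norm_eq_zero_iff.1 hi)
    let P : HeightOneSpectrum (baseSIntegers S) := ⟨M, hM.isPrime, hM0⟩
    have hA := valuationSubring_ne_top (K := k) P
    have hAS : Place.finite _ hA ∉ S := by
      intro h
      refine (ht _ _).2 h ?_
      have h1 : t ∈ baseSIntegers S := by
        rw [baseSIntegers_eq_poleRing ht hS_arch]
        exact self_mem_poleRing _
      exact P.valuation_le_one (K := k) ⟨t, h1⟩
    obtain ⟨a, haJ, ha⟩ := exists_mem_globalOrd_eq J hA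
    have h1 := norm_mem_idealNorm haJ
    have h2 := (ideleNorm_mem_iff hk hS_arch ht hAS (by rwa [hxJ])).1 (hx _ hAS)
    have h3 : (⟨_, hle _ h1⟩ : baseSIntegers S) ∈ P.asIdeal := hIM h1
    have h4 := (P.valuation_lt_one_iff_mem (K := k) _).2 h3
    have h5 : P.valuation k (Algebra.norm k (a : ∀ i, K i))⁻¹ ≤ 1 := h2.2
    have ha0 : Algebra.norm k (a : ∀ i, K i) ≠ 0 := (globalNorm (k := k) (∀ i, K i) a).ne_zero
    rw [map_inv₀, inv_le_one₀ (zero_lt_iff.2 ((Valuation.ne_zero_iff _).2 ha0))] at h5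
    exact absurd h4 (not_lt.2 h5)
  refine le_antisymm (fun z (hz : z ∈ idealNorm J) =>
    Submodule.mem_one.2 ⟨(⟨z, hle z hz⟩ : baseSIntegers S), rfl⟩) ?_
  rw [Submodule.one_eq_span, Submodule.span_le, Set.singleton_subset_iff]
  exact (Ideal.eq_top_iff_one I).1 hI

/-- The ideal of an idele has norm one iff the norm of the idele is a unit outside `S`. -/
theorem mem_normOneIdeals_iff {x : ∀ v : Place k, (LocalAlg (∀ i, K i) v)ˣ}
    {J : SIdeals K S} (hxJ : ideleOrd S K x = idealOrd S K J) :
    J ∈ normOneIdeals K S ↔ ideleNorm (∀ i, K i) x ∈ baseSUnitIdeles S := by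
  constructor
  · rintro ⟨h, -⟩
    rw [baseSUnitIdeles, Subgroup.mem_pi]
    rintro (⟨A, hA⟩ | w) hAS
    · obtain ⟨a, haJ, ha⟩ := exists_mem_globalOrd_eq J hA
      rw [ideleNorm_mem_iff hk hS_arch ht hAS (a := a) (by rwa [hxJ])]
      constructor
      · have h1 := norm_mem_idealNorm haJ
        rw [h, Submodule.mem_one] at h1
        obtain ⟨d, hd⟩ := h1
        rw [← hd]
        exact (mem_baseSIntegers hS_arch).1 d.2 A hA hAS
      · have h1 : (1 : k) ∈ idealNorm J := by
          rw [h]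
          exact Submodule.one_le.1 le_rfl
        have := norm_inv_mul_mem hk hS_arch ht hAS ha h1
        rwa [mul_one] at this
    · exact absurd (hS_arch w) hAS
  · intro h
    refine ⟨idealNorm_eq_one_of_ideleNorm_mem hk hS_arch ht hxJ h,
      idealNorm_eq_one_of_ideleNorm_mem hk hS_arch ht (x := x⁻¹) ?_ ?_⟩
    · rw [map_inv, map_inv, hxJ]
    · rw [map_inv]
      exact inv_mem h

end IdealsOfIdeles

/-! ### The index formula for ideles -/

section GroupLevel
open IsDedekindDomain

variable {k : Type*} [Field k] {S : Finset (Place k)}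

/-- The diagonal embedding of `k^×`. -/
noncomputable def baseDiagonal (k : Type*) [Field k] : kˣ →* (∀ v : Place k, (v.Completion)ˣ) :=
  MonoidHom.pi fun v => Units.map (algebraMap k v.Completion : k →* v.Completion)

theorem baseDiagonal_injective (hS : S.Nonempty) : Function.Injective (baseDiagonal k) := by
  obtain ⟨v, -⟩ := hS
  intro x y h
  exact Units.ext ((algebraMap k v.Completion).injective (congrArg Units.val (congrFun h v)))

theorem baseDiagonal_mem_iff {x : kˣ} :
    baseDiagonal k x ∈ baseSUnitIdeles S ↔ x ∈ baseSUnits S := by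
  rw [baseSUnitIdeles, Subgroup.mem_pi, baseSUnits, Submonoid.mem_units_iff]
  simp only [baseSIntegers, Subring.mem_toSubmonoid, Subring.mem_iInf, Subtype.forall,
    Subring.mem_comap]
  rw [← forall₂_and]
  refine forall₂_congr fun v hv => ?_
  rw [Submonoid.mem_units_iff]
  rfl

theorem diagonal_mem_iff {L : Type*} [CommRing L] [Algebra k L] {x : Lˣ} :
    diagonal L x ∈ sUnitIdeles L S ↔ x ∈ sUnits (k := k) L S := by
  rw [sUnitIdeles, Subgroup.mem_pi, sUnits, Submonoid.mem_units_iff]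
  simp only [sIntegers, Subring.mem_toSubmonoid, Subring.mem_iInf, Subtype.forall,
    Subring.mem_comap]
  rw [← forall₂_and]
  refine forall₂_congr fun v hv => ?_
  rw [localUnits, Submonoid.mem_units_iff]
  rfl

theorem ideleNorm_diagonal {L : Type*} [CommRing L] [Algebra k L] [Module.Finite k L] (x : Lˣ) :
    ideleNorm L (diagonal L x) = baseDiagonal k (globalNorm L x) :=
  funext fun v => localNorm_localDiagonal v x

theorem sUnitIdeles_le_ideles {L : Type*} [CommRing L] [Algebra k L] :
    sUnitIdeles L S ≤ ideles L := by
  intro x hx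
  rw [sUnitIdeles, Subgroup.mem_pi] at hx
  exact S.finite_toSet.subset fun v hv => by_contra fun h => hv (hx v h)

section SUnits
variable (hk : IsGlobalField k)
  (hS_arch : ∀ w : NumberField.InfinitePlace k, Place.infinite w ∈ S)
include hk hS_arch

/-- The group of `S`-units of a global field is finitely generated. -/
theorem baseSUnits_fg : (baseSUnits S).FG := by
  obtain ⟨F, hFtop, hF⟩ := exists_finset_finite_mem S
  choose ν hν using fun A : F => exists_valuation hk (hFtop A A.2)
  have hmem : ∀ {x : kˣ}, x ∈ baseSUnits S ↔ ∀ (A : ValuationSubring k) (hA : A ≠ ⊤),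
      Place.finite A hA ∉ S → (x : k) ∈ A ∧ ((x⁻¹ : kˣ) : k) ∈ A := by
    intro x
    rw [baseSUnits, Submonoid.mem_units_iff]
    simp only [Subring.mem_toSubmonoid, mem_baseSIntegers hS_arch, ← forall_and]
  -- The valuations at the places in `S` embed the `S`-units, modulo the elements that are units at
  -- every finite place, into a free abelian group of finite rank.
  let f : baseSUnits S →* (F → Multiplicative ℤ) :=
    MonoidHom.pi fun A => (ν A).comp (baseSUnits S).subtype
  have hker : f.ker = (everywhereUnits k).subgroupOf (baseSUnits S) := by
    ext x
    rw [Subgroup.mem_subgroupOf, mem_everywhereUnits, MonoidHom.mem_ker]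
    constructor
    · intro h A
      by_cases hA : A = ⊤
      · rw [hA]; exact ⟨trivial, trivial⟩
      by_cases hAF : A ∈ F
      · exact (hν ⟨A, hAF⟩ x).1 (congrFun h ⟨A, hAF⟩)
      · exact hmem.1 x.2 A hA fun h => hAF ((hF A hA).2 h)
    · intro h
      exact funext fun A => (hν A x).2 (h A)
  have hle : everywhereUnits k ≤ baseSUnits S := fun x hx =>
    hmem.2 fun A _ _ => mem_everywhereUnits.1 hx A
  have h1 : Group.FG (everywhereUnits k) := (Group.fg_iff_subgroup_fg _).2 (everywhereUnits_fg hk)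
  refine (Group.fg_iff_subgroup_fg _).1 (fg_of_fg_ker f ?_)
  rw [hker, ← Group.fg_iff_subgroup_fg]
  exact Group.fg_of_surjective (f := (Subgroup.subgroupOfEquivOfLe hle).symm.toMonoidHom)
    (Subgroup.subgroupOfEquivOfLe hle).symm.surjective

/-- Norms of `S`-units in a subgroup containing all squares have finite index in the `S`-units that
are norms. -/
theorem relIndex_map_globalNorm_ne_zero {L : Type*} [CommRing L] [Algebra k L] [Module.Finite k L]
    {H : Subgroup Lˣ} (hH : ∀ x, x ^ 2 ∈ H) :
    ((sUnits (k := k) L S ⊓ H).map (globalNorm L)).relIndex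
      (baseSUnits S ⊓ H.map (globalNorm L)) ≠ 0 := by
  rcases subsingleton_or_nontrivial L with hL | hL
  · have : H.map (globalNorm (k := k) L) = ⊥ := by
      rw [eq_bot_iff]
      rintro _ ⟨x, -, rfl⟩
      rw [Subsingleton.elim x 1, map_one]
      exact one_mem _
    rw [this, inf_bot_eq, Subgroup.relIndex_bot_right]
    exact one_ne_zero
  -- If `x` is an `S`-unit of `k` and `n` the degree of `L`, then `x ^ 2`, as an element of `L`,
  -- lies in `H` and has norm `x ^ (2 n)`.
  have hn : 2 * Module.finrank k L ≠ 0 := mul_ne_zero two_ne_zero Module.finrank_pos.ne'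
  have h1 : ((sUnits (k := k) L S ⊓ H).map (globalNorm L)).relIndex (baseSUnits S) ≠ 0 := by
    refine relIndex_ne_zero_of_pow_mem (baseSUnits_fg hk hS_arch) hn fun x hx => ?_
    let y : Lˣ := Units.map (algebraMap k L : k →* L) x
    refine ⟨y ^ 2, ⟨pow_mem ?_ 2, hH y⟩, ?_⟩
    · have hy : ∀ z ∈ baseSIntegers S, algebraMap k L z ∈ sIntegers L S := by
        intro z hz
        rw [mem_sIntegers hS_arch]
        intro A hA hAS
        exact isIntegral_algebraMap (x := (⟨z, (mem_baseSIntegers hS_arch).1 hz A hA hAS⟩ : A))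
      exact ⟨hy _ hx.1, hy _ hx.2⟩
    · rw [map_pow, mul_comm, pow_mul]
      congr 1
      exact Units.ext (Algebra.norm_algebraMap _)
  exact fun h => h1 (Subgroup.relIndex_eq_zero_of_le_right inf_le_left h)

end SUnits
section Product
variable {ι : Type*} {K : ι → Type*} [∀ i, Field (K i)] [∀ i, Algebra k (K i)]
  [∀ i, IsDedekindDomain (sIntegers (K i) S)] [∀ i, IsFractionRing (sIntegers (K i) S) (K i)]

/-- The principal ideals with generators in `H` and the principal ideles of elements of `H` have the
same valuations. -/
theorem map_principalIdealsOf [Fintype ι] [∀ i, FiniteDimensional k (K i)]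
    {H : Subgroup (∀ i, K i)ˣ} {H' : ∀ i, Subgroup (K i)ˣ}
    (hH : ∀ a, a ∈ H ↔ ∀ i, Units.map (Pi.evalMonoidHom K i) a ∈ H' i) :
    (principalIdealsOf K S H').map (idealOrd S K) = (H.map (diagonal _)).map (ideleOrd S K) := by
  ext z
  constructor
  · rintro ⟨J, hJ, rfl⟩
    obtain ⟨a, ha, rfl⟩ := mem_principalIdealsOf.1 hJ
    exact ⟨_, ⟨a, (hH a).2 ha, rfl⟩, ideleOrd_diagonal_eq a⟩
  · rintro ⟨_, ⟨a, ha, rfl⟩, rfl⟩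
    exact ⟨_, mem_principalIdealsOf.2 ⟨a, (hH a).1 ha, rfl⟩, (ideleOrd_diagonal_eq a).symm⟩

/-- The principal ideals have finite index in the ideals of `L`. -/
theorem principalIdeals_index_ne_zero [Finite ι] [∀ i, Finite (ClassGroup (sIntegers (K i) S))] :
    (principalIdeals K S).index ≠ 0 := by
  let f : SIdeals K S →* ∀ i, ClassGroup (sIntegers (K i) S) :=
    MonoidHom.pi fun i => (ClassGroup.mk (R := sIntegers (K i) S) (K := K i)).comp
      (Pi.evalMonoidHom _ i)
  have h : f.ker ≤ principalIdeals K S := by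
    intro J hJ i
    obtain ⟨a, ha⟩ := (ClassGroup.mk_eq_one_iff.1 (congrFun hJ i)).principal
    have ha : ((J i : FractionalIdeal (sIntegers (K i) S)⁰ (K i)) :
        Submodule (sIntegers (K i) S) (K i)) = Submodule.span _ {a} := ha
    have ha0 : a ≠ 0 := by
      rintro rfl
      rw [Submodule.span_zero_singleton] at ha
      exact FractionalIdeal.coeToSubmodule_ne_bot.2 (J i).ne_zero ha
    exact ⟨Units.mk0 a ha0, trivial, ha⟩
  have h3 : f.ker.index ≠ 0 := by
    rw [Subgroup.index_ker]
    exact Nat.card_pos.ne'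
  exact fun h4 => h3 (Nat.eq_zero_of_zero_dvd (h4 ▸ Subgroup.index_dvd_of_le h))

variable [Fintype ι] [∀ i, FiniteDimensional k (K i)]

/-- Every ideal of `L` is the ideal of an idele: take local generators at the finitely many places
where it is not trivial. -/
theorem idealOrd_mem_map_ideles (J : SIdeals K S) :
    ∃ x ∈ ideles (k := k) (∀ i, K i), ideleOrd S K x = idealOrd S K J := by
  classical
  choose a _ ha using fun (A : ValuationSubring k) (hA : A ≠ ⊤) => exists_mem_globalOrd_eq J hA
  let bad : Place k → Prop := fun v => ∃ i, ∃ P : HeightOneSpectrum (sIntegers (K i) S),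
    v = .finite (below P) (below_ne_top P) ∧ idealOrd S K J i P ≠ 1
  have hbad : {v | bad v}.Finite := by
    have h1 : ∀ i, {P : HeightOneSpectrum (sIntegers (K i) S) | idealOrd S K J i P ≠ 1}.Finite := by
      intro i
      refine (FractionalIdeal.finite_factors (R := sIntegers (K i) S) (K := K i) (J i)).subset ?_
      intro P hP h
      refine hP ?_
      have : FractionalIdeal.count (K i) P (J i : FractionalIdeal _ (K i)) = 0 := h
      rw [← WithZero.coe_inj, idealOrd_coe, this]
      rfl
    refine (Set.finite_iUnion fun i => (h1 i).image fun P =>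
      Place.finite (below P) (below_ne_top P)).subset ?_
    rintro v ⟨i, P, rfl, hP⟩
    exact Set.mem_iUnion.2 ⟨i, P, hP, rfl⟩
  let x : ∀ v : Place k, (LocalAlg (∀ i, K i) v)ˣ := fun v => match v with
    | .finite A hA => if bad (.finite A hA) then localDiagonal _ _ (a A hA) else 1
    | .infinite _ => 1
  refine ⟨x, hbad.subset fun v hv => ?_, ?_⟩
  · by_contra h
    refine hv ?_
    have h : ¬ bad v := h
    obtain ⟨A, hA⟩ | w := v
    · change (if bad (.finite A hA) then localDiagonal _ _ (a A hA) else 1) ∈ localUnits _ _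
      rw [if_neg h]
      exact one_mem _
    · exact one_mem (localUnits (∀ i, K i) (.infinite w))
  · ext i P
    refine congrArg Multiplicative.toAdd ?_
    change localOrd P (if bad (.finite (below P) (below_ne_top P)) then
      localDiagonal _ _ (a _ (below_ne_top P)) else 1) = _
    split_ifs with h
    · rw [← ha _ (below_ne_top P) i P rfl]
      refine localOrd_eq ?_
      rw [mul_inv_cancel]
      exact one_mem _
    · rw [map_one]
      by_contra h'
      exact h ⟨i, P, rfl, fun h => h' h.symm⟩

/-- Every idele has an ideal, since almost all of its valuations vanish. -/
theorem exists_idealOrd_eq {x : ∀ v : Place k, (LocalAlg (∀ i, K i) v)ˣ}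
    (hx : x ∈ ideles (k := k) (∀ i, K i)) : ∃ J, idealOrd S K J = ideleOrd S K x := by
  classical
  have hfin : ∀ i, {P : HeightOneSpectrum (sIntegers (K i) S) | ideleOrd S K x i P ≠ 1}.Finite := by
    intro i
    have hx' : {v | x v ∉ localUnits (∀ i, K i) v}.Finite := hx
    have h1 : (⋃ v ∈ {v | x v ∉ localUnits (∀ i, K i) v},
        {P : HeightOneSpectrum (sIntegers (K i) S) |
          Place.finite (below P) (below_ne_top P) = v}).Finite := by
      refine hx'.biUnion fun v _ => ?_
      obtain ⟨A, hA⟩ | w := v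
      · refine (finite_setOf_below_eq (S := S) (K := K i) hA).subset fun P hP => ?_
        have hP : Place.finite (below P) (below_ne_top P) = Place.finite A hA := hP
        injection hP
      · refine Set.finite_empty.subset fun P hP => ?_
        have hP : Place.finite (below P) (below_ne_top P) = Place.infinite w := hP
        cases hP
    refine h1.subset fun P hP => ?_
    simp only [Set.mem_iUnion]
    refine ⟨_, fun h => hP ?_, rfl⟩
    have h2 : localOrd P (x (.finite (below P) (below_ne_top P))) = globalOrd P 1 :=
      localOrd_eq (by rwa [map_one, inv_one, mul_one])
    rw [map_one] at h2
    exact h2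
  let e : ∀ i, HeightOneSpectrum (sIntegers (K i) S) →₀ ℤ := fun i =>
    Finsupp.ofSupportFinite (fun P => -(ideleOrd S K x i P).toAdd)
      ((hfin i).subset fun P hP h => hP (by
      change -(ideleOrd S K x i P).toAdd = 0
      rw [h]; rfl))
  have h0 : ∀ i, (e i).prod
      (fun P n => (P.asIdeal : FractionalIdeal (sIntegers (K i) S)⁰ (K i)) ^ n) ≠ 0 := fun i =>
    Finset.prod_ne_zero_iff.2 fun P _ =>
    zpow_ne_zero _ (FractionalIdeal.coeIdeal_ne_zero.2 P.ne_bot)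
  refine ⟨fun i => Units.mk0 _ (h0 i), ?_⟩
  ext i P
  change -(FractionalIdeal.count (K i) P ((e i).prod _)) = _
  rw [FractionalIdeal.count_finsuppProd]
  exact neg_neg _

variable (hk : IsGlobalField k)
  (hS_arch : ∀ w : NumberField.InfinitePlace k, Place.infinite w ∈ S) {t : k} (ht : PolesEq t S)
include hk hS_arch ht

/-- The ideals of norm one are those of the ideles whose norm lies in `U_{k,S}`. -/
theorem map_normOneIdeals [IsDedekindDomain (baseSIntegers S)]
    [IsFractionRing (baseSIntegers S) k] :
    (normOneIdeals K S).map (idealOrd S K) =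
      (ideles (∀ i, K i) ⊓ (baseSUnitIdeles S).comap (ideleNorm (∀ i, K i))).map
        (ideleOrd S K) := by
  ext z
  constructor
  · rintro ⟨J, hJ, rfl⟩
    obtain ⟨x, hx, hxJ⟩ := idealOrd_mem_map_ideles J
    exact ⟨x, ⟨hx, (mem_normOneIdeals_iff hk hS_arch ht hxJ).1 hJ⟩, hxJ⟩
  · rintro ⟨x, ⟨hx, hxV⟩, rfl⟩
    obtain ⟨J, hJ⟩ := exists_idealOrd_eq (S := S) hx
    exact ⟨J, (mem_normOneIdeals_iff hk hS_arch ht hJ.symm).2 hxV, hJ⟩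

/-- The index formula relating ideals, units and ideles, for the subgroup `H` of `L^×`. -/
theorem relIndex_formula [IsDedekindDomain (baseSIntegers S)] [IsFractionRing (baseSIntegers S) k]
    (hS : S.Nonempty) {H : Subgroup (∀ i, K i)ˣ} {H' : ∀ i, Subgroup (K i)ˣ}
    (hH : ∀ a, a ∈ H ↔ ∀ i, Units.map (Pi.evalMonoidHom K i) a ∈ H' i) :
    (principalIdealsOf K S H' ⊓ normOneIdeals K S).relIndex (normOneIdeals K S) *
        ((sUnits (∀ i, K i) S ⊓ H).map (globalNorm (∀ i, K i))).relIndex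
          (baseSUnits S ⊓ H.map (globalNorm (∀ i, K i))) =
      ((H.map (diagonal (∀ i, K i)) ⊓ adelicPoints (∀ i, K i)).map (ideleOrd S K)).relIndex
          ((adelicPoints (∀ i, K i)).map (ideleOrd S K)) *
        ((sUnitIdeles (∀ i, K i) S).map (ideleNorm (∀ i, K i))).relIndex
          (baseSUnitIdeles S ⊓ (ideles (∀ i, K i)).map (ideleNorm (∀ i, K i))) := by
  let L := ∀ i, K i
  let I := ideles (k := k) L
  let Γ := H.map (diagonal (k := k) L)
  have hΓ : Γ ≤ I := by
    rintro _ ⟨a, -, rfl⟩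
    exact diagonal_mem_ideles hk hS_arch ht a
  have hker := ideleOrd_ker (K := K) hk hS_arch ht
  have hU : ((ideleOrd S K).comp I.subtype).ker ≤
      (baseSUnitIdeles S).comap ((ideleNorm L).comp I.subtype) := by
    intro x hx
    have hx' : (x : ∀ v : Place k, (LocalAlg L v)ˣ) ∈ (ideleOrd S K).ker := hx
    rw [hker, sUnitIdeles, Subgroup.mem_pi] at hx'
    change ideleNorm L x ∈ baseSUnitIdeles S
    rw [baseSUnitIdeles, Subgroup.mem_pi]
    exact fun v hv => localNorm_mem (hx' v hv)
  have key := relIndex_mul_relIndex_eq ((ideleOrd S K).comp I.subtype)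
    ((ideleNorm L).comp I.subtype)
    (baseSUnitIdeles S) hU (Γ.subgroupOf I)
  -- The identity `key` lives in the group of ideles as a type of its own; the following equalities
  -- identify the subgroups that occur in it.
  have e1 : (Γ.subgroupOf I).map ((ideleOrd S K).comp I.subtype) = Γ.map (ideleOrd S K) := by
    rw [← Subgroup.map_map, Subgroup.subgroupOf_map_subtype, inf_eq_left.2 hΓ]
  have e2 : ((baseSUnitIdeles S).comap ((ideleNorm L).comp I.subtype)).map
      ((ideleOrd S K).comp I.subtype) = (normOneIdeals K S).map (idealOrd S K) := by
    rw [← Subgroup.map_map, ← Subgroup.comap_comap, map_normOneIdeals hk hS_arch ht, inf_comm]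
    congr 1
    exact Subgroup.subgroupOf_map_subtype _ _
  have e3 : (Γ.subgroupOf I ⊓ ((ideleOrd S K).comp I.subtype).ker).map
      ((ideleNorm L).comp I.subtype) =
      ((sUnits L S ⊓ H).map (globalNorm L)).map (baseDiagonal k) := by
    ext z
    constructor
    · rintro ⟨⟨_, hx⟩, ⟨⟨a, ha, rfl⟩, hx2⟩, rfl⟩
      have h1 : diagonal L a ∈ (ideleOrd S K).ker := hx2
      rw [hker, diagonal_mem_iff] at h1
      exact ⟨_, ⟨a, ⟨h1, ha⟩, rfl⟩, (ideleNorm_diagonal a).symm⟩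
    · rintro ⟨_, ⟨a, ⟨h1, ha⟩, rfl⟩, rfl⟩
      refine ⟨⟨diagonal L a, hΓ ⟨a, ha, rfl⟩⟩, ⟨⟨a, ha, rfl⟩, ?_⟩, ideleNorm_diagonal a⟩
      have h2 := diagonal_mem_iff.2 h1
      rwa [← hker] at h2
  have e4 : baseSUnitIdeles S ⊓ (Γ.subgroupOf I).map ((ideleNorm L).comp I.subtype) =
      (baseSUnits S ⊓ H.map (globalNorm L)).map (baseDiagonal k) := by
    rw [← Subgroup.map_map, Subgroup.subgroupOf_map_subtype, inf_eq_left.2 hΓ]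
    ext z
    constructor
    · rintro ⟨hz, ⟨_, ⟨a, ha, rfl⟩, rfl⟩⟩
      rw [ideleNorm_diagonal] at hz
      exact ⟨_, ⟨baseDiagonal_mem_iff.1 hz, ⟨a, ha, rfl⟩⟩, (ideleNorm_diagonal a).symm⟩
    · rintro ⟨_, ⟨hz, ⟨a, ha, rfl⟩⟩, rfl⟩
      exact ⟨baseDiagonal_mem_iff.2 hz, ⟨_, ⟨a, ha, rfl⟩, ideleNorm_diagonal a⟩⟩
  have e5 : (((ideleNorm L).comp I.subtype).ker).map ((ideleOrd S K).comp I.subtype) =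
      (adelicPoints L).map (ideleOrd S K) := by
    rw [← Subgroup.map_map, map_subtype_ker_comp_subtype]
    rfl
  have e6 : (Γ.subgroupOf I ⊓ ((ideleNorm L).comp I.subtype).ker).map
      ((ideleOrd S K).comp I.subtype) = (Γ ⊓ adelicPoints L).map (ideleOrd S K) := by
    rw [← Subgroup.map_map]
    congr 1
    ext x
    constructor
    · rintro ⟨⟨y, hy⟩, ⟨h1, h2⟩, rfl⟩
      exact ⟨h1, hy, h2⟩
    · rintro ⟨h1, hy, h2⟩
      exact ⟨⟨x, hy⟩, ⟨h1, h2⟩, rfl⟩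
  have e7 : (((ideleOrd S K).comp I.subtype).ker).map ((ideleNorm L).comp I.subtype) =
      (sUnitIdeles L S).map (ideleNorm L) := by
    rw [← Subgroup.map_map, map_subtype_ker_comp_subtype, hker,
      inf_eq_right.2 sUnitIdeles_le_ideles]
  have e8 : ((ideleNorm L).comp I.subtype).range = I.map (ideleNorm L) := by
    rw [MonoidHom.range_comp, Subgroup.range_subtype]
  rw [e1, e2, e3, e4, e5, e6, e7, e8] at key
  rw [← key, ← map_principalIdealsOf hH, ← Subgroup.map_inf _ _ _ idealOrd_injective,
    Subgroup.relIndex_map_map_of_injective _ _ idealOrd_injective,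
    Subgroup.relIndex_map_map_of_injective _ _ (baseDiagonal_injective hS)]

end Product
end GroupLevel

/-! ### The class number -/

section ClassNumber
open IsDedekindDomain

variable {k : Type*} [Field k] {S : Finset (Place k)}
variable {ι : Type*} [Fintype ι] {K : ι → Type*} [∀ i, Field (K i)] [∀ i, Algebra k (K i)]
  [∀ i, FiniteDimensional k (K i)]

/-- The principal ideles of norm one come from elements of norm one. -/
theorem rationalPoints_eq [∀ i, IsDedekindDomain (sIntegers (K i) S)]
    [∀ i, IsFractionRing (sIntegers (K i) S) (K i)] (hk : IsGlobalField k)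
    (hS_arch : ∀ w : NumberField.InfinitePlace k, Place.infinite w ∈ S) {t : k} (ht : PolesEq t S)
    (hS : S.Nonempty) (H : Subgroup (∀ i, K i)ˣ) :
    H.map (diagonal (k := k) (∀ i, K i)) ⊓ adelicPoints (∀ i, K i) =
      (H ⊓ (globalNorm (k := k) (∀ i, K i)).ker).map (diagonal (k := k) (∀ i, K i)) := by
  ext x
  constructor
  · rintro ⟨⟨a, ha, rfl⟩, -, h⟩
    refine ⟨a, ⟨ha, ?_⟩, rfl⟩
    have h1 : ideleNorm (∀ i, K i) (diagonal (k := k) _ a) = 1 := h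
    rw [ideleNorm_diagonal, ← map_one (baseDiagonal k)] at h1
    exact baseDiagonal_injective hS h1
  · rintro ⟨a, ⟨ha, hN⟩, rfl⟩
    refine ⟨⟨a, ha, rfl⟩, diagonal_mem_ideles hk hS_arch ht a, ?_⟩
    change ideleNorm (∀ i, K i) (diagonal (k := k) _ a) = 1
    have hN : globalNorm (k := k) _ a = 1 := hN
    rw [ideleNorm_diagonal, hN, map_one]

/-- The class number formula in terms of indices. -/
theorem relIndex_rationalPoints_mul [∀ i, IsDedekindDomain (sIntegers (K i) S)]
    [∀ i, IsFractionRing (sIntegers (K i) S) (K i)]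
    [IsDedekindDomain (baseSIntegers S)] [IsFractionRing (baseSIntegers S) k]
    (hk : IsGlobalField k)
    (hS_arch : ∀ w : NumberField.InfinitePlace k, Place.infinite w ∈ S) {t : k} (ht : PolesEq t S)
    (hS : S.Nonempty) :
    (principalIdeals K S ⊓ normOneIdeals K S).relIndex (normOneIdeals K S) *
        ((sUnits (∀ i, K i) S).map (globalNorm (∀ i, K i))).relIndex
          (baseSUnits S ⊓ Subgroup.map (globalNorm (∀ i, K i)) ⊤) =
      (rationalPoints (∀ i, K i) ⊔ torusSUnits (∀ i, K i) S).relIndex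
          (adelicPoints (k := k) (∀ i, K i)) *
        ((sUnitIdeles (∀ i, K i) S).map (ideleNorm (∀ i, K i))).relIndex
          (baseSUnitIdeles S ⊓ (ideles (∀ i, K i)).map (ideleNorm (∀ i, K i))) := by
  have h := relIndex_formula (K := K) hk hS_arch ht hS (H := ⊤) (H' := fun _ => ⊤)
    fun a => by simp
  rw [inf_top_eq] at h
  refine h.trans ?_
  rw [relIndex_map_of_le _ inf_le_right, rationalPoints_eq hk hS_arch ht hS, top_inf_eq,
    ideleOrd_ker hk hS_arch ht]
  congr 3
  rw [torusSUnits, adelicPoints, ← inf_assoc, inf_eq_left.2 sUnitIdeles_le_ideles]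

theorem relIndex_ne_zero_of_index_ne_zero {G : Type*} [Group G] {P T : Subgroup G}
    (h : P.index ≠ 0) : (P ⊓ T).relIndex T ≠ 0 := by
  rw [Subgroup.inf_relIndex_right]
  exact fun h1 => h (by
    rw [← Subgroup.relIndex_top_right]
    exact Subgroup.relIndex_eq_zero_of_le_right le_top h1)

end ClassNumber

/-! ### Real characters of finite `ℝ`-algebras -/

section RealAlgebras

/-- Units are detected in the residue fields. -/
theorem isUnit_iff_forall_quotient {E : Type*} [CommRing E] {y : E} :
    IsUnit y ↔ ∀ m : MaximalSpectrum E, Ideal.Quotient.mk m.asIdeal y ≠ 0 := by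
  constructor
  · intro h m h0
    rw [Ideal.Quotient.eq_zero_iff_mem] at h0
    exact m.isMaximal.ne_top (Ideal.eq_top_of_isUnit_mem _ h0 h)
  · intro h
    by_contra hy
    obtain ⟨M, hM, hyM⟩ := exists_max_ideal_of_mem_nonunits hy
    exact h ⟨M, hM⟩ (Ideal.Quotient.eq_zero_iff_mem.2 hyM)

variable {E : Type*} [CommRing E] [Algebra ℝ E]

/-- Ring homomorphisms to `ℝ` are `ℝ`-linear, because `ℝ` has no nontrivial endomorphisms. -/
theorem ringHom_algebraMap_real (Ψ : E →+* ℝ) (c : ℝ) : Ψ (algebraMap ℝ E c) = c :=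
  RingHom.congr_fun (Subsingleton.elim (Ψ.comp (algebraMap ℝ E)) (RingHom.id ℝ)) c

theorem ringHom_surjective (Ψ : E →+* ℝ) : Function.Surjective Ψ := fun c =>
  ⟨_, ringHom_algebraMap_real Ψ c⟩

/-- The maximal ideal of a real character. -/
def charKer (Ψ : E →+* ℝ) : MaximalSpectrum E :=
  ⟨RingHom.ker Ψ, RingHom.ker_isMaximal_of_surjective Ψ (ringHom_surjective Ψ)⟩

/-- The residue field of a real character `Ψ` is `ℝ`, and the residue class of `y` is `Ψ y`. -/
theorem mk_charKer (Ψ : E →+* ℝ) (y : E) :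
    Ideal.Quotient.mk (charKer Ψ).asIdeal y = algebraMap ℝ (E ⧸ (charKer Ψ).asIdeal) (Ψ y) := by
  have h : algebraMap ℝ (E ⧸ (charKer Ψ).asIdeal) (Ψ y) =
    Ideal.Quotient.mk (charKer Ψ).asIdeal (algebraMap ℝ E (Ψ y)) := rfl
  rw [h, Ideal.Quotient.eq]
  change Ψ _ = 0
  rw [map_sub, ringHom_algebraMap_real, sub_self]

theorem charKer_injective : Function.Injective (charKer (E := E)) := by
  intro Ψ Ψ' h
  ext y
  have h1 := mk_charKer Ψ y
  rw [show algebraMap ℝ (E ⧸ (charKer Ψ).asIdeal) (Ψ y) =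
    Ideal.Quotient.mk (charKer Ψ).asIdeal (algebraMap ℝ E (Ψ y)) from rfl, Ideal.Quotient.eq,
    h] at h1
  have h2 : Ψ' (y - algebraMap ℝ E (Ψ y)) = 0 := h1
  rw [map_sub, ringHom_algebraMap_real, sub_eq_zero] at h2
  exact h2.symm

variable [Module.Finite ℝ E]

theorem isArtinianRing_of_real : IsArtinianRing E := isArtinian_of_tower ℝ inferInstance

/-- A residue field of a finite `ℝ`-algebra that is not the residue field of a real character is
isomorphic to `ℂ`. -/
theorem nonempty_algEquiv_complex {m : MaximalSpectrum E} (hm : m ∉ Set.range (charKer (E := E))) :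
    Nonempty ((E ⧸ m.asIdeal) ≃ₐ[ℝ] ℂ) := by
  let _ := Ideal.Quotient.field m.asIdeal
  refine (Real.nonempty_algEquiv_or (E ⧸ m.asIdeal)).resolve_left ?_
  rintro ⟨e⟩
  refine hm ⟨(e : (E ⧸ m.asIdeal) →+* ℝ).comp (Ideal.Quotient.mk m.asIdeal), ?_⟩
  ext y
  change e (Ideal.Quotient.mk m.asIdeal y) = 0 ↔ _
  rw [map_eq_zero_iff e e.injective, Ideal.Quotient.eq_zero_iff_mem]

/-- A nonzero complex number has a square root with nonnegative real part. The segment from it to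
`1` avoids `0`. -/
theorem exists_sq_of_complex {z : ℂ} (hz : z ≠ 0) : ∃ u : ℂ, u ^ 2 = z ∧
    ∀ t : ℝ, 0 ≤ t → t ≤ 1 → ((1 - t : ℝ) : ℂ) + t * u ≠ 0 := by
  obtain ⟨u, hu⟩ := IsAlgClosed.exists_pow_nat_eq z two_pos
  have key : ∀ u : ℂ, u ^ 2 = z → 0 ≤ u.re → ∀ t : ℝ, 0 ≤ t → t ≤ 1 →
      ((1 - t : ℝ) : ℂ) + t * u ≠ 0 := by
    intro u hu hre t h0 h1 h
    have hr := congrArg Complex.re h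
    simp at hr
    have h2 : t * u.re ≥ 0 := mul_nonneg h0 hre
    have ht : t = 1 := by linarith
    subst ht
    simp at h
    rw [h] at hu
    exact hz (by rw [← hu]; norm_num)
  rcases le_total 0 u.re with h | h
  · exact ⟨u, hu, key u hu h⟩
  · exact ⟨-u, by rw [neg_sq, hu], key (-u) (by rw [neg_sq, hu]) (by simpa using h)⟩

variable [IsReduced E]

/-- A reduced finite `ℝ`-algebra is the product of its residue fields. -/
noncomputable def equivPiReal : E ≃ₐ[ℝ] ∀ m : MaximalSpectrum E, E ⧸ m.asIdeal :=
  have := isArtinianRing_of_real (E := E)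
  AlgEquiv.ofRingEquiv (f := IsArtinianRing.equivPi E) fun _ => rfl

theorem equivPiReal_apply (y : E) (m : MaximalSpectrum E) :
    equivPiReal y m = Ideal.Quotient.mk m.asIdeal y := rfl

/-- The sign of the norm of a unit of a reduced finite `ℝ`-algebra is the product of its signs at
the real characters. -/
theorem sign_norm_real [Fintype (E →+* ℝ)] {y : E} (hy : IsUnit y) :
    SignType.sign (Algebra.norm ℝ y) = ∏ Ψ : E →+* ℝ, SignType.sign (Ψ y) := by
  have := isArtinianRing_of_real (E := E)
  let _ : Fintype (MaximalSpectrum E) := Fintype.ofFinite _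
  rw [← Algebra.norm_eq_of_algEquiv (equivPiReal (E := E)), norm_pi]
  have hmul : SignType.sign (∏ m, Algebra.norm ℝ (equivPiReal y m)) =
      ∏ m, SignType.sign (Algebra.norm ℝ (equivPiReal y m)) := map_prod signHom _ _
  rw [hmul]
  symm
  refine Fintype.prod_of_injective charKer charKer_injective _ _ ?_ ?_
  -- Norms from `ℂ` to `ℝ` are positive.
  · intro m hm
    obtain ⟨e⟩ := nonempty_algEquiv_complex hm
    rw [equivPiReal_apply]
    have h0 : e (Ideal.Quotient.mk m.asIdeal y) ≠ 0 := by
      rw [ne_eq, map_eq_zero_iff e e.injective]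
      exact isUnit_iff_forall_quotient.1 hy m
    obtain ⟨u, hu⟩ := IsAlgClosed.exists_pow_nat_eq (e (Ideal.Quotient.mk m.asIdeal y)) two_pos
    rw [← Algebra.norm_eq_of_algEquiv e, ← hu, map_pow]
    refine sign_pos ?_
    have hu0 : u ≠ 0 := by
      rintro rfl
      exact h0 (by rw [← hu]; norm_num)
    have := (Algebra.norm_ne_zero_iff (R := ℝ)).2 hu0
    positivity
  · intro Ψ
    rw [equivPiReal_apply, mk_charKer, Algebra.norm_algebraMap]
    let e : (E ⧸ (charKer Ψ).asIdeal) ≃ₐ[ℝ] ℝ := AlgEquiv.ofRingEquiv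
      (f := RingHom.quotientKerEquivOfSurjective (ringHom_surjective Ψ))
      fun c => ringHom_algebraMap_real Ψ c
    rw [e.toLinearEquiv.finrank_eq, Module.finrank_self, pow_one]

/-- A unit of a reduced finite `ℝ`-algebra that is positive at all real characters is the square of
an element joined to `1` by a segment of units. -/
theorem exists_sq_real {y : E} (hy : IsUnit y) (hpos : ∀ Ψ : E →+* ℝ, 0 < Ψ y) :
    ∃ u : E, u ^ 2 = y ∧ ∀ t : ℝ, 0 ≤ t → t ≤ 1 →
      IsUnit (algebraMap ℝ E (1 - t) + algebraMap ℝ E t * u) := by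
  have key : ∀ m : MaximalSpectrum E, ∃ u : E ⧸ m.asIdeal, u ^ 2 = Ideal.Quotient.mk m.asIdeal y ∧
      ∀ t : ℝ, 0 ≤ t → t ≤ 1 → algebraMap ℝ (E ⧸ m.asIdeal) (1 - t) + algebraMap ℝ _ t * u ≠ 0 := by
    intro m
    let _ := Ideal.Quotient.field m.asIdeal
    by_cases hm : m ∈ Set.range (charKer (E := E))
    · obtain ⟨Ψ, rfl⟩ := hm
      refine ⟨algebraMap ℝ _ (Real.sqrt (Ψ y)), ?_, fun t h0 h1 => ?_⟩
      · rw [mk_charKer, ← map_pow, Real.sq_sqrt (hpos Ψ).le]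
      · rw [← map_mul, ← map_add, ne_eq, map_eq_zero]
        have hs := Real.sqrt_pos.2 (hpos Ψ)
        rcases h0.eq_or_lt with rfl | h0
        · norm_num
        · have := mul_pos h0 hs
          linarith
    · obtain ⟨e⟩ := nonempty_algEquiv_complex hm
      have h0 : e (Ideal.Quotient.mk m.asIdeal y) ≠ 0 := by
        rw [ne_eq, map_eq_zero_iff e e.injective]
        exact isUnit_iff_forall_quotient.1 hy m
      obtain ⟨u, hu, hut⟩ := exists_sq_of_complex h0
      refine ⟨e.symm u, e.injective (by rw [map_pow, e.apply_symm_apply, hu]), fun t h0 h1 h => ?_⟩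
      refine hut t h0 h1 ?_
      have := congrArg e h
      rw [map_add, map_mul, e.commutes, e.commutes, e.apply_symm_apply, map_zero] at this
      exact this
  choose u hu hut using key
  refine ⟨equivPiReal.symm u, equivPiReal.injective ?_, fun t h0 h1 => ?_⟩
  · rw [map_pow, AlgEquiv.apply_symm_apply]
    exact funext hu
  · rw [isUnit_iff_forall_quotient]
    intro m
    rw [← equivPiReal_apply, map_add, map_mul, AlgEquiv.apply_symm_apply, AlgEquiv.commutes,
      AlgEquiv.commutes]
    exact hut m t h0 h1

end RealAlgebras

/-! ### Signs of norms -/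

section RealCharacters

variable {F : Type*} [Field F] (e : F ≃+* ℝ)

section Transport

variable {E : Type*} [CommRing E] [Algebra F E] [Module.Finite F E] [IsReduced E]

/-- The version of `sign_norm_real` for algebras over a field isomorphic to `ℝ`. -/
theorem sign_norm_of_ringEquiv [Fintype (E →+* ℝ)] {y : E} (hy : IsUnit y) :
    SignType.sign (e (Algebra.norm F y)) = ∏ Ψ : E →+* ℝ, SignType.sign (Ψ y) := by
  let _ : Algebra ℝ F := e.symm.toRingHom.toAlgebra
  let _ : Algebra ℝ E := ((algebraMap F E).comp e.symm.toRingHom).toAlgebra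
  have : IsScalarTower ℝ F E := .of_algebraMap_eq fun _ => rfl
  have : Module.Finite ℝ F := Module.Finite.of_surjective (Algebra.linearMap ℝ F) e.symm.surjective
  have : Module.Finite ℝ E := .trans F E
  rw [← sign_norm_real hy]
  congr 1
  refine Algebra.norm_eq_of_ringEquiv e (RingHom.ext fun c => ?_) y
  change algebraMap F E (e.symm (e c)) = algebraMap F E c
  rw [e.symm_apply_apply]

/-- The version of `exists_sq_real` for algebras over a field isomorphic to `ℝ`. -/
theorem exists_sq_of_ringEquiv {y : E} (hy : IsUnit y) (hpos : ∀ Ψ : E →+* ℝ, 0 < Ψ y) :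
    ∃ u : E, u ^ 2 = y ∧ ∀ t : ℝ, 0 ≤ t → t ≤ 1 →
      IsUnit (algebraMap F E (e.symm (1 - t)) + algebraMap F E (e.symm t) * u) := by
  let _ : Algebra ℝ F := e.symm.toRingHom.toAlgebra
  let _ : Algebra ℝ E := ((algebraMap F E).comp e.symm.toRingHom).toAlgebra
  have : IsScalarTower ℝ F E := .of_algebraMap_eq fun _ => rfl
  have : Module.Finite ℝ F := Module.Finite.of_surjective (Algebra.linearMap ℝ F) e.symm.surjective
  have : Module.Finite ℝ E := .trans F E
  exact exists_sq_real hy hpos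

end Transport

include e in
theorem ringHom_ext_of_ringEquiv (f g : F →+* ℝ) : f = g := by
  have h : f.comp e.symm.toRingHom = g.comp e.symm.toRingHom := Subsingleton.elim _ _
  ext c
  have := RingHom.congr_fun h (e c)
  rwa [RingHom.comp_apply, RingHom.comp_apply, RingEquiv.toRingHom_eq_coe, RingEquiv.coe_toRingHom,
    e.symm_apply_apply] at this

section Tensor

variable {k : Type*} [Field k] [Algebra k F] {L : Type*} [CommRing L] [Algebra k L]

theorem isReduced_baseChange (F : Type*) [Field F] [Algebra k F] [Module.Finite k L]
    [Algebra.FormallyEtale k L] :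
    IsReduced (F ⊗[k] L) :=
  Algebra.FormallyUnramified.isReduced_of_field F (F ⊗[k] L)

include e in
/-- A real character of `F ⊗ L` is determined by its restriction to `L`. -/
theorem comp_includeRight_injective :
    Function.Injective fun Ψ : F ⊗[k] L →+* ℝ =>
      Ψ.comp (Algebra.TensorProduct.includeRight (R := k) (A := F)).toRingHom := by
  intro Ψ Ψ' h
  have h1 := ringHom_ext_of_ringEquiv e (Ψ.comp (algebraMap F _)) (Ψ'.comp (algebraMap F _))
  exact Algebra.TensorProduct.ringHom_ext h1 h

/-- The real characters of `F ⊗ L` restrict to real embeddings of `L` over the embedding of `k`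
given by `e`. -/
theorem comp_includeRight_comp_algebraMap (Ψ : F ⊗[k] L →+* ℝ) :
    (Ψ.comp (Algebra.TensorProduct.includeRight (R := k) (A := F)).toRingHom).comp
      (algebraMap k L) = e.toRingHom.comp (algebraMap k F) := by
  rw [ringHom_ext_of_ringEquiv e e.toRingHom (Ψ.comp (algebraMap F _))]
  ext c
  change Ψ ((1 : F) ⊗ₜ algebraMap k L c) = Ψ (algebraMap k F c ⊗ₜ 1)
  rw [Algebra.algebraMap_eq_smul_one, Algebra.algebraMap_eq_smul_one, TensorProduct.smul_tmul]

/-- The real embeddings of `L` over the embedding of `k` given by `e` extend to `F ⊗ L`. -/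
theorem exists_comp_includeRight_eq {φ : L →+* ℝ}
    (h : φ.comp (algebraMap k L) = e.toRingHom.comp (algebraMap k F)) :
    ∃ Ψ : F ⊗[k] L →+* ℝ,
      Ψ.comp (Algebra.TensorProduct.includeRight (R := k) (A := F)).toRingHom = φ := by
  let _ : Algebra k ℝ := (e.toRingHom.comp (algebraMap k F)).toAlgebra
  let f : F →ₐ[k] ℝ := { e.toRingHom with commutes' := fun _ => rfl }
  let g : L →ₐ[k] ℝ := { φ with commutes' := fun c => RingHom.congr_fun h c }
  refine ⟨(Algebra.TensorProduct.lift f g fun _ _ => Commute.all _ _).toRingHom, ?_⟩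
  ext x
  refine (Algebra.TensorProduct.lift_tmul f g (fun _ _ => Commute.all _ _) (1 : F) x).trans ?_
  rw [map_one, one_mul]
  rfl

open Classical in
/-- The sign of the norm of a unit of `F ⊗ L` whose sign at a real character depends as `ε` on the
restriction of the character to `L`: it is a product over the real embeddings of `L` that extend the
embedding of `k` given by `e`. -/
theorem sign_norm_baseChange [Module.Finite k L] [Algebra.FormallyEtale k L]
    [Fintype (L →+* ℝ)] {y : F ⊗[k] L}
    (hy : IsUnit y) (ε : (L →+* ℝ) → SignType) (hε : ∀ Ψ : F ⊗[k] L →+* ℝ, SignType.sign (Ψ y) =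
      ε (Ψ.comp (Algebra.TensorProduct.includeRight (R := k) (A := F)).toRingHom)) :
    SignType.sign (e (Algebra.norm F y)) =
      ∏ ψ : L →+* ℝ with ψ.comp (algebraMap k L) = e.toRingHom.comp (algebraMap k F), ε ψ := by
  have := isReduced_baseChange (k := k) (L := L) F
  have := Finite.of_injective _ (comp_includeRight_injective (k := k) (L := L) e)
  let _ : Fintype (F ⊗[k] L →+* ℝ) := Fintype.ofFinite _
  rw [sign_norm_of_ringEquiv e hy]
  refine Finset.prod_nbij
    (fun Ψ => Ψ.comp (Algebra.TensorProduct.includeRight (R := k) (A := F)).toRingHom) ?_ ?_ ?_ ?_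
  · intro Ψ _
    exact Finset.mem_filter.2 ⟨Finset.mem_univ _, comp_includeRight_comp_algebraMap e Ψ⟩
  · exact (comp_includeRight_injective e).injOn
  · intro φ hφ
    obtain ⟨Ψ, hΨ⟩ := exists_comp_includeRight_eq e (Finset.mem_filter.1 hφ).2
    exact ⟨Ψ, Finset.mem_coe.2 (Finset.mem_univ _), hΨ⟩
  · intro Ψ _
    exact hε Ψ

end Tensor

section Square

theorem norm_one_tmul_of_free {R F E : Type*} [CommRing R] [CommRing F] [Algebra R F] [CommRing E]
    [Algebra R E] [Module.Free R E] [Module.Finite R E] (x : E) :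
    Algebra.norm F ((1 : F) ⊗ₜ[R] x) = algebraMap R F (Algebra.norm R x) := by
  rw [Algebra.norm_apply, Algebra.norm_apply, ← LinearMap.det_baseChange]
  congr 1
  ext y
  simp

variable {k : Type*} [Field k] {L : Type*} [CommRing L] [Algebra k L]
  [Module.Finite k L] [Algebra.FormallyEtale k L] [Fintype (L →+* ℝ)]

open Classical in
/-- The sign at a real character `φ` of `L` of the norm to the left factor of a unit of `L ⊗ L`. -/
theorem sign_norm_left (φ : L →+* ℝ) {y : L ⊗[k] L} (hy : IsUnit y)
    (ε : (L →+* ℝ) → (L →+* ℝ) → SignType)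
    (hε : ∀ Φ : L ⊗[k] L →+* ℝ, SignType.sign (Φ y) =
      ε (Φ.comp (Algebra.TensorProduct.includeLeft (R := k) (S := k)).toRingHom)
        (Φ.comp (Algebra.TensorProduct.includeRight (R := k)).toRingHom)) :
    SignType.sign (φ (Algebra.norm L y)) =
      ∏ ψ : L →+* ℝ with ψ.comp (algebraMap k L) = φ.comp (algebraMap k L), ε φ ψ := by
  let _ : Algebra L ℝ := φ.toAlgebra
  let _ : Algebra k ℝ := (φ.comp (algebraMap k L)).toAlgebra
  have : IsScalarTower k L ℝ := .of_algebraMap_eq fun _ => rfl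
  -- Base change along `φ` turns `L ⊗ L` as an algebra over its left factor into `ℝ ⊗ L`.
  let g := Algebra.TensorProduct.cancelBaseChange k L ℝ ℝ L
  have h1 : φ (Algebra.norm L y) = Algebra.norm ℝ (g ((1 : ℝ) ⊗ₜ[L] y)) := by
    rw [Algebra.norm_eq_of_algEquiv, norm_one_tmul_of_free]
    rfl
  have hu : IsUnit (g ((1 : ℝ) ⊗ₜ[L] y)) :=
    (hy.map (Algebra.TensorProduct.includeRight : _ →ₐ[L] ℝ ⊗[L] (L ⊗[k] L))).map g
  rw [h1]
  refine sign_norm_baseChange (RingEquiv.refl ℝ) hu (ε φ) fun Ψ => ?_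
  let Φ : L ⊗[k] L →+* ℝ := (Ψ.comp g.toRingEquiv.toRingHom).comp
    (Algebra.TensorProduct.includeRight : _ →ₐ[L] ℝ ⊗[L] (L ⊗[k] L)).toRingHom
  refine (hε Φ).trans ?_
  congr 1
  · ext x
    change Ψ (g ((1 : ℝ) ⊗ₜ[L] (x ⊗ₜ[k] (1 : L)))) = φ x
    rw [Algebra.TensorProduct.cancelBaseChange_tmul]
    exact (congrArg (fun c => Ψ (c ⊗ₜ[k] (1 : L))) (mul_one (φ x))).trans
      (ringHom_algebraMap_real Ψ (φ x))
  · ext x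
    change Ψ (g ((1 : ℝ) ⊗ₜ[L] ((1 : L) ⊗ₜ[k] x))) = Ψ ((1 : ℝ) ⊗ₜ[k] x)
    rw [Algebra.TensorProduct.cancelBaseChange_tmul, one_smul]

end Square
end RealCharacters

/-! ### Elements of norm one with prescribed signs -/

section Signs

variable {M : Type*} [CommRing M] [Algebra ℚ M] [Module.Finite ℚ M]

theorem finite_realEmbeddings_rat : Finite (M →+* ℝ) :=
  Finite.of_injective (fun Φ : M →+* ℝ => Φ.toRatAlgHom) fun Φ Φ' h => by
    ext m
    exact AlgHom.congr_fun h m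

/-- The image of a finite `ℚ`-algebra under the product of its real embeddings is dense. -/
theorem dense_range_realEmbeddings :
    DenseRange fun (m : M) (Φ : M →+* ℝ) => Φ m := by
  have := finite_realEmbeddings_rat (M := M)
  let _ := Fintype.ofFinite (M →+* ℝ)
  let v : M →+ ((M →+* ℝ) → ℝ) :=
    { toFun := fun m Φ => Φ m
      map_zero' := funext fun Φ => map_zero Φ
      map_add' := fun a b => funext fun Φ => map_add Φ a b }
  let A := v.range.topologicalClosure
  -- By independence of characters the images of the elements of `M` span the real vector space, and
  -- rational combinations are dense in the real ones.
  have hli : LinearIndependent ℝ fun (Φ : M →+* ℝ) (m : M) => Φ m :=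
    (linearIndependent_monoidHom M ℝ).comp (fun Φ : M →+* ℝ => (Φ : M →* ℝ))
      fun Φ Φ' h => RingHom.ext fun m => DFunLike.congr_fun h m
  rw [← span_flip_eq_top_iff_linearIndependent] at hli
  intro f
  have hf : f ∈ Submodule.span ℝ (Set.range (flip fun (Φ : M →+* ℝ) (m : M) => Φ m)) := by
    rw [hli]; trivial
  change f ∈ A
  induction hf using Submodule.span_induction with
  | mem x hx => exact subset_closure hx
  | zero => exact A.zero_mem
  | add x y _ _ hx hy => exact A.add_mem hx hy
  | smul c x _ hx =>
    refine map_mem_closure₂ (f := fun (c : ℝ) (x : (M →+* ℝ) → ℝ) => c • x) continuous_smul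
      (Rat.denseRange_cast c) hx ?_
    rintro _ ⟨q, rfl⟩ _ ⟨m, rfl⟩
    refine ⟨q • m, funext fun Φ => ?_⟩
    exact (map_rat_smul Φ q m).trans (Rat.smul_def _ _)

/-- Units of a finite `ℚ`-algebra attain all systems of signs at the real embeddings. -/
theorem exists_isUnit_sign_eq (ε : (M →+* ℝ) → SignType) (hε : ∀ Φ, ε Φ ≠ 0) :
    ∃ y : M, IsUnit y ∧ ∀ Φ : M →+* ℝ, SignType.sign (Φ y) = ε Φ := by
  have := finite_realEmbeddings_rat (M := M)
  let _ := Fintype.ofFinite (M →+* ℝ)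
  obtain ⟨_, ⟨m, rfl⟩, hm⟩ := Metric.mem_closure_iff.1
    (dense_range_realEmbeddings (M := M) fun Φ => (ε Φ : ℝ)) (1 / 2) (by norm_num)
  -- a small rational translate of `m` is a unit
  have hfin := Module.End.finite_spectrum (Algebra.lmul ℚ M (-m))
  obtain ⟨δ, ⟨h0, h1⟩, hδ⟩ :=
    ((Set.Ioo_infinite (show (0 : ℚ) < 1 / 4 by norm_num)).sdiff hfin).nonempty
  refine ⟨m + algebraMap ℚ M δ, ?_, fun Φ => ?_⟩
  · rw [spectrum.mem_iff, not_not] at hδ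
    have h2 : algebraMap ℚ (Module.End ℚ M) δ - Algebra.lmul ℚ M (-m) =
        Algebra.lmul ℚ M (m + algebraMap ℚ M δ) := by
      rw [map_neg, map_add, sub_neg_eq_add, add_comm, AlgHom.commutes]
    rwa [h2, Algebra.lmul_isUnit_iff] at hδ
  · have h2 := (dist_le_pi_dist _ _ Φ).trans_lt hm
    rw [Real.dist_eq, abs_lt] at h2
    have h3 : Φ (m + algebraMap ℚ M δ) = Φ m + δ := by
      rw [map_add]
      congr 1
      exact RingHom.congr_fun (Subsingleton.elim (Φ.comp (algebraMap ℚ M)) (algebraMap ℚ ℝ)) δ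
    have h4 : (0 : ℝ) < δ := by exact_mod_cast h0
    have h5 : (δ : ℝ) < 1 / 4 := by
      have : (δ : ℝ) < ((1 / 4 : ℚ) : ℝ) := by exact_mod_cast h1
      simpa using this
    rw [h3]
    rcases hs : ε Φ with _ | _ | _
    · exact absurd hs (hε Φ)
    · rw [hs] at h2
      refine sign_neg ?_
      have : ((SignType.neg : SignType) : ℝ) = -1 := rfl
      simp only [this] at h2
      linarith
    · rw [hs] at h2
      refine sign_pos ?_
      have : ((SignType.pos : SignType) : ℝ) = 1 := rfl
      simp only [this] at h2
      linarith

end Signs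

section NormOne

variable {k : Type*} [Field k] [NumberField k] {L : Type*} [CommRing L] [Algebra k L]
  [Module.Finite k L]

theorem finite_realEmbeddings (k : Type*) [Field k] [NumberField k] (L : Type*) [CommRing L]
    [Algebra k L] [Module.Finite k L] : Finite (L →+* ℝ) := by
  let _ : Algebra ℚ L := ((algebraMap k L).comp (algebraMap ℚ k)).toAlgebra
  have : IsScalarTower ℚ k L := .of_algebraMap_eq fun _ => rfl
  have : Module.Finite ℚ L := .trans k L
  exact finite_realEmbeddings_rat

theorem exists_isUnit_sign_eq_of_numberField (k : Type*) [Field k] [NumberField k] {L : Type*}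
    [CommRing L] [Algebra k L] [Module.Finite k L] (ε : (L →+* ℝ) → SignType)
    (hε : ∀ Φ, ε Φ ≠ 0) :
    ∃ y : L, IsUnit y ∧ ∀ Φ : L →+* ℝ, SignType.sign (Φ y) = ε Φ := by
  let _ : Algebra ℚ L := ((algebraMap k L).comp (algebraMap ℚ k)).toAlgebra
  have : IsScalarTower ℚ k L := .of_algebraMap_eq fun _ => rfl
  have : Module.Finite ℚ L := .trans k L
  exact exists_isUnit_sign_eq ε hε

open Classical in
/-- Signs at the real embeddings of `L` are attained by an element of norm one as soon as their
product over the embeddings extending any given real embedding of `k` is positive. -/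
theorem exists_norm_eq_one_sign_eq [Algebra.FormallyEtale k L] [Fintype (L →+* ℝ)]
    (σ : (L →+* ℝ) → SignType) (hσ : ∀ φ, σ φ ≠ 0)
    (hprod : ∀ τ : k →+* ℝ, ∏ ψ : L →+* ℝ with ψ.comp (algebraMap k L) = τ, σ ψ = 1) :
    ∃ a : Lˣ, globalNorm (k := k) L a = 1 ∧ ∀ φ : L →+* ℝ, SignType.sign (φ a) = σ φ := by
  -- a choice of an extension to `L` of every real embedding of `k`
  let B : (L →+* ℝ) → (L →+* ℝ) := fun φ => Classical.choose
    (p := fun ψ : L →+* ℝ => ψ.comp (algebraMap k L) = φ.comp (algebraMap k L)) ⟨φ, rfl⟩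
  have hB : ∀ φ, (B φ).comp (algebraMap k L) = φ.comp (algebraMap k L) := fun φ =>
    Classical.choose_spec
      (p := fun ψ : L →+* ℝ => ψ.comp (algebraMap k L) = φ.comp (algebraMap k L)) ⟨φ, rfl⟩
  have hBeq : ∀ φ ψ : L →+* ℝ, ψ.comp (algebraMap k L) = φ.comp (algebraMap k L) → B ψ = B φ :=
    fun φ ψ h => by simp only [B, h]
  -- The characters of `L ⊗ L` are the pairs `(φ, ψ)` of real embeddings that agree on `k`. In the
  -- matrix of signs `δ` the product of row `φ` is `σ φ`. Column `ψ` is trivial unless `ψ` is one of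
  -- the chosen extensions, and then its product is that of all `σ φ` with the same restriction to
  -- `k`, which is `1`.
  let δ : (L →+* ℝ) → (L →+* ℝ) → SignType := fun φ ψ => if ψ = B φ then σ φ else 1
  have hδ : ∀ φ ψ, δ φ ψ ≠ 0 := fun φ ψ => by
    by_cases h : ψ = B φ
    · simpa [δ, h] using hσ φ
    · simp [δ, h]
  obtain ⟨y, hy, hyδ⟩ := exists_isUnit_sign_eq_of_numberField k (L := L ⊗[k] L)
    (fun Φ => δ (Φ.comp (Algebra.TensorProduct.includeLeft (R := k) (S := k)).toRingHom)
      (Φ.comp (Algebra.TensorProduct.includeRight (R := k)).toRingHom)) fun Φ => hδ _ _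
  let sw := Algebra.TensorProduct.comm k L L
  have hl : ∀ φ : L →+* ℝ, SignType.sign (φ (Algebra.norm L y)) = σ φ := fun φ => by
    rw [sign_norm_left φ hy δ hyδ, Finset.prod_eq_single (B φ)]
    · simp [δ]
    · intro ψ _ h
      simp [δ, h]
    · intro h
      exact absurd (by simpa using hB φ) h
  have hr : ∀ φ : L →+* ℝ, SignType.sign (φ (Algebra.norm L (sw y))) = 1 := fun φ => by
    rw [sign_norm_left φ (hy.map sw) (fun φ ψ => δ ψ φ)]
    · by_cases h : φ = B φ
      · rw [← hprod (φ.comp (algebraMap k L))]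
        refine Finset.prod_congr rfl fun ψ hψ => ?_
        have h1 : φ = B ψ := by rw [hBeq φ ψ (Finset.mem_filter.1 hψ).2]; exact h
        exact if_pos h1
      · refine Finset.prod_eq_one fun ψ hψ => if_neg ?_
        rw [hBeq φ ψ (Finset.mem_filter.1 hψ).2]
        exact h
    · intro Φ
      refine (hyδ (Φ.comp sw.toRingEquiv.toRingHom)).trans ?_
      congr 1
  refine ⟨(hy.map (Algebra.norm L)).unit * (((hy.map sw).map (Algebra.norm L)).unit)⁻¹, ?_, ?_⟩
  · rw [map_mul, map_inv, mul_inv_eq_one]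
    ext
    change Algebra.norm k (Algebra.norm L y) = Algebra.norm k (Algebra.norm L (sw y))
    rw [Algebra.norm_norm, Algebra.norm_norm, Algebra.norm_eq_of_algEquiv]
  · intro φ
    have h1 : SignType.sign (φ (((hy.map sw).map (Algebra.norm L)).unit⁻¹ : Lˣ)) = 1 := by
      have h2 : φ (((hy.map sw).map (Algebra.norm L)).unit⁻¹ : Lˣ) *
          φ (Algebra.norm L (sw y)) = 1 := by
        rw [← map_mul, IsUnit.val_inv_mul, map_one]
      have h3 := congrArg SignType.sign h2
      rwa [sign_mul, hr φ, mul_one, sign_one] at h3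
    rw [Units.val_mul, map_mul, sign_mul, h1, mul_one]
    exact hl φ

end NormOne

/-! ### The neutral component at a real place -/

section Neutral

/-- In a finite-dimensional algebra, `y` divides its norm, with a quotient that depends continuously
on `y`. -/
theorem exists_continuous_mul_eq_norm (F E : Type*) [Field F] [TopologicalSpace F]
    [IsTopologicalRing F] [CommRing E] [Algebra F E] [Module.Finite F E] [TopologicalSpace E]
    [IsModuleTopology F E] :
    ∃ f : E → E, Continuous f ∧ ∀ y, y * f y = algebraMap F E (Algebra.norm F y) := by
  have : ContinuousAdd E := IsModuleTopology.toContinuousAdd F E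
  have : ContinuousSMul F E := IsModuleTopology.toContinuousSMul F E
  let b := Module.finBasis F E
  refine ⟨fun y => Matrix.toLin b b (Algebra.leftMulMatrix b y).adjugate 1, ?_, fun y => ?_⟩
  · have h1 : Continuous fun y : E => Algebra.leftMulMatrix b y :=
      continuous_matrix fun i j => IsModuleTopology.continuous_of_linearMap
        ((Matrix.entryLinearMap F F i j).comp (Algebra.leftMulMatrix b).toLinearMap)
    have h2 := h1.matrix_adjugate
    simp only [Matrix.toLin_apply]
    exact continuous_finsetSum _ fun i _ =>
      ((continuous_apply i).comp (h2.matrix_mulVec continuous_const)).smul continuous_const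
  · have h1 : Matrix.toLin b b (Algebra.leftMulMatrix b y) = LinearMap.mulLeft F y := by
      rw [Algebra.leftMulMatrix_apply, Matrix.toLin_toMatrix]
      rfl
    change LinearMap.mulLeft F y (Matrix.toLin b b (Algebra.leftMulMatrix b y).adjugate 1) = _
    rw [← h1, ← Matrix.toLin_mul_apply, Matrix.mul_adjugate, ← Algebra.norm_eq_matrix_det,
      map_smul, Matrix.toLin_one, Algebra.algebraMap_eq_smul_one]
    rfl

variable {k : Type*} [Field k] {L : Type*} [CommRing L] [Algebra k L] [Module.Finite k L]
  {v : Place k} (e : v.Completion ≃+* ℝ)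

include e in
/-- A real character is continuous and does not vanish on units, so that it is positive on the
neutral component. -/
theorem pos_of_mem_localTorusNeutral (he : Continuous e) {x : (LocalAlg L v)ˣ}
    (hx : x ∈ localTorusNeutral L v) (Ψ : LocalAlg L v →+* ℝ) : 0 < Ψ x := by
  let _ : TopologicalSpace (LocalAlg L v) := moduleTopology v.Completion (LocalAlg L v)
  have : IsModuleTopology v.Completion (LocalAlg L v) := ⟨rfl⟩
  have : IsTopologicalRing (LocalAlg L v) :=
    IsModuleTopology.isTopologicalRing v.Completion (LocalAlg L v)
  obtain ⟨g, hg, rfl⟩ := hx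
  have hg : g ∈ connectedComponent (1 : localTorus L v) := hg
  have hΨ : ∀ c, Ψ (algebraMap v.Completion (LocalAlg L v) c) = e c := fun c =>
    RingHom.congr_fun (ringHom_ext_of_ringEquiv e (Ψ.comp (algebraMap _ _)) e.toRingHom) c
  let l : LocalAlg L v →ₗ[v.Completion] v.Completion :=
    { toFun := fun y => e.symm (Ψ y)
      map_add' := fun a b => by rw [map_add, map_add]
      map_smul' := fun c y => by
        rw [Algebra.smul_def, map_mul, hΨ, map_mul, e.symm_apply_apply, RingHom.id_apply,
          smul_eq_mul] }
  have hc : Continuous Ψ := by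
    have h := he.comp (IsModuleTopology.continuous_of_linearMap l)
    refine h.congr fun y => e.apply_symm_apply _
  let f : localTorus L v → ℝ := fun g => Ψ (g : (LocalAlg L v)ˣ)
  have hf : Continuous f := hc.comp (Units.continuous_val.comp continuous_subtype_val)
  have hpre := isPreconnected_connectedComponent (x := (1 : localTorus L v)).image f hf.continuousOn
  by_contra hneg
  have h0 : (0 : ℝ) ∈ f '' connectedComponent (1 : localTorus L v) :=
    hpre.ordConnected.out ⟨g, hg, rfl⟩ ⟨1, mem_connectedComponent, rfl⟩
      ⟨not_lt.1 hneg, by simp [f]⟩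
  obtain ⟨g', -, hg'⟩ := h0
  exact ((g' : (LocalAlg L v)ˣ).isUnit.map Ψ).ne_zero hg'

/-- An element of norm one that is positive at all real characters is joined to `1` by a path of
elements of norm one. -/
theorem mem_localTorusNeutral_of_pos [Algebra.FormallyEtale k L] (he : Continuous e)
    (he' : Continuous e.symm) {x : (LocalAlg L v)ˣ} (hx : x ∈ localTorus L v)
    (hpos : ∀ Ψ : LocalAlg L v →+* ℝ, 0 < Ψ x) :
    x ∈ localTorusNeutral L v := by
  let _ : TopologicalSpace (LocalAlg L v) := moduleTopology v.Completion (LocalAlg L v)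
  have : IsModuleTopology v.Completion (LocalAlg L v) := ⟨rfl⟩
  have : IsTopologicalRing (LocalAlg L v) :=
    IsModuleTopology.isTopologicalRing v.Completion (LocalAlg L v)
  have := isReduced_baseChange (k := k) (L := L) v.Completion
  have := IsModuleTopology.toContinuousSMul v.Completion (LocalAlg L v)
  obtain ⟨u, hu, hut⟩ := exists_sq_of_ringEquiv e x.isUnit hpos
  obtain ⟨adj, hadj, hadj'⟩ := exists_continuous_mul_eq_norm v.Completion (LocalAlg L v)
  -- The path is `s(t) w(t) ^ 2`, where `w` is a segment of units from `1` to a square root `u` of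
  -- `x`, and `s(t) > 0` is the scalar that makes the norm `1`. If `L_v = 0`, the exponent `-n⁻¹`
  -- has the junk value `0`, but then all norms are `1` anyway.
  let n := Module.finrank v.Completion (LocalAlg L v)
  let w : ℝ → LocalAlg L v := fun t =>
    algebraMap _ _ (e.symm (1 - t)) + algebraMap _ _ (e.symm t) * u
  let q : ℝ → ℝ := fun t => e (Algebra.norm v.Completion (w t)) ^ 2
  let s : ℝ → v.Completion := fun t => e.symm (q t ^ (-(n : ℝ)⁻¹))
  let y : ℝ → LocalAlg L v := fun t => algebraMap _ _ (s t) * w t ^ 2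
  have hq : ∀ t : unitInterval, 0 < q t := fun t => by
    have h1 : e (Algebra.norm v.Completion (w t)) ≠ 0 :=
      ((hut t t.2.1 t.2.2).map ((e : v.Completion →* ℝ).comp (Algebra.norm v.Completion))).ne_zero
    positivity
  have hNy : ∀ t : unitInterval, Algebra.norm v.Completion (y t) = 1 := fun t => by
    refine e.injective ?_
    rw [map_one, map_mul, Algebra.norm_algebraMap, map_pow, map_mul, map_pow, map_pow,
      e.apply_symm_apply]
    rcases eq_or_ne n 0 with h0 | h0
    · have : Subsingleton (LocalAlg L v) := Module.finrank_zero_iff.1 h0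
      rw [Subsingleton.elim (w t) 1, map_one, map_one, one_pow, mul_one]
      change _ ^ n = _
      rw [h0, pow_zero]
    · change _ ^ n * q t = 1
      rw [← Real.rpow_natCast, ← Real.rpow_mul (hq t).le, neg_mul,
        inv_mul_cancel₀ (Nat.cast_ne_zero.2 h0), Real.rpow_neg_one, inv_mul_cancel₀ (hq t).ne']
  have halg : Continuous (algebraMap v.Completion (LocalAlg L v)) :=
    IsModuleTopology.continuous_of_linearMap (Algebra.linearMap v.Completion (LocalAlg L v))
  have hw : Continuous w :=
    (halg.comp (he'.comp (continuous_const.sub continuous_id))).add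
      ((halg.comp he').mul continuous_const)
  have hnorm : Continuous (Algebra.norm v.Completion : LocalAlg L v → v.Completion) := by
    let b := Module.finBasis v.Completion (LocalAlg L v)
    have h1 : Continuous fun y : LocalAlg L v => Algebra.leftMulMatrix b y :=
      continuous_matrix fun i j => IsModuleTopology.continuous_of_linearMap
        ((Matrix.entryLinearMap v.Completion v.Completion i j).comp
          (Algebra.leftMulMatrix b).toLinearMap)
    exact h1.matrix_det.congr fun y => (Algebra.norm_eq_matrix_det b y).symm
  have hqc : Continuous q := (he.comp (hnorm.comp hw)).pow 2
  have hy : Continuous fun t : unitInterval => y t := by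
    have h1 : Continuous fun t : unitInterval => q t := hqc.comp continuous_subtype_val
    have h2 : Continuous fun t : unitInterval => q t ^ (-(n : ℝ)⁻¹) :=
      h1.rpow_const fun t => Or.inl (hq t).ne'
    exact (halg.comp (he'.comp h2)).mul ((hw.comp continuous_subtype_val).pow 2)
  have hinv : ∀ t : unitInterval, y t * adj (y t) = 1 := fun t => by
    rw [hadj', hNy, map_one]
  let γ : unitInterval → localTorus L v := fun t =>
    ⟨⟨y t, adj (y t), hinv t, by rw [mul_comm, hinv]⟩, Units.ext (hNy t)⟩
  have hγ : Continuous γ := by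
    refine Continuous.subtype_mk (Units.continuous_iff.2 ⟨hy, hadj.comp hy⟩) _
  have hγ0 : γ 0 = 1 := by
    refine Subtype.ext (Units.ext ?_)
    change y (0 : ℝ) = 1
    have hw0 : w 0 = 1 := by
      simp only [w, sub_zero, map_one, map_zero, zero_mul, add_zero]
    simp only [y, s, q, hw0, map_one, one_pow, Real.one_rpow, mul_one]
  have hγ1 : γ 1 = ⟨x, hx⟩ := by
    refine Subtype.ext (Units.ext ?_)
    change y (1 : ℝ) = x
    have hw1 : w 1 = u := by
      simp only [w, sub_self, map_one, map_zero, one_mul, zero_add]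
    have hq1 : q 1 = 1 := by
      have hx1 : Algebra.norm v.Completion (x : LocalAlg L v) = 1 := congrArg Units.val hx
      simp only [q, hw1]
      rw [← map_pow, ← map_pow, hu, hx1, map_one]
    simp only [y, s, hw1, hq1, Real.one_rpow, map_one, one_mul, hu]
  refine ⟨⟨x, hx⟩, ?_, rfl⟩
  change _ ∈ connectedComponent (1 : localTorus L v)
  exact (isPreconnected_range hγ).subset_connectedComponent ⟨0, hγ0⟩ ⟨1, hγ1⟩

end Neutral

/-! ### Signs of ideles at the real places -/

section RealPlaces

open NumberField

variable {k : Type*} [Field k]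

/-- The completion at a real place is topologically isomorphic to `ℝ`. -/
theorem exists_ringEquiv_real {v : Place k} (hv : v.IsReal) :
    ∃ e : v.Completion ≃+* ℝ, Continuous e ∧ Continuous e.symm := by
  cases v with
  | finite A hA => exact hv.elim
  | infinite w =>
    have hw : w.IsReal := hv
    exact ⟨InfinitePlace.Completion.ringEquivRealOfIsReal hw,
      (InfinitePlace.Completion.isometryEquivRealOfIsReal hw).continuous,
      (InfinitePlace.Completion.isometryEquivRealOfIsReal hw).symm.continuous⟩

theorem ringEquiv_comp_algebraMap {w : InfinitePlace k} (hw : w.IsReal)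
    (e : (Place.infinite w).Completion ≃+* ℝ) :
    e.toRingHom.comp (algebraMap k (Place.infinite w).Completion) =
      InfinitePlace.embedding_of_isReal hw := by
  rw [ringHom_ext_of_ringEquiv e e.toRingHom
    (InfinitePlace.Completion.ringEquivRealOfIsReal hw).toRingHom]
  ext c
  exact InfinitePlace.Completion.extensionEmbeddingOfIsReal_coe hw ((WithAbs.equiv w.1).symm c)

/-- A real place is determined by the real embedding of `k` that it defines. -/
theorem place_eq_of_comp_algebraMap_eq {v v' : Place k} (hv : v.IsReal) (hv' : v'.IsReal)
    (e : v.Completion ≃+* ℝ) (e' : v'.Completion ≃+* ℝ)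
    (h : e.toRingHom.comp (algebraMap k v.Completion) =
      e'.toRingHom.comp (algebraMap k v'.Completion)) : v = v' := by
  rcases v with ⟨A, hA⟩ | w
  · exact hv.elim
  rcases v' with ⟨A, hA⟩ | w'
  · exact hv'.elim
  rw [ringEquiv_comp_algebraMap hv, ringEquiv_comp_algebraMap hv'] at h
  congr 1
  rw [← w.mk_embedding, ← w'.mk_embedding]
  congr 1
  ext c
  rw [← InfinitePlace.embedding_of_isReal_apply hv,
    ← InfinitePlace.embedding_of_isReal_apply hv', h]

/-- Every real embedding of `k` comes from a real place. -/
theorem exists_place_of_realEmbedding (τ : k →+* ℝ) :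
    ∃ v : Place k, v.IsReal ∧ ∃ e : v.Completion ≃+* ℝ,
      e.toRingHom.comp (algebraMap k v.Completion) = τ := by
  have hτ : ComplexEmbedding.IsReal (Complex.ofRealHom.comp τ) := by
    rw [ComplexEmbedding.isReal_iff]
    ext c
    exact Complex.conj_ofReal _
  have hw : (InfinitePlace.mk (Complex.ofRealHom.comp τ)).IsReal := InfinitePlace.isReal_mk_iff.2 hτ
  obtain ⟨e, -⟩ := exists_ringEquiv_real (v := .infinite (.mk (Complex.ofRealHom.comp τ))) hw
  refine ⟨.infinite (.mk (Complex.ofRealHom.comp τ)), hw, e, ?_⟩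
  rw [ringEquiv_comp_algebraMap hw]
  ext c
  rw [← Complex.ofReal_inj, InfinitePlace.embedding_of_isReal_apply,
    InfinitePlace.embedding_mk_eq_of_isReal hτ]
  rfl

variable {L : Type*} [CommRing L] [Algebra k L]

/-- Every real embedding of `L` is the restriction of a real character of `L_v` for some real place
`v`. -/
theorem exists_localCharacter (φ : L →+* ℝ) :
    ∃ v : Place k, v.IsReal ∧ ∃ Ψ : LocalAlg L v →+* ℝ,
      Ψ.comp (Algebra.TensorProduct.includeRight (R := k) (A := v.Completion)).toRingHom = φ := by
  obtain ⟨v, hv, e, he⟩ := exists_place_of_realEmbedding (φ.comp (algebraMap k L))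
  exact ⟨v, hv, exists_comp_includeRight_eq e he.symm⟩

/-- The real place and the real character of `L_v` are determined by the real embedding of `L`. -/
theorem localCharacter_apply_eq {v v' : Place k} (hv : v.IsReal) (hv' : v'.IsReal)
    {Ψ : LocalAlg L v →+* ℝ} {Ψ' : LocalAlg L v' →+* ℝ}
    (h : Ψ.comp (Algebra.TensorProduct.includeRight (R := k) (A := v.Completion)).toRingHom =
      Ψ'.comp (Algebra.TensorProduct.includeRight (R := k) (A := v'.Completion)).toRingHom)
    (x : ∀ v : Place k, (LocalAlg L v)ˣ) : Ψ (x v) = Ψ' (x v') := by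
  obtain ⟨e, -⟩ := exists_ringEquiv_real hv
  obtain ⟨e', -⟩ := exists_ringEquiv_real hv'
  have hvv : v = v' := by
    refine place_eq_of_comp_algebraMap_eq hv hv' e e' ?_
    rw [← comp_includeRight_comp_algebraMap (L := L) e Ψ, h, comp_includeRight_comp_algebraMap e']
  subst hvv
  rw [comp_includeRight_injective e h]

/-- The signs of an idele at the real places, as a function on the real embeddings of `L`. -/
theorem exists_realSigns (x : ∀ v : Place k, (LocalAlg L v)ˣ) :
    ∃ σ : (L →+* ℝ) → SignType, (∀ φ, σ φ ≠ 0) ∧ ∀ v : Place k, v.IsReal →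
      ∀ Ψ : LocalAlg L v →+* ℝ, SignType.sign (Ψ (x v)) =
        σ (Ψ.comp (Algebra.TensorProduct.includeRight (R := k) (A := v.Completion)).toRingHom) := by
  choose V hV Ψ hΨ using exists_localCharacter (k := k) (L := L)
  refine ⟨fun φ => SignType.sign (Ψ φ (x (V φ))), fun φ => ?_, fun v hv Ψ' => ?_⟩
  · rw [sign_ne_zero]
    exact ((x (V φ)).isUnit.map (Ψ φ)).ne_zero
  · rw [localCharacter_apply_eq hv (hV _) (hΨ _).symm x]

theorem localCharacter_diagonal {v : Place k} (Ψ : LocalAlg L v →+* ℝ) (a : Lˣ) :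
    Ψ (diagonal (k := k) L a v) =
      Ψ.comp (Algebra.TensorProduct.includeRight (R := k) (A := v.Completion)).toRingHom a := rfl

theorem forall_localCharacter_diagonal_pos {a : Lˣ} :
    (∀ v : Place k, v.IsReal → ∀ Ψ : LocalAlg L v →+* ℝ, 0 < Ψ (diagonal (k := k) L a v)) ↔
      a ∈ totallyPositive L := by
  constructor
  · intro h φ
    obtain ⟨v, hv, Ψ, rfl⟩ := exists_localCharacter (k := k) φ
    exact h v hv Ψ
  · intro h v hv Ψ
    exact h (Ψ.comp (Algebra.TensorProduct.includeRight (R := k) (A := v.Completion)).toRingHom)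

/-- The totally positive elements have finite index in `L^×`: they are given by finitely many signs.
-/
theorem totallyPositive_index_ne_zero (k : Type*) [Field k] [NumberField k] (L : Type*)
    [CommRing L] [Algebra k L] [Module.Finite k L] : (totallyPositive L).index ≠ 0 := by
  have := finite_realEmbeddings k L
  let f : Lˣ →* ((L →+* ℝ) → SignTypeˣ) := MonoidHom.pi fun φ =>
    (Units.map (signHom : ℝ →*₀ SignType).toMonoidHom).comp (Units.map φ.toMonoidHom)
  have h : f.ker ≤ totallyPositive L := fun a ha φ =>
    sign_eq_one_iff.1 (congrArg Units.val (congrFun ha φ))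
  exact ne_zero_of_dvd_ne_zero (Subgroup.FiniteIndex.index_ne_zero (H := f.ker))
    (Subgroup.index_dvd_of_le h)

variable [Module.Finite k L] [Algebra.FormallyEtale k L]

/-- The neutral components at the real places are described by positivity at all real characters. -/
theorem mem_adelicPointsPos_iff {x : ∀ v : Place k, (LocalAlg L v)ˣ} :
    x ∈ adelicPointsPos L ↔ x ∈ adelicPoints L ∧
      ∀ v : Place k, v.IsReal → ∀ Ψ : LocalAlg L v →+* ℝ, 0 < Ψ (x v) := by
  refine and_congr_right fun hx => ?_
  change (∀ v : Place k, v.IsReal → x v ∈ localTorusNeutral L v) ↔ _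
  refine forall₂_congr fun v hv => ?_
  obtain ⟨e, he, he'⟩ := exists_ringEquiv_real hv
  exact ⟨fun h => pos_of_mem_localTorusNeutral e he h,
    mem_localTorusNeutral_of_pos e he he' (congrFun hx.2 v)⟩

/-- An idele of norm one agrees in sign with an element of `L` of norm one at the real places. -/
theorem exists_normOne_mul_pos [NumberField k] {x : ∀ v : Place k, (LocalAlg L v)ˣ}
    (hx : x ∈ (ideleNorm L).ker) : ∃ a : Lˣ, globalNorm (k := k) L a = 1 ∧
      ∀ v : Place k, v.IsReal → ∀ Ψ : LocalAlg L v →+* ℝ,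
        0 < Ψ ((diagonal (k := k) L a * x) v : (LocalAlg L v)ˣ) := by
  classical
  have := finite_realEmbeddings k L
  let _ := Fintype.ofFinite (L →+* ℝ)
  obtain ⟨σ, hσ, hxσ⟩ := exists_realSigns x
  obtain ⟨a, ha, haσ⟩ := exists_norm_eq_one_sign_eq (k := k) σ hσ fun τ => by
    obtain ⟨v, hv, e, rfl⟩ := exists_place_of_realEmbedding τ
    have hN : Algebra.norm v.Completion (x v : LocalAlg L v) = 1 :=
      congrArg Units.val (congrFun hx v)
    rw [← sign_norm_baseChange e (x v).isUnit σ (hxσ v hv), hN, map_one, sign_one]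
  refine ⟨a, ha, fun v hv Ψ => ?_⟩
  rw [Pi.mul_apply, Units.val_mul, map_mul, ← sign_eq_one_iff, sign_mul, localCharacter_diagonal,
    haσ, hxσ v hv]
  have := hσ (Ψ.comp (Algebra.TensorProduct.includeRight (R := k) (A := v.Completion)).toRingHom)
  revert this
  generalize σ _ = s
  decide +revert

/-- Norms of totally positive elements are totally positive. -/
theorem globalNorm_mem_totallyPositive [NumberField k] {a : Lˣ} (ha : a ∈ totallyPositive L) :
    globalNorm (k := k) L a ∈ totallyPositive k := by
  classical
  have := finite_realEmbeddings k L
  let _ := Fintype.ofFinite (L →+* ℝ)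
  intro τ
  let _ : Algebra k ℝ := τ.toAlgebra
  change 0 < τ (Algebra.norm k (a : L))
  have h : τ (Algebra.norm k (a : L)) = Algebra.norm ℝ ((1 : ℝ) ⊗ₜ[k] (a : L)) :=
    (norm_one_tmul (a : L)).symm
  rw [h, ← sign_eq_one_iff]
  refine (sign_norm_baseChange (k := k) (L := L) (RingEquiv.refl ℝ)
    (a.isUnit.map (Algebra.TensorProduct.includeRight : L →ₐ[k] ℝ ⊗[k] L)) (fun _ => 1)
    fun Ψ => sign_pos (ha (Ψ.comp
      (Algebra.TensorProduct.includeRight (R := k) (A := ℝ)).toRingHom))).trans ?_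
  exact Finset.prod_const_one

end RealPlaces

/-! ### The narrow class number -/

section Narrow
open IsDedekindDomain

/-- Every real character of a finite product of fields factors through one of the fields. -/
theorem mem_totallyPositive_pi {ι : Type*} [Finite ι] {K : ι → Type*} [∀ i, Field (K i)]
    {a : (∀ i, K i)ˣ} : a ∈ totallyPositive (∀ i, K i) ↔
      ∀ i, Units.map (Pi.evalMonoidHom K i) a ∈ totallyPositive (K i) := by
  classical
  let _ := Fintype.ofFinite ι
  constructor
  · exact fun h i φ => h (φ.comp (Pi.evalRingHom K i))
  · intro h φ
    -- exactly one of the idempotents of the product is not killed by `φ`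
    have h1 : ∑ i, φ (Pi.single i 1) = 1 := by
      rw [← map_sum, ← map_one φ]
      congr 1
      exact Finset.univ_sum_single (1 : ∀ i, K i)
    obtain ⟨i, -, hi⟩ := Finset.exists_ne_zero_of_sum_ne_zero (h1.trans_ne one_ne_zero)
    have hi1 : φ (Pi.single i 1) = 1 := by
      have h2 : φ (Pi.single i 1) * φ (Pi.single i 1) = φ (Pi.single i 1) := by
        rw [← map_mul, ← Pi.single_mul, one_mul]
      exact mul_right_cancel₀ hi (h2.trans (one_mul _).symm)
    let ψ : K i →+* ℝ :=
      { toFun := fun c => φ (Pi.single i c)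
        map_one' := hi1
        map_zero' := by rw [Pi.single_zero, map_zero]
        map_add' := fun b c => by rw [Pi.single_add, map_add]
        map_mul' := fun b c => by rw [Pi.single_mul, map_mul] }
    have h2 : φ (a : ∀ i, K i) = ψ ((a : ∀ i, K i) i) := by
      change _ = φ (Pi.single i ((a : ∀ i, K i) i))
      rw [← mul_one (φ (a : ∀ i, K i)), ← hi1, ← map_mul]
      congr 1
      ext j
      rcases eq_or_ne j i with rfl | hj
      · simp
      · simp [hj]
    rw [h2]
    exact h i ψ

theorem formallyEtale_pi {k : Type*} [Field k] {ι : Type*} [Finite ι] {K : ι → Type*}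
    [∀ i, Field (K i)] [∀ i, Algebra k (K i)] [∀ i, Algebra.IsSeparable k (K i)] :
    Algebra.FormallyEtale k (∀ i, K i) :=
  (Algebra.FormallyEtale.pi_iff K).2 fun i => .of_isSeparable k (K i)

variable {k : Type*} [Field k] {S : Finset (Place k)}
variable {ι : Type*} [Fintype ι] {K : ι → Type*} [∀ i, Field (K i)] [∀ i, Algebra k (K i)]
  [∀ i, FiniteDimensional k (K i)]

/-- The principal ideals with totally positive generators have finite index in the ideals of `L`. -/
theorem principalIdealsPos_index_ne_zero [NumberField k]
    [∀ i, IsDedekindDomain (sIntegers (K i) S)] [∀ i, IsFractionRing (sIntegers (K i) S) (K i)]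
    [∀ i, Finite (ClassGroup (sIntegers (K i) S))] : (principalIdealsPos K S).index ≠ 0 := by
  have h1 : (⊤ : Subgroup (∀ i, K i)ˣ).map (principalIdeal S) = principalIdeals K S := by
    ext J
    refine Iff.trans ?_ mem_principalIdealsOf.symm
    simp
  have h2 : (totallyPositive (∀ i, K i)).map (principalIdeal S) = principalIdealsPos K S := by
    ext J
    refine Iff.trans ?_ mem_principalIdealsOf.symm
    simp only [Subgroup.mem_map, mem_totallyPositive_pi]
  have h3 : (principalIdealsPos K S).relIndex (principalIdeals K S) ≠ 0 := by
    rw [← h1, ← h2, Subgroup.relIndex_map_map, top_sup_eq, Subgroup.relIndex_top_right]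
    exact fun h => totallyPositive_index_ne_zero k (∀ i, K i)
      (Nat.eq_zero_of_zero_dvd (h ▸ Subgroup.index_dvd_of_le le_sup_left))
  have h4 : principalIdealsPos K S ≤ principalIdeals K S := by
    rw [← h1, ← h2]
    exact Subgroup.map_mono le_top
  rw [← Subgroup.relIndex_mul_index h4]
  exact mul_ne_zero h3 principalIdeals_index_ne_zero

variable [∀ i, Algebra.IsSeparable k (K i)]

/-- The narrow class number formula in terms of indices. -/
theorem relIndex_rationalPoints_pos_mul [NumberField k]
    [∀ i, IsDedekindDomain (sIntegers (K i) S)]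
    [∀ i, IsFractionRing (sIntegers (K i) S) (K i)]
    [IsDedekindDomain (baseSIntegers S)] [IsFractionRing (baseSIntegers S) k]
    (hk : IsGlobalField k)
    (hS_arch : ∀ w : NumberField.InfinitePlace k, Place.infinite w ∈ S) {t : k} (ht : PolesEq t S)
    (hS : S.Nonempty) :
    (principalIdealsPos K S ⊓ normOneIdeals K S).relIndex (normOneIdeals K S) *
        (Subgroup.map (globalNorm (∀ i, K i))
          (sUnits (∀ i, K i) S ⊓ totallyPositive (∀ i, K i))).relIndex
          (baseSUnits S ⊓ (totallyPositive (∀ i, K i)).map (globalNorm (∀ i, K i))) =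
      (rationalPoints (∀ i, K i) ⊔
        (torusSUnits (∀ i, K i) S ⊓ adelicPointsPos (∀ i, K i))).relIndex
          (adelicPoints (k := k) (∀ i, K i)) *
        ((sUnitIdeles (∀ i, K i) S).map (ideleNorm (∀ i, K i))).relIndex
          (baseSUnitIdeles S ⊓ (ideles (∀ i, K i)).map (ideleNorm (∀ i, K i))) := by
  classical
  have := formallyEtale_pi (k := k) (K := K)
  let L := ∀ i, K i
  let T := adelicPoints (k := k) L
  let Tp := adelicPointsPos (k := k) L
  have hTp : Tp ≤ T := inf_le_left
  have hker := ideleOrd_ker (K := K) hk hS_arch ht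
  have hΓT : (⊤ : Subgroup Lˣ).map (diagonal (k := k) L) ⊓ T = rationalPoints L := by
    rw [rationalPoints_eq hk hS_arch ht hS, top_inf_eq]
    rfl
  have hT : T ≤ ((⊤ : Subgroup Lˣ).map (diagonal (k := k) L) ⊓ T) ⊔ Tp := by
    intro x hx
    obtain ⟨a, ha, hpos⟩ := exists_normOne_mul_pos (k := k) (L := L) hx.2
    have h1 : diagonal (k := k) L a ∈ (⊤ : Subgroup Lˣ).map (diagonal (k := k) L) ⊓ T := by
      rw [hΓT]
      exact ⟨a, ha, rfl⟩
    rw [← inv_mul_cancel_left (diagonal (k := k) L a) x]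
    exact mul_mem (Subgroup.mem_sup_left (inv_mem h1)) (Subgroup.mem_sup_right
      (mem_adelicPointsPos_iff.2 ⟨mul_mem h1.2 hx, hpos⟩))
  have hφ : T.map (ideleOrd S K) ≤ Tp.map (ideleOrd S K) := by
    rintro _ ⟨x, hx, rfl⟩
    -- the real components do not matter for the ideal of an idele
    let x' : ∀ v : Place k, (LocalAlg L v)ˣ := fun v => if v.IsReal then 1 else x v
    have hx1 : x' ∈ ideles L := by
      refine Filter.Eventually.mono (show ∀ᶠ v in Filter.cofinite, x v ∈ localUnits L v from hx.1)
        fun v hv => ?_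
      by_cases h : v.IsReal
      · simp only [x', if_pos h]
        exact one_mem _
      · simpa only [x', if_neg h] using hv
    have hx2 : x' ∈ (ideleNorm L).ker := by
      refine funext fun v => ?_
      rw [ideleNorm_apply]
      by_cases h : v.IsReal
      · simp only [x', if_pos h]
        exact map_one _
      · simp only [x', if_neg h]
        exact congrFun hx.2 v
    refine ⟨x', mem_adelicPointsPos_iff.2 ⟨⟨hx1, hx2⟩, fun v hv Ψ => ?_⟩, ?_⟩
    · simp only [x', if_pos hv, Units.val_one, map_one, zero_lt_one]
    · rw [← inv_mul_eq_one, ← map_inv, ← map_mul, ← MonoidHom.mem_ker, hker, sUnitIdeles,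
        Subgroup.mem_pi]
      intro v hv
      have h : ¬ v.IsReal := by
        intro h
        cases v with
        | finite A hA => exact h
        | infinite w => exact hv (hS_arch w)
      simp only [Pi.mul_apply, Pi.inv_apply, x', if_neg h, inv_mul_cancel]
      exact one_mem _
  have hpos : (⊤ : Subgroup Lˣ).map (diagonal (k := k) L) ⊓ Tp =
      (totallyPositive L).map (diagonal (k := k) L) ⊓ T := by
    ext x
    constructor
    · rintro ⟨⟨a, -, rfl⟩, ha⟩
      obtain ⟨h1, h2⟩ := mem_adelicPointsPos_iff.1 ha
      exact ⟨⟨a, forall_localCharacter_diagonal_pos.1 h2, rfl⟩, h1⟩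
    · rintro ⟨⟨a, ha, rfl⟩, h1⟩
      exact ⟨⟨a, trivial, rfl⟩,
        mem_adelicPointsPos_iff.2 ⟨h1, forall_localCharacter_diagonal_pos.2 ha⟩⟩
  have key := relIndex_sup_inf_eq (ideleOrd S K) hTp hT hφ
  rw [hΓT, hpos, hker] at key
  have h := relIndex_formula (K := K) hk hS_arch ht hS (H := totallyPositive L)
    (H' := fun i => totallyPositive (K i)) fun a => mem_totallyPositive_pi
  refine h.trans ?_
  rw [← key]
  congr 3
  have h1 : torusSUnits (k := k) L S ⊓ Tp = sUnitIdeles L S ⊓ Tp := by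
    rw [torusSUnits, inf_assoc, inf_eq_right.2 (hTp.trans inf_le_right)]
  exact h1.symm

end Narrow
end MultinormTorus

/-- `k` is a global field, `L = ∏ᵢ Kᵢ` an étale `k`-algebra, `S` a nonempty finite set of places of
`k` containing all archimedean ones. -/
theorem proposition2p2 {k : Type*} [Field k] (hk : IsGlobalField k)
    {ι : Type*} [Fintype ι] (K : ι → Type*) [∀ i, Field (K i)] [∀ i, Algebra k (K i)]
    [∀ i, FiniteDimensional k (K i)] [∀ i, Algebra.IsSeparable k (K i)]
    (S : Finset (Place k)) (hS : S.Nonempty)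
    (hS_arch : ∀ w : NumberField.InfinitePlace k, Place.infinite w ∈ S) :
    -- `h_S(T)` and the index in the denominator are finite (hence so are the other two indices),
    -- and the formula for `h_S(T)` holds
    (Finite (TorusClassGroup (k := k) (∀ i, K i) S) ∧
      ((sUnitIdeles (∀ i, K i) S).map (ideleNorm (∀ i, K i))).relIndex
        (baseSUnitIdeles S ⊓
          (ideles (∀ i, K i)).map (ideleNorm (∀ i, K i))) ≠ 0 ∧
      (classNumber (k := k) (∀ i, K i) S : ℚ) =
        ((principalIdeals K S ⊓ normOneIdeals K S).relIndex
            (normOneIdeals K S) : ℚ) *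
          (((sUnits (∀ i, K i) S).map (globalNorm (∀ i, K i))).relIndex
            (baseSUnits S ⊓
              Subgroup.map (globalNorm (∀ i, K i)) ⊤) : ℚ) /
          (((sUnitIdeles (∀ i, K i) S).map (ideleNorm (∀ i, K i))).relIndex
            (baseSUnitIdeles S ⊓
              (ideles (∀ i, K i)).map (ideleNorm (∀ i, K i))) : ℚ)) ∧
    -- the narrow version, for number fields
    (NumberField k →
      Finite (NarrowTorusClassGroup (k := k) (∀ i, K i) S) ∧
      (narrowClassNumber (k := k) (∀ i, K i) S : ℚ) =
        ((principalIdealsPos K S ⊓ normOneIdeals K S).relIndex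
            (normOneIdeals K S) : ℚ) *
          ((Subgroup.map (globalNorm (∀ i, K i))
              (sUnits (∀ i, K i) S ⊓
                totallyPositive (∀ i, K i))).relIndex
            ((baseSUnits S ⊓ totallyPositive k) ⊓
              (totallyPositive (∀ i, K i)).map (globalNorm (∀ i, K i))) : ℚ) /
          (((sUnitIdeles (∀ i, K i) S).map (ideleNorm (∀ i, K i))).relIndex
            (baseSUnitIdeles S ⊓
              (ideles (∀ i, K i)).map (ideleNorm (∀ i, K i))) : ℚ))
 := by
  obtain ⟨t, ht, hbase, hext⟩ := exists_polesEq hk hS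
  rw [← baseSIntegers_eq_poleRing ht hS_arch] at hbase
  have hext : ∀ i, IsDedekindDomain (sIntegers (K i) S) ∧ IsFractionRing (sIntegers (K i) S) (K i) ∧
      ∀ [IsDomain (sIntegers (K i) S)], Finite (ClassGroup (sIntegers (K i) S)) := fun i => by
    rw [sIntegers_eq_poleRing ht hS_arch]
    exact hext (K i)
  obtain ⟨_, _⟩ := hbase
  have := fun i => (hext i).1
  have := fun i => (hext i).2.1
  have := fun i => (hext i).2.2
  have key := relIndex_rationalPoints_mul (K := K) hk hS_arch ht hS
  have h1 : (principalIdeals K S ⊓ normOneIdeals K S).relIndex (normOneIdeals K S) ≠ 0 :=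
    relIndex_ne_zero_of_index_ne_zero principalIdeals_index_ne_zero
  have h2 := relIndex_map_globalNorm_ne_zero (k := k) (S := S) hk hS_arch
    (H := (⊤ : Subgroup (∀ i, K i)ˣ)) fun _ => trivial
  rw [inf_top_eq] at h2
  have h3 := mul_ne_zero h1 h2
  rw [key] at h3
  have h4 := right_ne_zero_of_mul h3
  refine ⟨⟨Nat.finite_of_card_ne_zero (left_ne_zero_of_mul h3), h4, ?_⟩, fun _ => ?_⟩
  · rw [eq_div_iff (Nat.cast_ne_zero.2 h4), ← Nat.cast_mul, ← Nat.cast_mul, key]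
    rfl
  · have := formallyEtale_pi (k := k) (K := K)
    -- norms of totally positive elements are totally positive
    have hN : (baseSUnits S ⊓ totallyPositive k) ⊓
        (totallyPositive (∀ i, K i)).map (globalNorm (∀ i, K i)) =
          baseSUnits S ⊓ (totallyPositive (∀ i, K i)).map (globalNorm (∀ i, K i)) := by
      have h : (totallyPositive (∀ i, K i)).map (globalNorm (k := k) (∀ i, K i)) ≤
          totallyPositive k := by
        rintro _ ⟨a, ha, rfl⟩
        exact globalNorm_mem_totallyPositive ha
      rw [inf_assoc, inf_eq_right.2 h]
    rw [hN]
    have key := relIndex_rationalPoints_pos_mul (K := K) hk hS_arch ht hS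
    have h1 : (principalIdealsPos K S ⊓ normOneIdeals K S).relIndex (normOneIdeals K S) ≠ 0 :=
      relIndex_ne_zero_of_index_ne_zero principalIdealsPos_index_ne_zero
    have h2 := relIndex_map_globalNorm_ne_zero (k := k) (S := S) hk hS_arch
      (H := totallyPositive (∀ i, K i)) fun x φ => by
        rw [Units.val_pow_eq_pow_val, map_pow]
        exact sq_pos_of_ne_zero (x.isUnit.map φ).ne_zero
    have h3 := mul_ne_zero h1 h2
    rw [key] at h3
    refine ⟨Nat.finite_of_card_ne_zero (left_ne_zero_of_mul h3), ?_⟩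
    rw [eq_div_iff (Nat.cast_ne_zero.2 h4), ← Nat.cast_mul, ← Nat.cast_mul, key]
    rfl
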